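/- Let $(M,g)$ be a smooth connected Riemannian manifold without boundary (Hausdorff, second countable), let $\Psi,\rho: M\to(0,\infty)$ and $V: M\to[0,\infty)$ be smooth, and let $\mu=\Psi\,\mathrm{vol}_g$. A function $f\in L^1_{\rm loc}(M)$ is identified with the distribution $\varphi\mapsto\int_M f\varphi\,d\mathrm{vol}_g$ on $C_c^\infty(M)$; with the distributional gradient and divergence put $\Delta u=\Psi^{-1}\operatorname{div}(\Psi\nabla u)$ and $$\mathcal L_{\rho,V}u=\rho^{-1}\Delta u-\rho^{-1}Vu ,\qquad u\in\mathcal D'(M).$$ For $\kappa=\rho+V$ let $W^1(M,\kappa)=\{f\in L^2(M,\kappa\mu) : \nabla f\in \vec L^2(M,\mu)\}$ with norm $\|f\|_{W^1}=\left(\int_M|\nabla f|^2d\mu+\int_M f^2\kappa\,d\mu\right)^{1/2}$, and let $W^1_0(M,\kappa)$ be the closure of $C_c^\infty(M)$ in $W^1(M,\kappa)$. For $f\in W^1(M,\kappa)$ write $f\ge 0 \bmod W^1_0(M,\kappa)$ if there is $h\in W^1_0(M,\kappa)$ with $f+h\ge 0$ $\mu$-a.e. **Theorem (parabolic maximum principle).**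 Let $0<T\le\infty$ and let $v:(0,T)\to W^1(M,\rho+V)$ be a path such that 1. for every $0<t<T$ the derivative $\partial_t v(t)$ exists as a strong limit in $L^2(M,\rho\mu)$; 2. $v(t)_-\to 0$ in $L^2(M,\rho\mu)$ as $t\to 0+$, where $f_-=\max\{-f,0\}$; 3. for every $0<t<T$, $v(t)\ge 0 \bmod W^1_0(M,\rho+V)$; 4. for every $0<s<T$, $(\partial_t v)(s)\ge\mathcal L_{\rho,V}(v(s))$ in the sense of $\mathcal D'(M)$, i.e. $\langle(\partial_t v)(s),\varphi\rangle\ge\langle\mathcal L_{\rho,V}(v(s)),\varphi\rangle$ for all $0\le\varphi\in C_c^\infty(M)$. Then $v\ge 0$ on $(0,T)\times M$, that is, for every $0<t<T$, $v(t)\ge 0$ $\mu$-a.e. on $M$. -/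

import Mathlib

open MeasureTheory Filter Topology Set Manifold Bundle
open scoped ContDiff ENNReal

noncomputable section

namespace WeightedManifold

/-- A smooth Riemannian metric on the `n`-dimensional smooth manifold `M`. -/
abbrev Metric (n : ℕ) (M : Type*) [TopologicalSpace M]
    [ChartedSpace (EuclideanSpace ℝ (Fin n)) M] [IsManifold (𝓡 n) ∞ M] :=
  ContMDiffRiemannianMetric (𝓡 n) ∞ (EuclideanSpace ℝ (Fin n))
    (fun x : M => TangentSpace (𝓡 n) x)

/-- Vector fields on `M` (without any regularity). -/
abbrev VectorField (n : ℕ) (M : Type*) [TopologicalSpace M]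
    [ChartedSpace (EuclideanSpace ℝ (Fin n)) M] :=
  (x : M) → TangentSpace (𝓡 n) x

section Geometry

variable {n : ℕ} {M : Type*} [TopologicalSpace M]
  [ChartedSpace (EuclideanSpace ℝ (Fin n)) M] [IsManifold (𝓡 n) ∞ M]

/-- The coordinate vector field `∂_i` of the chart at `c`, at the point `x` of its domain. -/
def coordVector (c x : M) (i : Fin n) : TangentSpace (𝓡 n) x :=
  (trivializationAt (EuclideanSpace ℝ (Fin n)) (TangentSpace (𝓡 n)) c).symmL ℝ x
    (EuclideanSpace.single i 1)

/-- The components `(X^1, …, X^n)` of a tangent vector at `x` in the chart at `c`. -/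
def components (c x : M) (X : TangentSpace (𝓡 n) x) : EuclideanSpace ℝ (Fin n) :=
  (trivializationAt (EuclideanSpace ℝ (Fin n)) (TangentSpace (𝓡 n)) c).continuousLinearMapAt ℝ x X

/-- The volume density `√(det g_{ij})` of the metric in the chart at `c`, at the point `x`. -/
def sqrtDet (g : Metric n M) (c x : M) : ℝ :=
  √(Matrix.of fun i j : Fin n => g.inner x (coordVector c x i) (coordVector c x j)).det

/-- The measure on the domain of the chart `φ` at `c`, extended by zero to `M`, that is
`√(det g_{ij}) dx^1 ⋯ dx^n` in the coordinates of `φ`. -/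
def chartVolume [MeasurableSpace M] (g : Metric n M) (c : M) : Measure M :=
  (((volume : Measure (EuclideanSpace ℝ (Fin n))).restrict
      (chartAt (EuclideanSpace ℝ (Fin n)) c).target).withDensity
    (fun y => ENNReal.ofReal
      (sqrtDet g c ((chartAt (EuclideanSpace ℝ (Fin n)) c).symm y)))).map
    (chartAt (EuclideanSpace ℝ (Fin n)) c).symm

/-- The Riemannian volume `vol_g`. The measures `chartVolume g c` agree on the overlaps of the
charts, so the smallest measure that dominates all of them is the one that restricts to
`chartVolume g c` on the domain of every chart. -/
def riemannianVolume [MeasurableSpace M] (g : Metric n M) : Measure M :=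
  ⨆ c : M, chartVolume g c

/-- The bilinear form `g_x` on the tangent space at `x`. -/
def metricForm (g : Metric n M) (x : M) : LinearMap.BilinForm ℝ (TangentSpace (𝓡 n) x) :=
  (ContinuousLinearMap.coeLM ℝ).comp (g.inner x).toLinearMap

instance instFiniteDimensionalTangentSpace (x : M) :
    FiniteDimensional ℝ (TangentSpace (𝓡 n) x) :=
  inferInstanceAs (FiniteDimensional ℝ (EuclideanSpace ℝ (Fin n)))

theorem metricForm_apply (g : Metric n M) (x : M) (v w : TangentSpace (𝓡 n) x) :
    metricForm g x v w = g.inner x v w := rfl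

theorem metricForm_nondegenerate (g : Metric n M) (x : M) : (metricForm g x).Nondegenerate := by
  refine ⟨fun v hv => ?_, fun v hv => ?_⟩ <;>
  · by_contra h
    exact (g.pos x v h).ne' (hv v)

/-- The gradient `∇f` of a differentiable function `f`. -/
def gradient (g : Metric n M) (f : M → ℝ) : VectorField n M := fun x =>
  ((metricForm g x).toDual (metricForm_nondegenerate g x)).symm
    (mvfderiv (𝓡 n) f x).toLinearMap

theorem inner_gradient (g : Metric n M) (f : M → ℝ) (x : M) (v : TangentSpace (𝓡 n) x) :
    g.inner x (gradient g f x) v = mvfderiv (𝓡 n) f x v :=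
  LinearMap.BilinForm.apply_toDual_symm_apply (hB := metricForm_nondegenerate g x) _ v

/-- The divergence of a differentiable vector field,
`div X = (det g)^{-1/2} ∑_k ∂_k ((det g)^{1/2} X^k)`, computed at `x` in the chart at `x`. -/
def divergence (g : Metric n M) (X : VectorField n M) : M → ℝ := fun x =>
  (sqrtDet g x x)⁻¹ * ∑ k : Fin n,
    fderiv ℝ (fun y : EuclideanSpace ℝ (Fin n) =>
      sqrtDet g x ((chartAt (EuclideanSpace ℝ (Fin n)) x).symm y) *
        components x ((chartAt (EuclideanSpace ℝ (Fin n)) x).symm y)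
          (X ((chartAt (EuclideanSpace ℝ (Fin n)) x).symm y)) k)
      (chartAt (EuclideanSpace ℝ (Fin n)) x x) (EuclideanSpace.single k 1)

/-- `φ ∈ 𝒟(M) = C_c^∞(M)`. -/
def IsTestFunction (n : ℕ) {M : Type*} [TopologicalSpace M]
    [ChartedSpace (EuclideanSpace ℝ (Fin n)) M] (φ : M → ℝ) : Prop :=
  ContMDiff (𝓡 n) 𝓘(ℝ) ∞ φ ∧ HasCompactSupport φ

/-- `ψ` is a smooth vector field with compact support. -/
def IsTestField (ψ : VectorField n M) : Prop :=
  ContMDiff (𝓡 n) (𝓡 n).tangent ∞ (fun x => (⟨x, ψ x⟩ : TangentBundle (𝓡 n) M)) ∧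
    ∃ K : Set M, IsCompact K ∧ ∀ x ∉ K, ψ x = 0

end Geometry

section Distributions

/-! Distributions are represented by the functionals `φ ↦ ⟨u, φ⟩`, and distributional vector
fields by the functionals `ψ ↦ ⟨ζ, ψ⟩`. Only their values at test functions, respectively at
smooth compactly supported vector fields, are meaningful and only these are ever used. The
operators on distributions are defined by transposition. -/

variable {n : ℕ} {M : Type*} [TopologicalSpace M]
  [ChartedSpace (EuclideanSpace ℝ (Fin n)) M] [IsManifold (𝓡 n) ∞ M]

/-- The distribution `φ ↦ ∫ f φ dvol_g` of a locally integrable function. -/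
def toDistribution [MeasurableSpace M] (g : Metric n M) (f : M → ℝ) : (M → ℝ) → ℝ :=
  fun φ => ∫ x, f x * φ x ∂(riemannianVolume g)

/-- The distributional vector field `ψ ↦ ∫ ⟨X, ψ⟩ dvol_g` of a locally integrable vector field. -/
def toVectorDistribution [MeasurableSpace M] (g : Metric n M) (X : VectorField n M) :
    VectorField n M → ℝ :=
  fun ψ => ∫ x, g.inner x (X x) (ψ x) ∂(riemannianVolume g)

/-- Product of a smooth function and a distribution: `⟨a u, φ⟩ = ⟨u, a φ⟩`. -/
def mulDistribution {M : Type*} (a : M → ℝ) (u : (M → ℝ) → ℝ) : (M → ℝ) → ℝ :=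
  fun φ => u (fun x => a x * φ x)

/-- Product of a smooth function and a distributional vector field: `⟨a ζ, ψ⟩ = ⟨ζ, a ψ⟩`. -/
def mulVectorDistribution (a : M → ℝ) (ζ : VectorField n M → ℝ) : VectorField n M → ℝ :=
  fun ψ => ζ (fun x => a x • ψ x)

/-- Distributional gradient: `⟨∇u, ψ⟩ = -⟨u, div ψ⟩`. -/
def distGradient (g : Metric n M) (u : (M → ℝ) → ℝ) : VectorField n M → ℝ :=
  fun ψ => -u (divergence g ψ)

/-- Distributional divergence: `⟨div ζ, φ⟩ = -⟨ζ, ∇φ⟩`. -/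
def distDivergence (g : Metric n M) (ζ : VectorField n M → ℝ) : (M → ℝ) → ℝ :=
  fun φ => -ζ (gradient g φ)

/-- The weighted Laplacian `Δu = Ψ⁻¹ div(Ψ ∇u)` on distributions. -/
def distLaplacian (g : Metric n M) (Ψ : M → ℝ) (u : (M → ℝ) → ℝ) : (M → ℝ) → ℝ :=
  mulDistribution (fun x => (Ψ x)⁻¹)
    (distDivergence g (mulVectorDistribution Ψ (distGradient g u)))

/-- The Schrödinger operator `𝓛_{ρ,V} u = ρ⁻¹ Δu - ρ⁻¹ V u` on distributions. -/
def distSchrodinger (g : Metric n M) (Ψ ρ V : M → ℝ) (u : (M → ℝ) → ℝ) : (M → ℝ) → ℝ :=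
  mulDistribution (fun x => (ρ x)⁻¹) (distLaplacian g Ψ u) -
    mulDistribution (fun x => (ρ x)⁻¹ * V x) u

/-- The inequality `u ≤ w` in the sense of `𝒟'(M)`: `⟨u, φ⟩ ≤ ⟨w, φ⟩` for every nonnegative test
function `φ`. -/
def DistributionLE (n : ℕ) {M : Type*} [TopologicalSpace M]
    [ChartedSpace (EuclideanSpace ℝ (Fin n)) M] (u w : (M → ℝ) → ℝ) : Prop :=
  ∀ φ : M → ℝ, IsTestFunction n φ → (∀ x, 0 ≤ φ x) → u φ ≤ w φ

end Distributions

section Sobolev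

variable {n : ℕ} {M : Type*} [TopologicalSpace M]
  [ChartedSpace (EuclideanSpace ℝ (Fin n)) M] [IsManifold (𝓡 n) ∞ M] [MeasurableSpace M]

/-- The measure `Ψ vol_g`. With `Ψ` the density of `μ`, this is `μ`. -/
def weightedVolume (g : Metric n M) (Ψ : M → ℝ) : Measure M :=
  (riemannianVolume g).withDensity (fun x => ENNReal.ofReal (Ψ x))

/-- The measure `κ μ`, where `μ = Ψ vol_g`. -/
def densityMeasure (g : Metric n M) (Ψ κ : M → ℝ) : Measure M :=
  (weightedVolume g Ψ).withDensity (fun x => ENNReal.ofReal (κ x))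

/-- `X` is a measurable vector field, i.e. it has measurable components in every chart (up to
null sets), and `∫ |X|² dμ < ∞`, where `μ = Ψ vol_g`. -/
def IsL2Field (g : Metric n M) (Ψ : M → ℝ) (X : VectorField n M) : Prop :=
  (∀ c : M, AEMeasurable (fun x => components c x (X x))
      ((riemannianVolume g).restrict (chartAt (EuclideanSpace ℝ (Fin n)) c).source)) ∧
    ∫⁻ x, ENNReal.ofReal (g.inner x (X x) (X x)) ∂(weightedVolume g Ψ) < ⊤

/-- The distributional gradient of `f` is the square integrable vector field `X`. -/
def IsL2Gradient (g : Metric n M) (Ψ : M → ℝ) (f : M → ℝ) (X : VectorField n M) : Prop :=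
  IsL2Field g Ψ X ∧ ∀ ψ : VectorField n M, IsTestField ψ →
    distGradient g (toDistribution g f) ψ = toVectorDistribution g X ψ

/-- The Sobolev space `W^1(M, κ)`: functions in `L²(M, κ μ)` with distributional gradient in
`L²(M, μ)`, where `μ = Ψ vol_g`. -/
def MemW1 (g : Metric n M) (Ψ κ : M → ℝ) (f : M → ℝ) : Prop :=
  MemLp f 2 (densityMeasure g Ψ κ) ∧ ∃ X : VectorField n M, IsL2Gradient g Ψ f X

/-- The norm `‖f‖_{W^1} = (∫ |∇f|² dμ + ∫ f² κ dμ)^{1/2}`. The infimum runs over all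
representatives `X` of the distributional gradient (which agree almost everywhere). -/
def normW1 (g : Metric n M) (Ψ κ : M → ℝ) (f : M → ℝ) : ℝ≥0∞ :=
  (⨅ (X : VectorField n M) (_ : IsL2Gradient g Ψ f X),
    ((∫⁻ x, ENNReal.ofReal (g.inner x (X x) (X x)) ∂(weightedVolume g Ψ)) +
      ∫⁻ x, ENNReal.ofReal (f x ^ 2) ∂(densityMeasure g Ψ κ))) ^ (1 / 2 : ℝ)

/-- The space `W^1_0(M, κ)`: the closure of `C_c^∞(M)` in `W^1(M, κ)`. -/
def MemW10 (g : Metric n M) (Ψ κ : M → ℝ) (f : M → ℝ) : Prop :=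
  MemW1 g Ψ κ f ∧ ∀ ε : ℝ≥0∞, 0 < ε →
    ∃ φ : M → ℝ, IsTestFunction n φ ∧ normW1 g Ψ κ (fun x => f x - φ x) < ε

/-- `f ≥ 0 mod W^1_0(M, κ)`: there is `h ∈ W^1_0(M, κ)` with `f + h ≥ 0` almost everywhere. -/
def NonnegModW10 (g : Metric n M) (Ψ κ : M → ℝ) (f : M → ℝ) : Prop :=
  ∃ h : M → ℝ, MemW10 g Ψ κ h ∧ ∀ᵐ x ∂(weightedVolume g Ψ), 0 ≤ f x + h x

end Sobolev

end WeightedManifold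

end

set_option linter.unusedSectionVars false

noncomputable section

namespace WeightedManifold

/-! ### The Piola identity for changes of coordinates -/

section Piola

variable {n : ℕ}

local notation "𝔼" => EuclideanSpace ℝ (Fin n)

/-! The proof is an energy argument. Formally, the supersolution inequality at time `s` is tested
with the nonnegative function `trunc δ (-v)`, a smoothed version of the negative part of `v + δ`. As
`trunc δ` is nondecreasing, the gradient term `-∫ ⟨∇v, ∇ trunc δ (-v)⟩ dμ` is nonnegative. As `trunc
δ (-v)` vanishes where `v ≥ 0`, so is the potential term `-∫ V v trunc δ (-v) dμ`. Hence `∫ trunc δ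
(-v) ∂ₜv ρ dμ ≥ 0`. This integral is minus the time derivative of `J(t) = ∫ truncInt δ (-v(t)) ρ
dμ`, so `J` is nonincreasing. It lies between `0` and the squared norm of the negative part of
`v(t)`, which tends to `0` as `t → 0+`; therefore `J` vanishes. Since `truncInt δ` is positive
beyond `2δ`, this forces `v ≥ -2δ` (`ae_neg_le_of_energy`), and `δ → 0` concludes.

The difficulty is that `trunc δ (-v)` is not a test function. The boundary condition gives `h` in
`W¹₀` with `v + h ≥ 0`. The function `truncDiff δ a b = trunc δ (-a) - trunc δ (-a - ramp δ b)`
vanishes for `b = 0` and equals `trunc δ (-a)` when `a + b ≥ 0`. For test functions `u`, `φ` the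
function `truncDiff δ u φ` is thus a smooth, nonnegative, compactly supported substitute. Two
successive limits are taken. With `φ` fixed, `u → v` together with gradients on the support of `φ`
(`truncDiff_inequality`). Then `φ → h` in `L²` with gradients merely bounded in `L²`
(`integral_trunc_mul_nonneg`): the coefficient of `∇φ` tends to `0` because `v + h ≥ 0`, and Young's
inequality absorbs the rest.

Two facts on weak gradients support this. Locally, a function with square integrable weak gradient
is a limit of test functions (`IsLocalGradient.exists_approx`), by mollification in charts and a
partition of unity. Weak gradients are unique almost everywhere (`gradient_ae_eq_of_sub`), which
turns closeness in the `W¹` norm into a bound for the classical gradient of `φ`. Both pass to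
coordinates through `integral_chart_weak`, which rests on the Piola identity `sum_fderiv_pullback`,
because the divergence at each point is computed in that point's own chart. -/

theorem hasFDerivAt_inverse_curve {F G : Type*} [NormedAddCommGroup F] [NormedSpace ℝ F]
    [NormedAddCommGroup G] [NormedSpace ℝ G] [CompleteSpace G] {A B : F → G →L[ℝ] G}
    {y₀ : F} {D : F →L[ℝ] G →L[ℝ] G} (hA : HasFDerivAt A D y₀)
    (hBA : ∀ᶠ y in 𝓝 y₀, B y ∘L A y = ContinuousLinearMap.id ℝ G)
    (hAB : ∀ᶠ y in 𝓝 y₀, A y ∘L B y = ContinuousLinearMap.id ℝ G) :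
    ∃ L : F →L[ℝ] G →L[ℝ] G, HasFDerivAt B L y₀ ∧ ∀ v w, L v w = -(B y₀ (D v (B y₀ w))) := by
  let U : (G →L[ℝ] G)ˣ := ⟨A y₀, B y₀, hAB.self_of_nhds, hBA.self_of_nhds⟩
  have hBinv : B =ᶠ[𝓝 y₀] fun y => Ring.inverse (A y) := by
    filter_upwards [hBA, hAB] with y h1 h2
    let V : (G →L[ℝ] G)ˣ := ⟨A y, B y, h2, h1⟩
    exact (Ring.inverse_unit V).symm
  have h := hasFDerivAt_ringInverse (𝕜 := ℝ) U
  exact ⟨_, (HasFDerivAt.comp y₀ (f := A) h hA).congr_of_eventuallyEq hBinv, fun v w => rfl⟩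

theorem differentiable_det : Differentiable ℝ (fun A : 𝔼 →L[ℝ] 𝔼 => A.det) := by
  have h : (fun A : 𝔼 →L[ℝ] 𝔼 => A.det) = fun A => ∑ σ : Equiv.Perm (Fin n),
      ((Equiv.Perm.sign σ : ℤ) : ℝ) *
        ∏ i, (EuclideanSpace.basisFun (Fin n) ℝ).toBasis.repr
          (A ((EuclideanSpace.basisFun (Fin n) ℝ).toBasis i)) (σ i) := by
    ext A
    rw [ContinuousLinearMap.det, ← LinearMap.det_toMatrix
      (EuclideanSpace.basisFun (Fin n) ℝ).toBasis, Matrix.det_apply']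
    simp [LinearMap.toMatrix_apply]
  rw [h]
  simp only [OrthonormalBasis.coe_toBasis_repr_apply, OrthonormalBasis.coe_toBasis,
    EuclideanSpace.basisFun_apply, EuclideanSpace.basisFun_repr]
  refine Differentiable.fun_sum fun σ _ => (differentiable_const _).mul ?_
  exact fun A => (HasFDerivAt.finsetProd fun i _ => (EuclideanSpace.proj (𝕜 := ℝ) (σ i) ∘L
    ContinuousLinearMap.apply ℝ 𝔼 (EuclideanSpace.single i (1 : ℝ))).hasFDerivAt).differentiableAt

theorem trace_eq_sum_apply_single (f : 𝔼 →L[ℝ] 𝔼) :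
    LinearMap.trace ℝ 𝔼 f = ∑ k, f (EuclideanSpace.single k 1) k := by
  rw [LinearMap.trace_eq_sum_inner _ (EuclideanSpace.basisFun (Fin n) ℝ)]
  simp [PiLp.inner_apply]

theorem hasDerivAt_comp_line {G : Type*} [NormedAddCommGroup G] [NormedSpace ℝ G] {f : G → ℝ}
    {a : G} (hf : DifferentiableAt ℝ f a) (b : G) :
    HasDerivAt (fun t : ℝ => f (a + t • b)) (fderiv ℝ f a b) 0 := by
  have h2 : HasDerivAt (fun t : ℝ => a + t • b) b 0 := by
    simpa using ((hasDerivAt_id (0 : ℝ)).smul_const b).const_add a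
  have h3 : HasFDerivAt f (fderiv ℝ f a) (a + (0 : ℝ) • b) := by
    simpa using hf.hasFDerivAt
  exact h3.comp_hasDerivAt 0 h2

/-- Along the line `1 + t B` the determinant is a polynomial in `t` whose linear coefficient is the
trace; uniqueness of the one-variable derivative identifies the two. -/
theorem fderiv_det_one (B : 𝔼 →L[ℝ] 𝔼) :
    fderiv ℝ (fun A : 𝔼 →L[ℝ] 𝔼 => A.det) 1 B = LinearMap.trace ℝ 𝔼 B := by
  have h1 : HasDerivAt (fun t : ℝ => (1 + t • B).det) 
      (fderiv ℝ (fun A : 𝔼 →L[ℝ] 𝔼 => A.det) 1 B) 0 :=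
    hasDerivAt_comp_line (differentiable_det (n := n) 1) B
  have h4 : ∃ q : Polynomial ℝ, (fun t : ℝ => (1 + t • B).det) = 
      fun t => 1 + LinearMap.trace ℝ 𝔼 B * t + q.eval t * t ^ 2 := by
    set b := (EuclideanSpace.basisFun (Fin n) ℝ).toBasis
    obtain ⟨q, hq⟩ : ∃ q : Polynomial ℝ, ∀ t : ℝ,
        (1 + t • LinearMap.toMatrix b b (B : 𝔼 →ₗ[ℝ] 𝔼)).det =
          1 + (LinearMap.toMatrix b b (B : 𝔼 →ₗ[ℝ] 𝔼)).trace * t + q.eval t * t ^ 2 :=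
      ⟨_, fun t => Matrix.det_one_add_smul t _⟩
    refine ⟨q, funext fun t => ?_⟩
    rw [ContinuousLinearMap.det, ← LinearMap.det_toMatrix b, LinearMap.trace_eq_matrix_trace ℝ b,
      ← hq]
    have : ((1 + t • B : 𝔼 →L[ℝ] 𝔼) : 𝔼 →ₗ[ℝ] 𝔼) = LinearMap.id + t • (B : 𝔼 →ₗ[ℝ] 𝔼) := rfl
    rw [this, map_add, map_smul, LinearMap.toMatrix_id]
  obtain ⟨q, hq⟩ := h4
  rw [hq] at h1
  have h5 : HasDerivAt (fun t : ℝ => 1 + LinearMap.trace ℝ 𝔼 B * t + q.eval t * t ^ 2)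
      (LinearMap.trace ℝ 𝔼 B) 0 := by
    refine ((((hasDerivAt_id' (0 : ℝ)).const_mul (LinearMap.trace ℝ 𝔼 B)).const_add 1).add
      ((q.hasDerivAt 0).mul ((hasDerivAt_id' (0 : ℝ)).pow 2))).congr_deriv ?_
    simp
  exact h1.unique h5

/-- The Piola identity: the divergence of the pull-back of the field `η w` under `z`. -/
theorem sum_fderiv_pullback (z : 𝔼 → 𝔼) (y₀ : 𝔼) (hz : ContDiffAt ℝ 2 z y₀)
    (B : 𝔼 → 𝔼 →L[ℝ] 𝔼) (hBA : ∀ᶠ y in 𝓝 y₀, B y ∘L fderiv ℝ z y = ContinuousLinearMap.id ℝ 𝔼)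
    (hAB : ∀ᶠ y in 𝓝 y₀, fderiv ℝ z y ∘L B y = ContinuousLinearMap.id ℝ 𝔼)
    (η : 𝔼 → ℝ) (hη : DifferentiableAt ℝ η (z y₀)) (w : 𝔼) :
    ∑ k, fderiv ℝ (fun y => |(fderiv ℝ z y).det| * η (z y) * (B y w) k) y₀
        (EuclideanSpace.single k 1) = |(fderiv ℝ z y₀).det| * fderiv ℝ η (z y₀) w := by
  set A : 𝔼 → 𝔼 →L[ℝ] 𝔼 := fderiv ℝ z with hA
  set D := fderiv ℝ A y₀ with hD
  have hAd : HasFDerivAt A D y₀ :=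
    ((hz.fderiv_right (m := 1) (by norm_num)).differentiableAt one_ne_zero).hasFDerivAt
  have hsymm : ∀ u v, D u v = D v u := by
    have := hz.isSymmSndFDerivAt (by simp)
    exact fun u v => this u v
  have hB0 := hBA.self_of_nhds
  have hA0 := hAB.self_of_nhds
  obtain ⟨L, hBd, hL⟩ := hasFDerivAt_inverse_curve hAd hBA hAB
  -- Composing with the fixed inverse `B y₀` moves the base point to the identity, where the
  -- derivative of the determinant is the trace.
  have hdet : HasFDerivAt (fun y => (B y₀ ∘L A y).det)
      ((fderiv ℝ (fun A : 𝔼 →L[ℝ] 𝔼 => A.det) 1) ∘L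
        ((ContinuousLinearMap.compL ℝ 𝔼 𝔼 𝔼 (B y₀)) ∘L D)) y₀ := by
    have h1 : HasFDerivAt (fun y => B y₀ ∘L A y)
        ((ContinuousLinearMap.compL ℝ 𝔼 𝔼 𝔼 (B y₀)) ∘L D) y₀ :=
      (ContinuousLinearMap.compL ℝ 𝔼 𝔼 𝔼 (B y₀)).hasFDerivAt.comp y₀ hAd
    have h2 : HasFDerivAt (fun A : 𝔼 →L[ℝ] 𝔼 => A.det)
        (fderiv ℝ (fun A : 𝔼 →L[ℝ] 𝔼 => A.det) 1) (B y₀ ∘L A y₀) := by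
      rw [hB0]; exact (differentiable_det (n := n) 1).hasFDerivAt
    exact h2.comp y₀ h1
  have hone : (B y₀ ∘L A y₀).det = 1 := by
    rw [hB0]; exact LinearMap.det_id
  -- The normalised determinant is near `1`, hence positive, so the absolute value only affects the
  -- constant factor and differentiability survives.
  have habs : (fun y => |(A y).det|) =ᶠ[𝓝 y₀] fun y => |(A y₀).det| * (B y₀ ∘L A y).det := by
    have hpos : ∀ᶠ y in 𝓝 y₀, 0 < (B y₀ ∘L A y).det :=
      hdet.continuousAt.eventually (lt_mem_nhds (by simp only [hone]; exact one_pos))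
    filter_upwards [hpos] with y hy
    have : A y = A y₀ ∘L (B y₀ ∘L A y) := by
      rw [← ContinuousLinearMap.comp_assoc, hA0, ContinuousLinearMap.id_comp]
    have h3 : (A y).det = (A y₀).det * (B y₀ ∘L A y).det := by
      conv_lhs => rw [this]
      exact LinearMap.det_comp _ _
    rw [h3, abs_mul, abs_of_pos hy]
  have hηd : HasFDerivAt (fun y => η (z y)) (fderiv ℝ η (z y₀) ∘L A y₀) y₀ :=
    hη.hasFDerivAt.comp y₀ (hz.differentiableAt two_ne_zero).hasFDerivAt
  have hcomp : ∀ k, HasFDerivAt (fun y => (B y w) k) ((EuclideanSpace.proj (𝕜 := ℝ) k) ∘L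
      ((ContinuousLinearMap.apply ℝ 𝔼 w) ∘L L)) y₀ := fun k =>
    (EuclideanSpace.proj (𝕜 := ℝ) k).hasFDerivAt.comp y₀
      ((ContinuousLinearMap.apply ℝ 𝔼 w).hasFDerivAt.comp y₀ hBd)
  set u := B y₀ w with hu
  -- The three summands come from the determinant, from `η` and from the inverse `B`. By symmetry of
  -- the second derivative the first and the last both sum over `k` to a multiple of the trace of `B
  -- y₀ ∘L D u`, and they cancel.
  have hterm : ∀ k, fderiv ℝ (fun y => |(A y).det| * η (z y) * (B y w) k) y₀
        (EuclideanSpace.single k 1) =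
      |(A y₀).det| * η (z y₀) * (u k * LinearMap.trace ℝ 𝔼
          (B y₀ ∘L D (EuclideanSpace.single k 1) : 𝔼 →L[ℝ] 𝔼))
      + |(A y₀).det| * (u k * fderiv ℝ η (z y₀) (A y₀ (EuclideanSpace.single k 1)))
      - |(A y₀).det| * η (z y₀) * (B y₀ ∘L D u) (EuclideanSpace.single k 1) k := by
    intro k
    have h1 : HasFDerivAt (fun y => |(A y).det|) _ y₀ :=
      (hdet.const_mul (|(A y₀).det|)).congr_of_eventuallyEq habs
    have h2 := ((h1.mul hηd).mul (hcomp k)).fderiv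
    simp only [Pi.mul_def] at h2
    rw [h2]
    have h3 := fderiv_det_one (B y₀ ∘L D (EuclideanSpace.single k 1))
    simp only [add_apply, smul_apply,
      ContinuousLinearMap.comp_apply, ContinuousLinearMap.compL_apply, smul_eq_mul] at h3 ⊢
    rw [h3, ← hu, hsymm u]
    simp [hL, ← hu]
    ring
  rw [Finset.sum_congr rfl fun k _ => hterm k, Finset.sum_sub_distrib, Finset.sum_add_distrib,
    ← Finset.mul_sum, ← Finset.mul_sum, ← Finset.mul_sum, ← trace_eq_sum_apply_single]
  have hsum : ∑ k, u k • (EuclideanSpace.single k 1 : 𝔼) = u := by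
    conv_rhs => rw [← (EuclideanSpace.basisFun (Fin n) ℝ).sum_repr u]
    simp
  have e1 : ∑ k, u k * LinearMap.trace ℝ 𝔼 (B y₀ ∘L D (EuclideanSpace.single k 1) : 𝔼 →L[ℝ] 𝔼)
      = LinearMap.trace ℝ 𝔼 (B y₀ ∘L D u : 𝔼 →L[ℝ] 𝔼) := by
    conv_rhs => rw [← hsum, map_sum, ContinuousLinearMap.comp_finsetSum]
    simp [map_smul]
  have e2 : ∑ k, u k * fderiv ℝ η (z y₀) (A y₀ (EuclideanSpace.single k 1)) =
      fderiv ℝ η (z y₀) w := by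
    have : A y₀ u = w := congrArg (fun L => L w) hA0
    rw [← this]
    conv_rhs => rw [← hsum, map_sum, map_sum]
    simp
  rw [e1, e2]
  ring

end Piola

/-! ### Friedrichs mollification in Euclidean space -/

section Mollification

theorem eLpNorm_two_sq {α : Type*} [MeasurableSpace α] {μ : Measure α} (f : α → ℝ) :
    eLpNorm f 2 μ ^ 2 = ∫⁻ x, ‖f x‖ₑ ^ 2 ∂μ := by
  have := eLpNorm_nnreal_pow_eq_lintegral (f := f) (μ := μ) (p := 2) two_ne_zero
  simpa only [NNReal.coe_ofNat, ENNReal.coe_ofNat, ENNReal.rpow_ofNat] using this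

theorem lintegral_enorm_sq_lt_top {α : Type*} [MeasurableSpace α] {μ : Measure α} {f : α → ℝ}
    (hf : MemLp f 2 μ) : ∫⁻ x, ‖f x‖ₑ ^ 2 ∂μ < ⊤ := by
  rw [← eLpNorm_two_sq]
  exact ENNReal.pow_lt_top hf.eLpNorm_lt_top

theorem memLp_two_of_lintegral_enorm_sq {α : Type*} [MeasurableSpace α] {μ : Measure α} {f : α → ℝ}
    (hf : AEStronglyMeasurable f μ) (h : ∫⁻ x, ‖f x‖ₑ ^ 2 ∂μ < ⊤) : MemLp f 2 μ := by
  refine ⟨hf, ?_⟩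
  rw [← eLpNorm_two_sq] at h
  exact (ENNReal.pow_lt_top_iff.1 h).resolve_right two_ne_zero

theorem lintegral_sq_le_of_isProbabilityMeasure {α : Type*} [MeasurableSpace α] (ν : Measure α)
    [IsProbabilityMeasure ν] {k : α → ℝ≥0∞} (hk : AEMeasurable k ν) :
    (∫⁻ t, k t ∂ν) ^ 2 ≤ ∫⁻ t, k t ^ 2 ∂ν := by
  have h := ENNReal.lintegral_mul_le_Lp_mul_Lq ν Real.HolderConjugate.two_two hk
    (aemeasurable_const (b := (1 : ℝ≥0∞)))
  simp only [Pi.mul_apply, mul_one, ENNReal.one_rpow, lintegral_one, measure_univ] at h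
  calc (∫⁻ t, k t ∂ν) ^ 2 ≤ ((∫⁻ t, k t ^ (2 : ℝ) ∂ν) ^ (1 / 2 : ℝ)) ^ 2 := by gcongr
    _ = ∫⁻ t, k t ^ 2 ∂ν := by
      rw [← ENNReal.rpow_natCast, ← ENNReal.rpow_mul]
      norm_num

variable {E : Type*} [NormedAddCommGroup E] [NormedSpace ℝ E] [FiniteDimensional ℝ E]
  [MeasurableSpace E] [BorelSpace E] {μ : Measure E} [μ.IsAddHaarMeasure]

theorem tendsto_eLpNorm_translate_sub {F : E → ℝ} (hF : MemLp F 2 μ) :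
    Tendsto (fun t : E => eLpNorm (fun x => F (x - t) - F x) 2 μ) (𝓝 0) (𝓝 0) := by
  have : Fact ((1 : ℝ≥0∞) ≤ 2) := ⟨one_le_two⟩
  have : Fact ((2 : ℝ≥0∞) ≠ ⊤) := ⟨ENNReal.ofNat_ne_top⟩
  have : ProperSpace E := FiniteDimensional.proper_real E
  have hcont : Continuous fun t : E => DomAddAct.mk (-t) +ᵥ hF.toLp F := by fun_prop
  have h0 := hcont.tendsto 0
  rw [neg_zero, tendsto_iff_edist_tendsto_0] at h0
  refine h0.congr fun t => ?_
  rw [DomAddAct.mk_vadd_toLp, DomAddAct.mk_vadd_toLp, Lp.edist_toLp_toLp]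
  refine eLpNorm_congr_ae (Eventually.of_forall fun x => ?_)
  simp [vadd_eq_add, sub_eq_neg_add]

open ContinuousLinearMap in
-- The normalised bump is a probability density, so the difference at `x` is the average of `F (x -
-- t) - F x` over small `t`. Jensen's inequality for the square and Tonelli's theorem reduce the
-- claim to single translates.
theorem lintegral_convolution_sub_sq_le {F : E → ℝ} (hF : MemLp F 2 μ) (φ : ContDiffBump (0 : E))
    {ε : ℝ≥0∞} (hε : ∀ t ∈ Metric.ball (0 : E) φ.rOut, eLpNorm (fun x => F (x - t) - F x) 2 μ ≤ ε) :
    ∫⁻ x, ‖convolution (φ.normed μ) F (lsmul ℝ ℝ) μ x - F x‖ₑ ^ 2 ∂μ ≤ ε ^ 2 := by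
  have hloc : LocallyIntegrable F μ := hF.locallyIntegrable one_le_two
  set η := φ.normed μ with hη
  have hηc : Continuous η := φ.continuous_normed
  have hηm : Measurable fun t => ‖η t‖ₑ := hηc.measurable.enorm
  set ν := μ.withDensity fun t => ‖η t‖ₑ with hν
  have hprob : IsProbabilityMeasure ν := by
    refine ⟨?_⟩
    rw [hν, withDensity_apply _ MeasurableSet.univ, Measure.restrict_univ]
    have h1 := ofReal_integral_eq_lintegral_ofReal (φ.integrable_normed (μ := μ))
      (Eventually.of_forall φ.nonneg_normed)
    rw [φ.integral_normed, ENNReal.ofReal_one] at h1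
    rw [h1]
    exact lintegral_congr fun t => Real.enorm_of_nonneg (φ.nonneg_normed t)
  have hpm : AEStronglyMeasurable (fun p : E × E => F (p.1 - p.2) - F p.1) (μ.prod μ) :=
    (hF.1.comp_quasiMeasurePreserving (quasiMeasurePreserving_sub μ μ)).sub
      hF.1.comp_fst
  have hac : ν ≪ μ := withDensity_absolutelyContinuous _ _
  have hpn := hpm.mono_ac (Measure.AbsolutelyContinuous.rfl.prod hac)
  have hpm' : AEMeasurable (fun p : E × E => ‖F (p.1 - p.2) - F p.1‖ₑ) (μ.prod ν) := hpn.enorm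
  have hpt : ∀ᵐ x ∂μ, ‖convolution η F (lsmul ℝ ℝ) μ x - F x‖ₑ ^ 2 ≤
      ∫⁻ t, ‖F (x - t) - F x‖ₑ ^ 2 ∂ν := by
    filter_upwards [hpn.prodMk_left] with x hx'
    have hx := hx'.enorm
    have h1 : convolution η F (lsmul ℝ ℝ) μ x - F x = ∫ t, η t * (F (x - t) - F x) ∂μ := by
      have hex : Integrable (fun t => η t * F (x - t)) μ :=
        φ.hasCompactSupport_normed.convolutionExists_left (lsmul ℝ ℝ) hηc hloc x
      simp_rw [mul_sub]
      rw [integral_sub hex (φ.integrable_normed.mul_const _), integral_mul_const, φ.integral_normed,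
        one_mul]
      rfl
    refine le_trans ?_ (lintegral_sq_le_of_isProbabilityMeasure ν hx)
    gcongr
    rw [h1]
    refine (enorm_integral_le_lintegral_enorm _).trans_eq ?_
    rw [hν, lintegral_withDensity_eq_lintegral_mul₀' hηm.aemeasurable hx]
    simp [enorm_mul]
  refine (lintegral_mono_ae hpt).trans ?_
  rw [lintegral_lintegral_swap (hpm'.pow_const 2)]
  have hin : ∀ᵐ t ∂ν, ∫⁻ x, ‖F (x - t) - F x‖ₑ ^ 2 ∂μ ≤ ε ^ 2 := by
    rw [hν, ae_withDensity_iff hηm]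
    refine Eventually.of_forall fun t ht => ?_
    have : t ∈ Function.support η := by simpa using ht
    rw [hη, φ.support_normed_eq] at this
    have h2 := hε t this
    rw [← eLpNorm_two_sq]
    gcongr
  refine (lintegral_mono_ae hin).trans ?_
  simp

open ContinuousLinearMap in
-- The derivative falls on the mollifier, and `t ↦ η (x - t)` is itself an admissible test function
-- for the weak identity; the reflection supplies the sign.
theorem fderiv_convolution_of_weak {F D : E → ℝ} (hF : LocallyIntegrable F μ) {η : E → ℝ} {w : E}
    (hη : ContDiff ℝ ∞ η) (hηc : HasCompactSupport η)
    (hD : ∀ ψ : E → ℝ, ContDiff ℝ ∞ ψ → HasCompactSupport ψ →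
      ∫ x, F x * fderiv ℝ ψ x w ∂μ = -∫ x, D x * ψ x ∂μ) (x : E) :
    fderiv ℝ (convolution η F (lsmul ℝ ℝ) μ) x w = convolution η D (lsmul ℝ ℝ) μ x := by
  have hη1 : ContDiff ℝ 1 η := hη.of_le (by simp)
  rw [(hηc.hasFDerivAt_convolution_left (lsmul ℝ ℝ) hη1 hF x).fderiv]
  have hex : Integrable (fun t => ((lsmul ℝ ℝ : ℝ →L[ℝ] ℝ →L[ℝ] ℝ).precompL E) (fderiv ℝ η t)
      (F (x - t))) μ :=
    (hηc.fderiv ℝ).convolutionExists_left _ (hη1.continuous_fderiv one_ne_zero) hF x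
  rw [convolution, ContinuousLinearMap.integral_apply hex]
  have h1 := hD (fun t => η (x - t)) (hη.comp (contDiff_const.sub contDiff_id))
    (hηc.comp_homeomorph (Homeomorph.subLeft x))
  have h2 : ∀ t, fderiv ℝ (fun t => η (x - t)) t w = -fderiv ℝ η (x - t) w := by
    intro t
    have hc : HasFDerivAt (fun t : E => x - t) (-ContinuousLinearMap.id ℝ E) t :=
      (hasFDerivAt_id t).const_sub x
    have := ((hη1.differentiable one_ne_zero (x - t)).hasFDerivAt.comp t hc).fderiv
    simp only [Function.comp_def] at this
    rw [this]; simp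
  simp_rw [h2, mul_neg, integral_neg] at h1
  rw [convolution_lsmul_swap]
  calc _ = ∫ t, fderiv ℝ η t w * F (x - t) ∂μ := rfl
    _ = ∫ t, F t * fderiv ℝ η (x - t) w ∂μ := by
      rw [← integral_sub_left_eq_self _ μ x]
      simp [mul_comm]
    _ = ∫ t, D t * η (x - t) ∂μ := neg_injective h1
    _ = _ := by simp [mul_comm]

open ContinuousLinearMap in
/-- Friedrichs mollification of a compactly supported function with weak partial derivatives
`D i` in the directions `w i`. -/
theorem exists_smooth_approx {ι : Type*} [Finite ι] {K U : Set E} (hK : IsCompact K)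
    (hU : IsOpen U) (hKU : K ⊆ U) {F : E → ℝ} (hF : MemLp F 2 μ) (hFK : ∀ x ∉ K, F x = 0)
    (w : ι → E) {D : ι → E → ℝ} (hDL : ∀ i, MemLp (D i) 2 μ)
    (hD : ∀ i, ∀ ψ : E → ℝ, ContDiff ℝ ∞ ψ → HasCompactSupport ψ →
      ∫ x, F x * fderiv ℝ ψ x (w i) ∂μ = -∫ x, D i x * ψ x ∂μ) {δ : ℝ≥0∞} (hδ : 0 < δ) :
    ∃ u : E → ℝ, ContDiff ℝ ∞ u ∧ HasCompactSupport u ∧ tsupport u ⊆ U ∧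
      ∫⁻ x, ‖u x - F x‖ₑ ^ 2 ∂μ ≤ δ ∧
      ∀ i, ∫⁻ x, ‖fderiv ℝ u x (w i) - D i x‖ₑ ^ 2 ∂μ ≤ δ := by
  have : ProperSpace E := FiniteDimensional.proper_real E
  set ε : ℝ≥0∞ := δ ^ (1 / 2 : ℝ) with hεdef
  have hε : 0 < ε := by
    by_cases h : δ = ⊤
    · simp [hεdef, h]
    · exact ENNReal.rpow_pos hδ h
  have hε2 : ε ^ 2 = δ := by
    rw [hεdef, ← ENNReal.rpow_natCast, ← ENNReal.rpow_mul]; norm_num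
  obtain ⟨r₁, hr₁, hr₁U⟩ := hK.exists_cthickening_subset_open hU hKU
  have hall : ∀ᶠ t : E in 𝓝 0, eLpNorm (fun x => F (x - t) - F x) 2 μ ≤ ε ∧
      ∀ i, eLpNorm (fun x => D i (x - t) - D i x) 2 μ ≤ ε :=
    ((tendsto_eLpNorm_translate_sub hF).eventually (Iic_mem_nhds hε)).and
      (eventually_all.2 fun i => (tendsto_eLpNorm_translate_sub (hDL i)).eventually
        (Iic_mem_nhds hε))
  obtain ⟨r₂, hr₂, hr₂b⟩ := Metric.eventually_nhds_iff_ball.1 hall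
  -- The bound `r₁` keeps the support inside `U`; the bound `r₂` makes all translates of `F` and of
  -- the `D i` close to the originals.
  set r := min r₁ r₂
  have hr : 0 < r := lt_min hr₁ hr₂
  let φ : ContDiffBump (0 : E) := ⟨r / 2, r, by positivity, by linarith⟩
  have hsub : ∀ t ∈ Metric.ball (0 : E) φ.rOut, t ∈ Metric.ball (0 : E) r₂ := fun t ht =>
    Metric.ball_subset_ball (min_le_right _ _) ht
  have hloc : LocallyIntegrable F μ := hF.locallyIntegrable one_le_two
  have hsupp : tsupport (convolution (φ.normed μ) F (lsmul ℝ ℝ) μ) ⊆ Metric.cthickening r₁ K := by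
    refine closure_minimal ?_ Metric.isClosed_cthickening
    refine (support_convolution_subset (lsmul ℝ ℝ)).trans ?_
    rintro _ ⟨a, ha, b, hb, rfl⟩
    rw [φ.support_normed_eq] at ha
    have hbK : b ∈ K := by by_contra h; exact hb (hFK b h)
    refine Metric.mem_cthickening_of_dist_le _ b _ _ hbK ?_
    rw [mem_ball_zero_iff] at ha
    simpa using ha.le.trans (min_le_left _ _)
  refine ⟨convolution (φ.normed μ) F (lsmul ℝ ℝ) μ,
    φ.hasCompactSupport_normed.contDiff_convolution_left (n := ⊤) _ φ.contDiff_normed hloc,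
    hK.cthickening.of_isClosed_subset (isClosed_tsupport _) hsupp, hsupp.trans hr₁U, ?_, ?_⟩
  · rw [← hε2]
    exact lintegral_convolution_sub_sq_le hF φ fun t ht => (hr₂b t (hsub t ht)).1
  · intro i
    simp_rw [fderiv_convolution_of_weak hloc φ.contDiff_normed φ.hasCompactSupport_normed (hD i)]
    rw [← hε2]
    exact lintegral_convolution_sub_sq_le (hDL i) φ fun t ht => (hr₂b t (hsub t ht)).2 i

end Mollification

/-! ### Smooth truncations of the positive part -/

section Truncation

/-- A smooth nondecreasing function that vanishes on `(-∞, 0]` and has slope `1` on `[δ, ∞)`. -/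
def ramp (δ s : ℝ) : ℝ := ∫ τ in (0 : ℝ)..s, Real.smoothTransition (τ / δ)

/-- The derivative of `ramp δ`. -/
def rampDeriv (δ s : ℝ) : ℝ := Real.smoothTransition (s / δ)

/-- A smooth convex approximation of the positive part that vanishes on `(-∞, δ]`. -/
def trunc (δ s : ℝ) : ℝ := ramp δ (s - δ)

/-- The primitive of `trunc δ`. -/
def truncInt (δ s : ℝ) : ℝ := ∫ τ in (0 : ℝ)..s, trunc δ τ

variable {δ : ℝ}

theorem continuous_rampDeriv (δ : ℝ) : Continuous (rampDeriv δ) :=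
  Real.smoothTransition.continuous.comp (continuous_id.div_const δ)

theorem contDiff_rampDeriv (δ : ℝ) : ContDiff ℝ ∞ (rampDeriv δ) :=
  (Real.smoothTransition.contDiff (n := ⊤)).comp (contDiff_id.div_const δ)

theorem hasDerivAt_ramp (δ s : ℝ) : HasDerivAt (ramp δ) (rampDeriv δ s) s :=
  (continuous_rampDeriv δ).integral_hasStrictDerivAt 0 s |>.hasDerivAt

theorem deriv_ramp (δ : ℝ) : deriv (ramp δ) = rampDeriv δ :=
  funext fun s => (hasDerivAt_ramp δ s).deriv

theorem contDiff_ramp (δ : ℝ) : ContDiff ℝ ∞ (ramp δ) := by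
  rw [contDiff_infty_iff_deriv, deriv_ramp]
  exact ⟨fun s => (hasDerivAt_ramp δ s).differentiableAt, contDiff_rampDeriv δ⟩

theorem rampDeriv_nonneg (δ s : ℝ) : 0 ≤ rampDeriv δ s := Real.smoothTransition.nonneg _

theorem rampDeriv_le_one (δ s : ℝ) : rampDeriv δ s ≤ 1 := Real.smoothTransition.le_one _

theorem rampDeriv_mono (hδ : 0 < δ) : Monotone (rampDeriv δ) := fun _ _ h =>
  Real.smoothTransition.monotone (by gcongr)

theorem rampDeriv_of_nonpos (hδ : 0 < δ) {s : ℝ} (hs : s ≤ 0) : rampDeriv δ s = 0 :=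
  Real.smoothTransition.zero_of_nonpos (div_nonpos_of_nonpos_of_nonneg hs hδ.le)

theorem ramp_zero (δ : ℝ) : ramp δ 0 = 0 := intervalIntegral.integral_same

theorem ramp_mono (δ : ℝ) : Monotone (ramp δ) :=
  monotone_of_deriv_nonneg (fun s => (hasDerivAt_ramp δ s).differentiableAt) fun s => by
    rw [deriv_ramp]; exact rampDeriv_nonneg δ s

theorem ramp_sub_le {a b : ℝ} (hab : a ≤ b) : ramp δ b - ramp δ a ≤ b - a := by
  have h : Antitone fun s => ramp δ s - s :=
    antitone_of_hasDerivAt_nonpos (fun s => (hasDerivAt_ramp δ s).sub (hasDerivAt_id s)) fun s => by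
      simpa using rampDeriv_le_one δ s
  have := h hab
  simp only at this
  linarith

theorem abs_ramp_sub_le (a b : ℝ) : |ramp δ b - ramp δ a| ≤ |b - a| := by
  rcases le_total a b with h | h
  · rw [abs_of_nonneg (sub_nonneg.2 (ramp_mono δ h)), abs_of_nonneg (sub_nonneg.2 h)]
    exact ramp_sub_le h
  · rw [abs_of_nonpos (sub_nonpos.2 (ramp_mono δ h)), abs_of_nonpos (sub_nonpos.2 h)]
    linarith [ramp_sub_le (δ := δ) h]

theorem ramp_of_nonpos (hδ : 0 < δ) {s : ℝ} (hs : s ≤ 0) : ramp δ s = 0 := by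
  refine intervalIntegral.integral_zero_ae (Eventually.of_forall fun τ hτ => ?_)
  rw [uIoc_of_ge hs] at hτ
  exact rampDeriv_of_nonpos hδ hτ.2

theorem ramp_nonneg (hδ : 0 < δ) (s : ℝ) : 0 ≤ ramp δ s := by
  rcases le_total s 0 with h | h
  · rw [ramp_of_nonpos hδ h]
  · simpa [ramp_zero] using ramp_mono δ h

theorem sub_le_ramp (hδ : 0 < δ) (s : ℝ) : s - δ ≤ ramp δ s := by
  rcases le_total s δ with h | h
  · linarith [ramp_nonneg hδ s]
  · have h1 : ∫ τ in δ..s, Real.smoothTransition (τ / δ) = s - δ := by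
      rw [intervalIntegral.integral_congr (g := fun _ => 1)]
      · simp
      · intro τ hτ
        rw [uIcc_of_le h] at hτ
        exact Real.smoothTransition.one_of_one_le ((one_le_div hδ).2 hτ.1)
    have h2 := intervalIntegral.integral_add_adjacent_intervals
      ((continuous_rampDeriv δ).intervalIntegrable 0 δ (μ := volume))
      ((continuous_rampDeriv δ).intervalIntegrable δ s)
    simp only [rampDeriv, h1] at h2
    have := ramp_nonneg hδ δ
    unfold ramp at this ⊢
    linarith

theorem continuous_ramp (δ : ℝ) : Continuous (ramp δ) := (contDiff_ramp δ).continuous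

theorem continuous_trunc (δ : ℝ) : Continuous (trunc δ) :=
  (continuous_ramp δ).comp (continuous_id.sub continuous_const)

theorem contDiff_trunc (δ : ℝ) : ContDiff ℝ ∞ (trunc δ) :=
  (contDiff_ramp δ).comp (contDiff_id.sub contDiff_const)

theorem hasDerivAt_trunc (δ s : ℝ) : HasDerivAt (trunc δ) (rampDeriv δ (s - δ)) s :=
  HasDerivAt.comp_sub_const s δ (hasDerivAt_ramp δ (s - δ))

theorem trunc_mono (δ : ℝ) : Monotone (trunc δ) := fun _ _ h => ramp_mono δ (by gcongr)

theorem trunc_of_le (hδ : 0 < δ) {s : ℝ} (hs : s ≤ δ) : trunc δ s = 0 :=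
  ramp_of_nonpos hδ (by linarith)

theorem trunc_nonneg (hδ : 0 < δ) (s : ℝ) : 0 ≤ trunc δ s := ramp_nonneg hδ _

theorem abs_trunc_sub_le (a b : ℝ) : |trunc δ b - trunc δ a| ≤ |b - a| := by
  simpa [trunc] using abs_ramp_sub_le (δ := δ) (a - δ) (b - δ)

theorem abs_trunc_le (hδ : 0 < δ) (s : ℝ) : |trunc δ s| ≤ |s| := by
  simpa [trunc_of_le hδ hδ.le] using abs_trunc_sub_le (δ := δ) 0 s

theorem hasDerivAt_truncInt (δ s : ℝ) : HasDerivAt (truncInt δ) (trunc δ s) s :=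
  (continuous_trunc δ).integral_hasStrictDerivAt 0 s |>.hasDerivAt

theorem continuous_truncInt (δ : ℝ) : Continuous (truncInt δ) :=
  continuous_iff_continuousAt.2 fun s => (hasDerivAt_truncInt δ s).continuousAt

theorem truncInt_zero (δ : ℝ) : truncInt δ 0 = 0 := intervalIntegral.integral_same

theorem exists_truncInt_sub_eq (a b : ℝ) :
    ∃ c ∈ uIcc a b, truncInt δ b - truncInt δ a = trunc δ c * (b - a) := by
  rcases lt_trichotomy a b with h | h | h
  · obtain ⟨c, hc, hc'⟩ := exists_hasDerivAt_eq_slope (truncInt δ) (trunc δ) h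
      (continuous_truncInt δ).continuousOn fun x _ => hasDerivAt_truncInt δ x
    refine ⟨c, by rw [uIcc_of_le h.le]; exact Ioo_subset_Icc_self hc, ?_⟩
    rw [hc', div_mul_cancel₀ _ (sub_ne_zero.2 h.ne')]
  · exact ⟨a, left_mem_uIcc, by simp [h]⟩
  · obtain ⟨c, hc, hc'⟩ := exists_hasDerivAt_eq_slope (truncInt δ) (trunc δ) h
      (continuous_truncInt δ).continuousOn fun x _ => hasDerivAt_truncInt δ x
    refine ⟨c, by rw [uIcc_of_ge h.le]; exact Ioo_subset_Icc_self hc, ?_⟩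
    rw [hc', ← neg_sub a b, mul_neg, div_mul_cancel₀ _ (sub_ne_zero.2 h.ne')]
    ring

/-- `trunc δ` is `1`-Lipschitz, so the mean value theorem leaves a quadratic remainder. This
pointwise bound later integrates to the squared `L²` norm. -/
theorem abs_truncInt_sub_sub_le (a b : ℝ) :
    |truncInt δ b - truncInt δ a - trunc δ a * (b - a)| ≤ (b - a) ^ 2 := by
  obtain ⟨c, hc, h⟩ := exists_truncInt_sub_eq (δ := δ) a b
  rw [h, ← sub_mul, abs_mul, ← sq_abs, sq]
  exact mul_le_mul_of_nonneg_right
    ((abs_trunc_sub_le a c).trans (abs_sub_left_of_mem_uIcc hc)) (abs_nonneg _)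

/-- The tangent line inequality of a convex function: the derivative `trunc δ` is monotone. -/
theorem trunc_mul_le_truncInt_sub (a b : ℝ) :
    trunc δ a * (b - a) ≤ truncInt δ b - truncInt δ a := by
  obtain ⟨c, hc, h⟩ := exists_truncInt_sub_eq (δ := δ) a b
  rw [h]
  rcases le_total a b with hab | hab
  · rw [uIcc_of_le hab] at hc
    exact mul_le_mul_of_nonneg_right (trunc_mono δ hc.1) (by linarith)
  · rw [uIcc_of_ge hab] at hc
    exact mul_le_mul_of_nonpos_right (trunc_mono δ hc.2) (by linarith)

theorem truncInt_nonneg (hδ : 0 < δ) (s : ℝ) : 0 ≤ truncInt δ s := by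
  simpa [trunc_of_le hδ hδ.le, truncInt_zero] using trunc_mul_le_truncInt_sub (δ := δ) 0 s

theorem truncInt_le_sq (hδ : 0 < δ) (s : ℝ) : truncInt δ s ≤ max s 0 ^ 2 := by
  rcases le_total s 0 with h | h
  · rw [max_eq_right h]
    have := trunc_mul_le_truncInt_sub (δ := δ) s 0
    rw [trunc_of_le hδ (h.trans hδ.le), truncInt_zero] at this
    linarith
  · rw [max_eq_left h]
    have := (le_abs_self _).trans (abs_truncInt_sub_sub_le (δ := δ) 0 s)
    simpa [trunc_of_le hδ hδ.le, truncInt_zero] using this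

theorem truncInt_pos (hδ : 0 < δ) {s : ℝ} (hs : 2 * δ < s) : 0 < truncInt δ s := by
  obtain ⟨a, ha, has⟩ := exists_between hs
  have h1 := trunc_mul_le_truncInt_sub (δ := δ) a s
  have h2 := truncInt_nonneg hδ a
  have h3 : 0 < trunc δ a := by
    have := sub_le_ramp hδ (a - δ)
    unfold trunc
    linarith
  have := mul_pos h3 (sub_pos.2 has)
  linarith

end Truncation

/-! ### The energy functional on `L²` and its decay -/

section Energy

variable {α : Type*} [MeasurableSpace α] {m : Measure α} {δ : ℝ}

theorem hasFDerivAt_of_abs_sub_le_sq {H : Type*} [NormedAddCommGroup H] [NormedSpace ℝ H]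
    {N : H → ℝ} {L : H →L[ℝ] ℝ} {a : H} (h : ∀ b, |N b - N a - L (b - a)| ≤ ‖b - a‖ ^ 2) :
    HasFDerivAt N L a := by
  rw [hasFDerivAt_iff_isLittleO]
  refine (Asymptotics.IsBigO.of_bound' (g := fun b => ‖b - a‖ ^ 2)
    (Eventually.of_forall fun b => ?_)).trans_isLittleO ?_
  · simpa using h b
  · have := (Asymptotics.isLittleO_norm_pow_id (E' := H) one_lt_two)
    exact this.comp_tendsto
      (tendsto_sub_nhds_zero_iff.2 tendsto_id : Tendsto (fun b => b - a) (𝓝 a) (𝓝 0))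

theorem integrable_truncInt (hδ : 0 < δ) (v : Lp ℝ 2 m) :
    Integrable (fun x => truncInt δ (-(v x))) m := by
  refine (Lp.memLp v).integrable_sq.mono
    ((continuous_truncInt δ).comp_aestronglyMeasurable (Lp.aestronglyMeasurable v).neg)
    (Eventually.of_forall fun x => ?_)
  rw [Real.norm_of_nonneg (truncInt_nonneg hδ _), Real.norm_of_nonneg (sq_nonneg _)]
  refine (truncInt_le_sq hδ _).trans ?_
  rcases le_total (-(v x)) 0 with h | h
  · rw [max_eq_right h]; simpa using sq_nonneg (v x)
  · rw [max_eq_left h, neg_sq]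

theorem memLp_trunc (hδ : 0 < δ) (v : Lp ℝ 2 m) : MemLp (fun x => trunc δ (-(v x))) 2 m := by
  refine (Lp.memLp v).mono
    ((continuous_trunc δ).comp_aestronglyMeasurable (Lp.aestronglyMeasurable v).neg)
    (Eventually.of_forall fun x => ?_)
  simpa using abs_trunc_le hδ (-(v x))

/-- The functional is Fréchet differentiable on all of `L²`, so the chain rule along the path needs
only its strong derivative in `L²` and no pointwise derivative in time. The differential is minus
the inner product with the class of `trunc δ (-a)`. -/
theorem exists_hasFDerivAt_integral_truncInt (hδ : 0 < δ) (a : Lp ℝ 2 m) :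
    ∃ L : Lp ℝ 2 m →L[ℝ] ℝ, (∀ w, L w = -∫ x, trunc δ (-(a x)) * w x ∂m) ∧
      HasFDerivAt (fun v : Lp ℝ 2 m => ∫ x, truncInt δ (-(v x)) ∂m) L a := by
  set p : Lp ℝ 2 m := (memLp_trunc hδ a).toLp _ with hp
  have hpa : p =ᵐ[m] fun x => trunc δ (-(a x)) := (memLp_trunc hδ a).coeFn_toLp
  have hL : ∀ w : Lp ℝ 2 m, inner ℝ p w = ∫ x, trunc δ (-(a x)) * w x ∂m := by
    intro w
    rw [L2.inner_def]
    refine integral_congr_ae ?_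
    filter_upwards [hpa] with x hx
    simp [hx, mul_comm]
  refine ⟨-(innerSL ℝ p), fun w => by simp [hL], hasFDerivAt_of_abs_sub_le_sq fun b => ?_⟩
  have hi : Integrable (fun x => trunc δ (-(a x)) * (b - a : Lp ℝ 2 m) x) m :=
    (memLp_trunc hδ a).integrable_mul (Lp.memLp (b - a))
  have h1 : (∫ x, truncInt δ (-(b x)) ∂m) - (∫ x, truncInt δ (-(a x)) ∂m)
      - (-(innerSL ℝ p)) (b - a) = ∫ x, (truncInt δ (-(b x)) - truncInt δ (-(a x))
        + trunc δ (-(a x)) * (b - a : Lp ℝ 2 m) x) ∂m := by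
    have hs : Integrable (fun x => truncInt δ (-(b x)) - truncInt δ (-(a x))) m :=
      (integrable_truncInt hδ b).sub (integrable_truncInt hδ a)
    rw [integral_add hs hi,
      integral_sub (integrable_truncInt hδ b) (integrable_truncInt hδ a), ← hL]
    simp
  have h2 : ‖b - a‖ ^ 2 = ∫ x, ((b - a : Lp ℝ 2 m) x) ^ 2 ∂m := by
    rw [← real_inner_self_eq_norm_sq, L2.inner_def]
    simp [sq]
  rw [h1, h2]
  refine abs_integral_le_integral_abs.trans (integral_mono_ae
    (((integrable_truncInt hδ b).sub (integrable_truncInt hδ a)).add hi).abs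
    (Lp.memLp (b - a)).integrable_sq ?_)
  filter_upwards [Lp.coeFn_sub b a] with x hx
  rw [hx, Pi.sub_apply]
  have := abs_truncInt_sub_sub_le (δ := δ) (-(a x)) (-(b x))
  rw [show truncInt δ (-(b x)) - truncInt δ (-(a x)) + trunc δ (-(a x)) * (b x - a x) =
      truncInt δ (-(b x)) - truncInt δ (-(a x)) - trunc δ (-(a x)) * (-(b x) - -(a x)) by ring,
    show (b x - a x) ^ 2 = (-(b x) - -(a x)) ^ 2 by ring]
  exact this

/-- The hypothesis on the integral says that the energy has nonpositive derivative. Comparing time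
`t` with times `r → 0+`, where the energy is at most the squared norm of the negative part, shows
that it is zero at `t`. -/
theorem ae_neg_le_of_energy (hδ : 0 < δ) {T : EReal} {v : ℝ → Lp ℝ 2 m}
    (hv_diff : ∀ t : ℝ, 0 < t → (t : EReal) < T → DifferentiableAt ℝ v t)
    (hv_init : Tendsto (fun t => Lp.negPart (v t)) (𝓝[>] 0) (𝓝 0))
    (hv : ∀ t : ℝ, 0 < t → (t : EReal) < T → 0 ≤ ∫ x, trunc δ (-(v t x)) * deriv v t x ∂m)
    {t : ℝ} (ht : 0 < t) (htT : (t : EReal) < T) : ∀ᵐ x ∂m, -(2 * δ) ≤ v t x := by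
  set J : ℝ → ℝ := fun t => ∫ x, truncInt δ (-(v t x)) ∂m with hJ
  have hderiv : ∀ r : ℝ, 0 < r → (r : EReal) < T →
      HasDerivAt J (-∫ x, trunc δ (-(v r x)) * deriv v r x ∂m) r := by
    intro r hr hrT
    obtain ⟨L, hL, hL'⟩ := exists_hasFDerivAt_integral_truncInt hδ (v r)
    rw [← hL]
    exact hL'.comp_hasDerivAt r (hv_diff r hr hrT).hasDerivAt
  have hlt : ∀ r, r ≤ t → (r : EReal) < T := fun r hr =>
    lt_of_le_of_lt (EReal.coe_le_coe_iff.2 hr) htT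
  have hanti : AntitoneOn J (Ioc 0 t) := by
    refine antitoneOn_of_deriv_nonpos (convex_Ioc 0 t)
      (fun r hr => (hderiv r hr.1 (hlt r hr.2)).continuousAt.continuousWithinAt) ?_ ?_
    · intro r hr
      have hr := interior_subset hr
      exact (hderiv r hr.1 (hlt r hr.2)).differentiableAt.differentiableWithinAt
    · intro r hr
      have hr := interior_subset hr
      rw [(hderiv r hr.1 (hlt r hr.2)).deriv]
      linarith [hv r hr.1 (hlt r hr.2)]
  have hJle : ∀ r, J r ≤ ‖Lp.negPart (v r)‖ ^ 2 := by
    intro r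
    rw [← real_inner_self_eq_norm_sq, L2.inner_def]
    refine integral_mono_ae (integrable_truncInt hδ _) ?_ ?_
    · exact L2.integrable_inner _ _
    · filter_upwards [Lp.coeFn_negPart_eq_max (v r)] with x hx
      rw [hx]
      simpa [sq] using truncInt_le_sq hδ (-(v r x))
  have hJ0 : J t ≤ 0 := by
    have hlim : Tendsto (fun r => ‖Lp.negPart (v r)‖ ^ 2) (𝓝[>] 0) (𝓝 0) := by
      simpa using (hv_init.norm.pow 2)
    refine ge_of_tendsto hlim ?_
    filter_upwards [Ioc_mem_nhdsGT ht] with r hr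
    exact (hanti hr ⟨ht, le_rfl⟩ hr.2).trans (hJle r)
  have hzero : J t = 0 := le_antisymm hJ0 (integral_nonneg fun x => truncInt_nonneg hδ _)
  rw [hJ] at hzero
  have := (integral_eq_zero_iff_of_nonneg (fun x => truncInt_nonneg hδ (-(v t x)))
    (integrable_truncInt hδ (v t))).1 hzero
  filter_upwards [this] with x hx
  by_contra hlt
  have := truncInt_pos hδ (s := -(v t x)) (by linarith)
  rw [Pi.zero_apply] at hx
  linarith

end Energy

/-! ### Coordinate frames and the Gram matrix of the metric -/

section Frames

variable {n : ℕ} {M : Type*} [TopologicalSpace M]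
  [ChartedSpace (EuclideanSpace ℝ (Fin n)) M] [IsManifold (𝓡 n) ∞ M]

local notation "𝔼" => EuclideanSpace ℝ (Fin n)

/-- The tangent vector at `x` with components `w` in the chart at `c`. -/
def frame (c x : M) : 𝔼 →L[ℝ] TangentSpace (𝓡 n) x :=
  (trivializationAt 𝔼 (TangentSpace (𝓡 n)) c).symmL ℝ x

theorem coordVector_eq_frame (c x : M) (i : Fin n) :
    coordVector c x i = frame c x (EuclideanSpace.single i 1) := rfl

/-- The components in the chart at `c` as a continuous linear map. -/
def coframe (c x : M) : TangentSpace (𝓡 n) x →L[ℝ] 𝔼 :=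
  (trivializationAt 𝔼 (TangentSpace (𝓡 n)) c).continuousLinearMapAt ℝ x

theorem components_eq_coframe (c x : M) (X : TangentSpace (𝓡 n) x) :
    components c x X = coframe c x X := rfl

variable {c x : M}

theorem coframe_frame (hx : x ∈ (chartAt 𝔼 c).source) (w : 𝔼) : coframe c x (frame c x w) = w :=
  (trivializationAt 𝔼 (TangentSpace (𝓡 n)) c).continuousLinearMapAt_symmL hx w

theorem frame_coframe (hx : x ∈ (chartAt 𝔼 c).source) (X : TangentSpace (𝓡 n) x) :
    frame c x (coframe c x X) = X :=
  (trivializationAt 𝔼 (TangentSpace (𝓡 n)) c).symmL_continuousLinearMapAt hx X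

theorem chart_mem_target (hx : x ∈ (chartAt 𝔼 c).source) :
    chartAt 𝔼 c x ∈ (chartAt 𝔼 c).target := (chartAt 𝔼 c).map_source hx

theorem contMDiffAt_chart (hx : x ∈ (chartAt 𝔼 c).source) :
    ContMDiffAt (𝓡 n) (𝓡 n) ∞ (chartAt 𝔼 c) x :=
  contMDiffOn_chart.contMDiffAt ((chartAt 𝔼 c).open_source.mem_nhds hx)

theorem contMDiffAt_chart_symm {y : 𝔼} (hy : y ∈ (chartAt 𝔼 c).target) :
    ContMDiffAt (𝓡 n) (𝓡 n) ∞ (chartAt 𝔼 c).symm y :=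
  contMDiffOn_chart_symm.contMDiffAt ((chartAt 𝔼 c).open_target.mem_nhds hy)

theorem frame_eq_mfderiv (hx : x ∈ (chartAt 𝔼 c).source) (w : 𝔼) :
    frame c x w = mfderiv (𝓡 n) (𝓡 n) (chartAt 𝔼 c).symm (chartAt 𝔼 c x) w := by
  unfold frame
  rw [TangentBundle.symmL_trivializationAt hx]
  simp [mfderivWithin_univ]
  rfl

theorem coframe_eq_mfderiv (hx : x ∈ (chartAt 𝔼 c).source) (X : TangentSpace (𝓡 n) x) :
    coframe c x X = mfderiv (𝓡 n) (𝓡 n) (chartAt 𝔼 c) x X := by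
  unfold coframe
  rw [TangentBundle.continuousLinearMapAt_trivializationAt hx]
  simp
  rfl

theorem mvfderiv_frame {f : M → ℝ} (hf : MDifferentiableAt (𝓡 n) 𝓘(ℝ) f x)
    (hx : x ∈ (chartAt 𝔼 c).source) (w : 𝔼) :
    mvfderiv (𝓡 n) f x (frame c x w) =
      fderiv ℝ (f ∘ (chartAt 𝔼 c).symm) (chartAt 𝔼 c x) w := by
  rw [frame_eq_mfderiv hx, ← mfderiv_eq_fderiv]
  have hsymm := (contMDiffAt_chart_symm (chart_mem_target hx)).mdifferentiableAt
    (by simp)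
  have hl : (chartAt 𝔼 c).symm (chartAt 𝔼 c x) = x := (chartAt 𝔼 c).left_inv hx
  have hf' : MDifferentiableAt (𝓡 n) 𝓘(ℝ) f ((chartAt 𝔼 c).symm (chartAt 𝔼 c x)) := by rwa [hl]
  rw [mfderiv_comp _ hf' hsymm]
  -- All tangent spaces unfold to the same model space, so the base point `symm (chart x)` can be
  -- replaced by `x` by congruence once the derivatives are typed on `𝔼`.
  exact congrArg (fun z => (mfderiv (𝓡 n) 𝓘(ℝ) f z : 𝔼 →L[ℝ] ℝ)
    (mfderiv (𝓡 n) (𝓡 n) (chartAt 𝔼 c).symm (chartAt 𝔼 c x) w)) hl.symm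

theorem coframe_frame_eq_fderiv {c' : M} (hx : x ∈ (chartAt 𝔼 c).source)
    (hx' : x ∈ (chartAt 𝔼 c').source) (w : 𝔼) :
    coframe c' x (frame c x w) =
      fderiv ℝ (chartAt 𝔼 c' ∘ (chartAt 𝔼 c).symm) (chartAt 𝔼 c x) w := by
  rw [coframe_eq_mfderiv hx', frame_eq_mfderiv hx, ← mfderiv_eq_fderiv]
  have hsymm := (contMDiffAt_chart_symm (chart_mem_target hx)).mdifferentiableAt
    (by simp)
  have hl : (chartAt 𝔼 c).symm (chartAt 𝔼 c x) = x := (chartAt 𝔼 c).left_inv hx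
  have hf' : MDifferentiableAt (𝓡 n) (𝓡 n) (chartAt 𝔼 c') ((chartAt 𝔼 c).symm (chartAt 𝔼 c x)) := by
    rw [hl]; exact (contMDiffAt_chart hx').mdifferentiableAt (by simp)
  rw [mfderiv_comp _ hf' hsymm]
  exact congrArg (fun z => (mfderiv (𝓡 n) (𝓡 n) (chartAt 𝔼 c') z : 𝔼 →L[ℝ] 𝔼)
    (mfderiv (𝓡 n) (𝓡 n) (chartAt 𝔼 c).symm (chartAt 𝔼 c x) w)) hl.symm

theorem contMDiffAt_section_iff_coframe {X : VectorField n M} (hx : x ∈ (chartAt 𝔼 c).source) :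
    ContMDiffAt (𝓡 n) (𝓡 n).tangent ∞ (fun x => (⟨x, X x⟩ : TangentBundle (𝓡 n) M)) x ↔
      ContMDiffAt (𝓡 n) 𝓘(ℝ, 𝔼) ∞ (fun x => coframe c x (X x)) x := by
  set e := trivializationAt 𝔼 (TangentSpace (𝓡 n) : M → Type _) c
  refine (e.contMDiffAt_section_iff (IB := 𝓡 n) hx).trans ?_
  refine Filter.EventuallyEq.contMDiffAt_iff ?_
  filter_upwards [(chartAt 𝔼 c).open_source.mem_nhds hx] with y hy
  exact (e.continuousLinearMapAt_apply_of_mem (R := ℝ) hy _).symm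

theorem contMDiffAt_frame {u : M → 𝔼} (hu : ContMDiffAt (𝓡 n) 𝓘(ℝ, 𝔼) ∞ u x)
    (hx : x ∈ (chartAt 𝔼 c).source) :
    ContMDiffAt (𝓡 n) (𝓡 n).tangent ∞
      (fun x => (⟨x, frame c x (u x)⟩ : TangentBundle (𝓡 n) M)) x := by
  rw [contMDiffAt_section_iff_coframe hx]
  refine hu.congr_of_eventuallyEq ?_
  filter_upwards [(chartAt 𝔼 c).open_source.mem_nhds hx] with y hy
  exact coframe_frame hy _

theorem contMDiffAt_inner (g : Metric n M) {X Y : VectorField n M}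
    (hX : ContMDiffAt (𝓡 n) (𝓡 n).tangent ∞ (fun x => (⟨x, X x⟩ : TangentBundle (𝓡 n) M)) x)
    (hY : ContMDiffAt (𝓡 n) (𝓡 n).tangent ∞ (fun x => (⟨x, Y x⟩ : TangentBundle (𝓡 n) M)) x) :
    ContMDiffAt (𝓡 n) 𝓘(ℝ) ∞ (fun x => g.inner x (X x) (Y x)) x := by
  have : ContMDiffAt (𝓡 n) ((𝓡 n).prod 𝓘(ℝ)) ∞
      (fun m => TotalSpace.mk' ℝ (E := Bundle.Trivial M ℝ) m (g.inner m (X m) (Y m))) x := by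
    apply ContMDiffAt.clm_bundle_apply₂ (F₁ := 𝔼) (F₂ := 𝔼)
    · exact g.contMDiff.contMDiffAt
    · exact hX
    · exact hY
  rw [contMDiffAt_totalSpace] at this
  exact this.2

theorem contDiffAt_comp_symm {F : Type*} [NormedAddCommGroup F] [NormedSpace ℝ F] {f : M → F}
    (hf : ContMDiffAt (𝓡 n) 𝓘(ℝ, F) ∞ f x) (hx : x ∈ (chartAt 𝔼 c).source) :
    ContDiffAt ℝ ∞ (f ∘ (chartAt 𝔼 c).symm) (chartAt 𝔼 c x) := by
  rw [← contMDiffAt_iff_contDiffAt]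
  refine ContMDiffAt.comp _ ?_ (contMDiffAt_chart_symm (chart_mem_target hx))
  rwa [(chartAt 𝔼 c).left_inv hx]

theorem contMDiffAt_comp_chart {F : Type*} [NormedAddCommGroup F] [NormedSpace ℝ F] {η : 𝔼 → F}
    (hη : ContDiffAt ℝ ∞ η (chartAt 𝔼 c x)) (hx : x ∈ (chartAt 𝔼 c).source) :
    ContMDiffAt (𝓡 n) 𝓘(ℝ, F) ∞ (η ∘ chartAt 𝔼 c) x :=
  ContMDiffAt.comp x hη.contMDiffAt (contMDiffAt_chart hx)

/-- The coefficient matrix of the metric in the chart at `c`. -/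
def gram (g : Metric n M) (c x : M) : Matrix (Fin n) (Fin n) ℝ :=
  Matrix.of fun i j => g.inner x (coordVector c x i) (coordVector c x j)

theorem sum_smul_single (w : 𝔼) : ∑ i, w i • (EuclideanSpace.single i 1 : 𝔼) = w := by
  conv_rhs => rw [← (EuclideanSpace.basisFun (Fin n) ℝ).sum_repr w]
  simp

theorem inner_frame (g : Metric n M) (c x : M) (u w : 𝔼) :
    g.inner x (frame c x u) (frame c x w) = ∑ i, ∑ j, u i * gram g c x i j * w j := by
  conv_lhs => rw [← sum_smul_single u, ← sum_smul_single w]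
  rw [Finset.sum_comm]
  simp only [map_sum, map_smul, sum_apply, smul_apply,
    smul_eq_mul, gram, Matrix.of_apply, coordVector_eq_frame, Finset.mul_sum]
  refine Finset.sum_congr rfl fun i _ => Finset.sum_congr rfl fun j _ => ?_
  ring

theorem gram_posDef (g : Metric n M) (hx : x ∈ (chartAt 𝔼 c).source) : (gram g c x).PosDef := by
  refine Matrix.PosDef.of_dotProduct_mulVec_pos ?_ ?_
  · ext i j
    simp [gram, g.symm x (coordVector c x j)]
  · intro w hw
    have h0 : frame c x (WithLp.toLp 2 w) ≠ 0 := by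
      intro h
      have := coframe_frame hx (WithLp.toLp 2 w)
      rw [h, map_zero] at this
      exact hw (by simpa using congrArg WithLp.ofLp this.symm)
    have := g.pos x _ h0
    rw [inner_frame] at this
    simpa [dotProduct, Matrix.mulVec, Finset.mul_sum, mul_assoc] using this

theorem sqrtDet_eq (g : Metric n M) (c x : M) : sqrtDet g c x = √(gram g c x).det := rfl

theorem sqrtDet_pos (g : Metric n M) (hx : x ∈ (chartAt 𝔼 c).source) : 0 < sqrtDet g c x :=
  Real.sqrt_pos.2 (gram_posDef g hx).det_pos

theorem contMDiffAt_gram (g : Metric n M) (hx : x ∈ (chartAt 𝔼 c).source) (i j : Fin n) :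
    ContMDiffAt (𝓡 n) 𝓘(ℝ) ∞ (fun x => gram g c x i j) x :=
  contMDiffAt_inner g (contMDiffAt_frame contMDiffAt_const hx)
    (contMDiffAt_frame contMDiffAt_const hx)

theorem contMDiffAt_det {A : M → Matrix (Fin n) (Fin n) ℝ}
    (hA : ∀ i j, ContMDiffAt (𝓡 n) 𝓘(ℝ) ∞ (fun x => A x i j) x) :
    ContMDiffAt (𝓡 n) 𝓘(ℝ) ∞ (fun x => (A x).det) x := by
  simp only [Matrix.det_apply']
  exact ContMDiffAt.sum fun σ _ => contMDiffAt_const.mul (ContMDiffAt.prod fun i _ => hA _ _)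

theorem contMDiffAt_sqrtDet (g : Metric n M) (hx : x ∈ (chartAt 𝔼 c).source) :
    ContMDiffAt (𝓡 n) 𝓘(ℝ) ∞ (fun x => sqrtDet g c x) x := by
  have h1 := contMDiffAt_det (contMDiffAt_gram g hx)
  exact ContMDiffAt.comp x
    (Real.contDiffAt_sqrt (gram_posDef g hx).det_pos.ne').contMDiffAt h1

end Frames

/-! ### Transfer of functions and fields between the manifold and a chart -/

section ChartFields

variable {n : ℕ} {M : Type*} [TopologicalSpace M]
  [ChartedSpace (EuclideanSpace ℝ (Fin n)) M] [IsManifold (𝓡 n) ∞ M]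

local notation "𝔼" => EuclideanSpace ℝ (Fin n)

variable {c x : M}

theorem gram_change (g : Metric n M) {c' : M} (hx : x ∈ (chartAt 𝔼 c).source)
    (hx' : x ∈ (chartAt 𝔼 c').source) :
    gram g c' x = (LinearMap.toMatrix (EuclideanSpace.basisFun (Fin n) ℝ).toBasis
        (EuclideanSpace.basisFun (Fin n) ℝ).toBasis
        (fderiv ℝ (chartAt 𝔼 c ∘ (chartAt 𝔼 c').symm) (chartAt 𝔼 c' x) : 𝔼 →ₗ[ℝ] 𝔼)).transpose *
      gram g c x * (LinearMap.toMatrix (EuclideanSpace.basisFun (Fin n) ℝ).toBasis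
        (EuclideanSpace.basisFun (Fin n) ℝ).toBasis
        (fderiv ℝ (chartAt 𝔼 c ∘ (chartAt 𝔼 c').symm) (chartAt 𝔼 c' x) : 𝔼 →ₗ[ℝ] 𝔼)) := by
  set A := fderiv ℝ (chartAt 𝔼 c ∘ (chartAt 𝔼 c').symm) (chartAt 𝔼 c' x) with hA
  have hfr : ∀ u, frame c' x u = frame c x (A u) := fun u => by
    rw [hA, ← coframe_frame_eq_fderiv hx' hx, frame_coframe hx]
  ext i j
  have : gram g c' x i j = g.inner x (frame c' x (EuclideanSpace.single i 1))
    (frame c' x (EuclideanSpace.single j 1)) := rfl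
  rw [this, hfr, hfr, inner_frame]
  simp only [Matrix.mul_apply, Matrix.transpose_apply, LinearMap.toMatrix_apply, Finset.sum_mul]
  rw [Finset.sum_comm]
  simp

/-- The Gram matrices are congruent through the Jacobian matrix, so their determinants differ by the
square of the Jacobian determinant. -/
theorem sqrtDet_change (g : Metric n M) {c' : M} (hx : x ∈ (chartAt 𝔼 c).source)
    (hx' : x ∈ (chartAt 𝔼 c').source) :
    sqrtDet g c' x = |(fderiv ℝ (chartAt 𝔼 c ∘ (chartAt 𝔼 c').symm) (chartAt 𝔼 c' x)).det| *
      sqrtDet g c x := by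
  rw [sqrtDet_eq, sqrtDet_eq, gram_change g hx hx', Matrix.det_mul, Matrix.det_mul,
    Matrix.det_transpose, LinearMap.det_toMatrix, mul_right_comm, ← sq,
    Real.sqrt_mul (sq_nonneg _), Real.sqrt_sq_eq_abs]

/-- The function on `M` with the coordinate expression `η`, extended by zero. -/
def pull (c : M) (η : 𝔼 → ℝ) : M → ℝ :=
  (chartAt 𝔼 c).source.indicator (η ∘ chartAt 𝔼 c)

theorem pull_apply (hx : x ∈ (chartAt 𝔼 c).source) (η : 𝔼 → ℝ) :
    pull c η x = η (chartAt 𝔼 c x) := indicator_of_mem hx _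

/-- The set of points of the chart domain with coordinates in `K`. -/
def pullSet (c : M) (K : Set 𝔼) : Set M := (chartAt 𝔼 c).symm '' K

theorem isCompact_pullSet {K : Set 𝔼} (hK : IsCompact K) (hKt : K ⊆ (chartAt 𝔼 c).target) :
    IsCompact (pullSet c K) := hK.image_of_continuousOn ((chartAt 𝔼 c).continuousOn_symm.mono hKt)

theorem pullSet_subset_source {K : Set 𝔼} (hKt : K ⊆ (chartAt 𝔼 c).target) :
    pullSet c K ⊆ (chartAt 𝔼 c).source := by
  rintro _ ⟨y, hy, rfl⟩
  exact (chartAt 𝔼 c).map_target (hKt hy)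

theorem mem_pullSet {K : Set 𝔼} (hx : x ∈ (chartAt 𝔼 c).source) (h : chartAt 𝔼 c x ∈ K) :
    x ∈ pullSet c K := ⟨_, h, (chartAt 𝔼 c).left_inv hx⟩

theorem pull_of_notMem {η : 𝔼 → ℝ} (hx : x ∉ pullSet c (tsupport η)) : pull c η x = 0 := by
  by_cases h : x ∈ (chartAt 𝔼 c).source
  · rw [pull_apply h]
    exact image_eq_zero_of_notMem_tsupport fun h' => hx (mem_pullSet h h')
  · exact indicator_of_notMem h _

section T2

variable [T2Space M]

theorem tsupport_pull_subset {η : 𝔼 → ℝ} (hηc : HasCompactSupport η)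
    (hηt : tsupport η ⊆ (chartAt 𝔼 c).target) :
    tsupport (pull c η) ⊆ pullSet c (tsupport η) := by
  refine closure_minimal (fun x hx => ?_) (isCompact_pullSet hηc hηt).isClosed
  by_contra h
  exact hx (pull_of_notMem h)

theorem isTestFunction_pull {η : 𝔼 → ℝ} (hη : ContDiff ℝ ∞ η) (hηc : HasCompactSupport η)
    (hηt : tsupport η ⊆ (chartAt 𝔼 c).target) : IsTestFunction n (pull c η) := by
  have hK := isCompact_pullSet hηc hηt
  refine ⟨fun x => ?_, hK.of_isClosed_subset (isClosed_tsupport _)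
    (tsupport_pull_subset hηc hηt)⟩
  by_cases hx : x ∈ pullSet c (tsupport η)
  · have hx := pullSet_subset_source hηt hx
    refine (contMDiffAt_comp_chart hη.contDiffAt hx).congr_of_eventuallyEq ?_
    filter_upwards [(chartAt 𝔼 c).open_source.mem_nhds hx] with y hy
    exact pull_apply hy η
  · refine (contMDiffAt_const (c := (0 : ℝ))).congr_of_eventuallyEq ?_
    filter_upwards [hK.isClosed.isOpen_compl.mem_nhds hx] with y hy
    exact pull_of_notMem hy

end T2

/-- The coordinate expression of a function on `M`, extended by zero. -/
def push (c : M) (f : M → ℝ) : 𝔼 → ℝ :=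
  (chartAt 𝔼 c).target.indicator (f ∘ (chartAt 𝔼 c).symm)

theorem push_apply {y : 𝔼} (hy : y ∈ (chartAt 𝔼 c).target) (f : M → ℝ) :
    push c f y = f ((chartAt 𝔼 c).symm y) := indicator_of_mem hy _

theorem isCompact_chart_image {K : Set M} (hK : IsCompact K) (hKs : K ⊆ (chartAt 𝔼 c).source) :
    IsCompact (chartAt 𝔼 c '' K) := hK.image_of_continuousOn ((chartAt 𝔼 c).continuousOn.mono hKs)

theorem chart_image_subset_target {K : Set M} (hKs : K ⊆ (chartAt 𝔼 c).source) :
    chartAt 𝔼 c '' K ⊆ (chartAt 𝔼 c).target := by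
  rintro _ ⟨x, hx, rfl⟩
  exact (chartAt 𝔼 c).map_source (hKs hx)

theorem push_of_notMem {f : M → ℝ} {K : Set M} (hf : ∀ x ∉ K, f x = 0) {y : 𝔼}
    (hy : y ∉ chartAt 𝔼 c '' K) : push c f y = 0 := by
  by_cases h : y ∈ (chartAt 𝔼 c).target
  · rw [push_apply h]
    exact hf _ fun h' => hy ⟨_, h', (chartAt 𝔼 c).right_inv h⟩
  · exact indicator_of_notMem h _

theorem tsupport_push_subset {χ : M → ℝ} (hχ : IsTestFunction n χ)
    (hs : tsupport χ ⊆ (chartAt 𝔼 c).source) :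
    tsupport (push c χ) ⊆ chartAt 𝔼 c '' tsupport χ := by
  refine closure_minimal (fun y hy => ?_) (isCompact_chart_image (n := n) hχ.2 hs).isClosed
  by_contra h
  exact hy (push_of_notMem (n := n) (fun x hx => image_eq_zero_of_notMem_tsupport hx) h)

theorem contDiff_push {χ : M → ℝ} (hχ : IsTestFunction n χ)
    (hs : tsupport χ ⊆ (chartAt 𝔼 c).source) : ContDiff ℝ ∞ (push c χ : 𝔼 → ℝ) := by
  refine contDiff_iff_contDiffAt.2 fun y => ?_
  by_cases hy : y ∈ chartAt 𝔼 c '' tsupport χ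
  · obtain ⟨x, hx, rfl⟩ := hy
    refine (contDiffAt_comp_symm (hχ.1 x) (hs hx)).congr_of_eventuallyEq ?_
    filter_upwards [(chartAt 𝔼 c).open_target.mem_nhds (chart_mem_target (hs hx))] with y hy
    exact push_apply hy χ
  · refine (contDiffAt_const (c := (0 : ℝ))).congr_of_eventuallyEq ?_
    filter_upwards [(isCompact_chart_image (n := n) hχ.2 hs).isClosed.isOpen_compl.mem_nhds hy]
      with z hz
    exact push_of_notMem (n := n) (fun x hx => image_eq_zero_of_notMem_tsupport hx) hz

theorem hasCompactSupport_push {χ : M → ℝ} (hχ : IsTestFunction n χ)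
    (hs : tsupport χ ⊆ (chartAt 𝔼 c).source) : HasCompactSupport (push c χ : 𝔼 → ℝ) :=
  (isCompact_chart_image (n := n) hχ.2 hs).of_isClosed_subset (isClosed_tsupport _)
    (tsupport_push_subset hχ hs)

open Classical in
/-- The vector field with components `η w / √(det g)` in the chart at `c`, extended by zero. -/
def chartField (g : Metric n M) (c : M) (η : 𝔼 → ℝ) (w : 𝔼) : VectorField n M := fun x =>
  if x ∈ (chartAt 𝔼 c).source then (η (chartAt 𝔼 c x) / sqrtDet g c x) • frame c x w else 0

theorem chartField_apply (g : Metric n M) (hx : x ∈ (chartAt 𝔼 c).source) (η : 𝔼 → ℝ) (w : 𝔼) :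
    chartField g c η w x = (η (chartAt 𝔼 c x) / sqrtDet g c x) • frame c x w := if_pos hx

theorem chartField_of_notMem (g : Metric n M) {η : 𝔼 → ℝ} (w : 𝔼)
    (hx : x ∉ pullSet c (tsupport η)) : chartField g c η w x = 0 := by
  by_cases h : x ∈ (chartAt 𝔼 c).source
  · rw [chartField_apply g h, image_eq_zero_of_notMem_tsupport fun h' => hx (mem_pullSet h h'),
      zero_div, zero_smul]
  · exact if_neg h

theorem contMDiffAt_zero_section :
    ContMDiffAt (𝓡 n) (𝓡 n).tangent ∞ (fun x => (⟨x, 0⟩ : TangentBundle (𝓡 n) M)) x :=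
  contMDiffAt_zeroSection ℝ (TangentSpace (𝓡 n) : M → Type _)

theorem isTestField_chartField [T2Space M] (g : Metric n M) {η : 𝔼 → ℝ} (hη : ContDiff ℝ ∞ η)
    (hηc : HasCompactSupport η) (hηt : tsupport η ⊆ (chartAt 𝔼 c).target) (w : 𝔼) :
    IsTestField (chartField g c η w) := by
  have hK := isCompact_pullSet hηc hηt
  refine ⟨fun x => ?_, _, hK, fun x hx => chartField_of_notMem g w hx⟩
  by_cases hx : x ∈ pullSet c (tsupport η)
  · have hx := pullSet_subset_source hηt hx
    have h1 : ContMDiffAt (𝓡 n) 𝓘(ℝ, 𝔼) ∞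
        (fun x => (η (chartAt 𝔼 c x) / sqrtDet g c x) • w) x :=
      ((contMDiffAt_comp_chart hη.contDiffAt hx).div₀ (contMDiffAt_sqrtDet g hx)
        (sqrtDet_pos g hx).ne').smul contMDiffAt_const
    refine (contMDiffAt_frame h1 hx).congr_of_eventuallyEq ?_
    filter_upwards [(chartAt 𝔼 c).open_source.mem_nhds hx] with y hy
    rw [chartField_apply g hy, map_smul]
  · refine contMDiffAt_zero_section.congr_of_eventuallyEq ?_
    filter_upwards [hK.isClosed.isOpen_compl.mem_nhds hx] with y hy
    rw [chartField_of_notMem g w hy]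

/-- In the chart at `c` this would be immediate, because the density cancels the factor `1 / √(det
g)` in the field. The divergence at `x` is however defined in the chart at `x`, and the passage
between the two charts is exactly the Piola identity. -/
theorem divergence_chartField [T2Space M] (g : Metric n M) {η : 𝔼 → ℝ} (hη : ContDiff ℝ ∞ η)
    (hηc : HasCompactSupport η) (hηt : tsupport η ⊆ (chartAt 𝔼 c).target) (w : 𝔼) (x : M) :
    divergence g (chartField g c η w) x =
      pull c (fun y => fderiv ℝ η y w) x * (sqrtDet g c x)⁻¹ := by
  have hxs : x ∈ (chartAt 𝔼 x).source := mem_chart_source 𝔼 x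
  have hcont : ContinuousAt (chartAt 𝔼 x).symm (chartAt 𝔼 x x) :=
    (chartAt 𝔼 x).continuousAt_symm (chart_mem_target hxs)
  have hl := (chartAt 𝔼 x).left_inv hxs
  by_cases hx : x ∈ pullSet c (tsupport η)
  · have hx := pullSet_subset_source hηt hx
    set z := chartAt 𝔼 c ∘ (chartAt 𝔼 x).symm with hz
    -- The inverse Jacobian of the transition map `z`, written with frames.
    set B : 𝔼 → 𝔼 →L[ℝ] 𝔼 := fun y =>
      (coframe x ((chartAt 𝔼 x).symm y)) ∘L (frame c ((chartAt 𝔼 x).symm y)) with hB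
    have hev : ∀ᶠ y in 𝓝 (chartAt 𝔼 x x), y ∈ (chartAt 𝔼 x).target ∧
        (chartAt 𝔼 x).symm y ∈ (chartAt 𝔼 c).source := by
      refine Filter.Eventually.and ((chartAt 𝔼 x).open_target.mem_nhds (chart_mem_target hxs))
        (hcont.preimage_mem_nhds ?_)
      rw [hl]
      exact (chartAt 𝔼 c).open_source.mem_nhds hx
    have hAe : ∀ y ∈ (chartAt 𝔼 x).target, (chartAt 𝔼 x).symm y ∈ (chartAt 𝔼 c).source → ∀ u,
        fderiv ℝ z y u = coframe c ((chartAt 𝔼 x).symm y) (frame x ((chartAt 𝔼 x).symm y) u) := by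
      intro y hy hyc u
      rw [coframe_frame_eq_fderiv ((chartAt 𝔼 x).map_target hy) hyc, (chartAt 𝔼 x).right_inv hy]
    have hBA : ∀ᶠ y in 𝓝 (chartAt 𝔼 x x), B y ∘L fderiv ℝ z y = ContinuousLinearMap.id ℝ 𝔼 := by
      filter_upwards [hev] with y ⟨hy, hyc⟩
      ext1 u
      rw [ContinuousLinearMap.comp_apply, hAe y hy hyc, hB]
      simp only [ContinuousLinearMap.comp_apply]
      rw [frame_coframe hyc, coframe_frame ((chartAt 𝔼 x).map_target hy)]
      rfl
    have hAB : ∀ᶠ y in 𝓝 (chartAt 𝔼 x x), fderiv ℝ z y ∘L B y = ContinuousLinearMap.id ℝ 𝔼 := by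
      filter_upwards [hev] with y ⟨hy, hyc⟩
      ext1 u
      rw [ContinuousLinearMap.comp_apply, hAe y hy hyc, hB]
      simp only [ContinuousLinearMap.comp_apply]
      rw [frame_coframe ((chartAt 𝔼 x).map_target hy), coframe_frame hyc]
      rfl
    have hz0 : z (chartAt 𝔼 x x) = chartAt 𝔼 c x := by simp [hz, hl]
    have hzd : ContDiffAt ℝ 2 z (chartAt 𝔼 x x) :=
      (contDiffAt_comp_symm (f := chartAt 𝔼 c) (contMDiffAt_chart hx) hxs).of_le
        ENat.LEInfty.out
    have hpiola := sum_fderiv_pullback z _ hzd B hBA hAB η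
      (hη.differentiable (by simp) _) w
    have hfun : ∀ k : Fin n, (fun y : 𝔼 => sqrtDet g x ((chartAt 𝔼 x).symm y) *
        components x ((chartAt 𝔼 x).symm y) (chartField g c η w ((chartAt 𝔼 x).symm y)) k)
        =ᶠ[𝓝 (chartAt 𝔼 x x)] fun y => |(fderiv ℝ z y).det| * η (z y) * (B y w) k := by
      intro k
      filter_upwards [hev] with y ⟨hy, hyc⟩
      have hpos := (sqrtDet_pos g hyc).ne'
      rw [chartField_apply g hyc, sqrtDet_change g hyc ((chartAt 𝔼 x).map_target hy),
        (chartAt 𝔼 x).right_inv hy, components_eq_coframe, map_smul, PiLp.smul_apply, smul_eq_mul]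
      simp only [hB, hz, Function.comp_apply, ContinuousLinearMap.comp_apply]
      field_simp
    have hd : divergence g (chartField g c η w) x = (sqrtDet g x x)⁻¹ * _ :=
      congrArg ((sqrtDet g x x)⁻¹ * ·) (Finset.sum_congr rfl fun k _ =>
        congrArg (fun L : 𝔼 →L[ℝ] ℝ => L (EuclideanSpace.single k 1)) (hfun k).fderiv_eq)
    rw [hd, hpiola, hz0, pull_apply hx, sqrtDet_change g hx hxs]
    have h1 := (sqrtDet_pos g hx).ne'
    have h2 : |(fderiv ℝ z (chartAt 𝔼 x x)).det| ≠ 0 := by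
      intro h0
      have := sqrtDet_pos g hxs
      rw [sqrtDet_change g hx hxs, h0, zero_mul] at this
      exact lt_irrefl _ this
    field_simp
    exact mul_div_cancel_left₀ _ h2
  -- Off the compact set carrying the field, the field vanishes in a neighbourhood of `x` and both
  -- sides are zero; closedness of this set uses the Hausdorff property.
  · have h0 : pull c (fun y => fderiv ℝ η y w) x = 0 := by
      refine pull_of_notMem fun h => hx ?_
      refine image_mono ?_ h
      exact (tsupport_fderiv_apply_subset ℝ w)
    rw [h0, zero_mul]
    have hfun : ∀ k : Fin n, (fun y : 𝔼 => sqrtDet g x ((chartAt 𝔼 x).symm y) *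
        components x ((chartAt 𝔼 x).symm y) (chartField g c η w ((chartAt 𝔼 x).symm y)) k)
        =ᶠ[𝓝 (chartAt 𝔼 x x)] fun _ => 0 := by
      intro k
      have : ∀ᶠ y in 𝓝 (chartAt 𝔼 x x), (chartAt 𝔼 x).symm y ∈ (pullSet c (tsupport η))ᶜ := by
        refine hcont.preimage_mem_nhds ?_
        rw [hl]
        exact (isCompact_pullSet hηc hηt).isClosed.isOpen_compl.mem_nhds hx
      filter_upwards [this] with y hy
      rw [chartField_of_notMem g w hy, components_eq_coframe, map_zero]
      simp
    have hd : divergence g (chartField g c η w) x = (sqrtDet g x x)⁻¹ * _ :=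
      congrArg ((sqrtDet g x x)⁻¹ * ·) (Finset.sum_congr rfl fun k _ =>
        congrArg (fun L : 𝔼 →L[ℝ] ℝ => L (EuclideanSpace.single k 1)) (hfun k).fderiv_eq)
    rw [hd]
    simp

end ChartFields

/-! ### Smoothness of gradients and inequalities for the metric -/

section Gradient

variable {n : ℕ} {M : Type*} [TopologicalSpace M]
  [ChartedSpace (EuclideanSpace ℝ (Fin n)) M] [IsManifold (𝓡 n) ∞ M]

local notation "𝔼" => EuclideanSpace ℝ (Fin n)

variable {c x : M}

theorem IsTestFunction.mdifferentiableAt {φ : M → ℝ} (hφ : IsTestFunction n φ) (x : M) :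
    MDifferentiableAt (𝓡 n) 𝓘(ℝ) φ x := (hφ.1 x).mdifferentiableAt (by simp)

/-- The defining relation of the gradient is a linear system with the Gram matrix. Its explicit
solution gives smoothness of the gradient. -/
theorem coframe_gradient (g : Metric n M) (φ : M → ℝ) (hx : x ∈ (chartAt 𝔼 c).source) :
    (coframe c x (gradient g φ x)).ofLp = (gram g c x)⁻¹.mulVec fun i =>
      mvfderiv (𝓡 n) φ x (coordVector c x i) := by
  have hdet : IsUnit (gram g c x).det := (gram_posDef g hx).det_pos.ne'.isUnit
  have h : (fun i => mvfderiv (𝓡 n) φ x (coordVector c x i)) =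
      (gram g c x).mulVec (coframe c x (gradient g φ x)).ofLp := by
    ext i
    rw [← inner_gradient g φ x]
    conv_lhs => rw [← frame_coframe hx (gradient g φ x), coordVector_eq_frame, g.symm, inner_frame]
    simp [Matrix.mulVec, dotProduct, PiLp.single_apply, ite_mul]
  rw [h, Matrix.mulVec_mulVec, Matrix.nonsing_inv_mul _ hdet, Matrix.one_mulVec]

theorem contMDiffAt_mvfderiv_frame {φ : M → ℝ} (hφ : ContMDiff (𝓡 n) 𝓘(ℝ) ∞ φ)
    (hx : x ∈ (chartAt 𝔼 c).source) (w : 𝔼) :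
    ContMDiffAt (𝓡 n) 𝓘(ℝ) ∞ (fun x => mvfderiv (𝓡 n) φ x (frame c x w)) x := by
  have h1 : ContDiffAt ℝ ∞ (fun y => fderiv ℝ (φ ∘ (chartAt 𝔼 c).symm) y w) (chartAt 𝔼 c x) :=
    ((contDiffAt_comp_symm (hφ x) hx).fderiv_right (m := ∞) (by simp)).clm_apply contDiffAt_const
  refine (contMDiffAt_comp_chart h1 hx).congr_of_eventuallyEq ?_
  filter_upwards [(chartAt 𝔼 c).open_source.mem_nhds hx] with y hy
  exact mvfderiv_frame ((hφ y).mdifferentiableAt (by simp)) hy w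

theorem contMDiffAt_inv_gram (g : Metric n M) (hx : x ∈ (chartAt 𝔼 c).source) (i j : Fin n) :
    ContMDiffAt (𝓡 n) 𝓘(ℝ) ∞ (fun x => (gram g c x)⁻¹ i j) x := by
  simp only [Matrix.inv_def, Matrix.smul_apply, Ring.inverse_eq_inv', smul_eq_mul,
    Matrix.adjugate_apply]
  refine ((contMDiffAt_det (contMDiffAt_gram g hx)).inv₀ (gram_posDef g hx).det_pos.ne').mul
    (contMDiffAt_det fun k l => ?_)
  by_cases h : k = j
  · subst h
    simp only [Matrix.updateRow_self]
    exact contMDiffAt_const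
  · simp only [Matrix.updateRow_ne h]
    exact contMDiffAt_gram g hx k l

theorem contMDiffAt_gradient (g : Metric n M) {φ : M → ℝ} (hφ : ContMDiff (𝓡 n) 𝓘(ℝ) ∞ φ) (x : M) :
    ContMDiffAt (𝓡 n) (𝓡 n).tangent ∞
      (fun x => (⟨x, gradient g φ x⟩ : TangentBundle (𝓡 n) M)) x := by
  have hx : x ∈ (chartAt 𝔼 x).source := mem_chart_source 𝔼 x
  rw [contMDiffAt_section_iff_coframe hx]
  have h1 : ContMDiffAt (𝓡 n) 𝓘(ℝ, 𝔼) ∞ (fun y => ∑ i, (∑ j, (gram g x y)⁻¹ i j *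
      mvfderiv (𝓡 n) φ y (coordVector x y j)) • (EuclideanSpace.single i (1 : ℝ) : 𝔼)) x :=
    ContMDiffAt.sum fun i _ => ContMDiffAt.smul (ContMDiffAt.sum fun j _ =>
      (contMDiffAt_inv_gram g hx i j).mul (contMDiffAt_mvfderiv_frame hφ hx _)) contMDiffAt_const
  refine h1.congr_of_eventuallyEq ?_
  filter_upwards [(chartAt 𝔼 x).open_source.mem_nhds hx] with y hy
  rw [← sum_smul_single (coframe x y (gradient g φ y)), coframe_gradient g φ hy]
  rfl

theorem gradient_of_notMem_tsupport (g : Metric n M) {φ : M → ℝ} (hx : x ∉ tsupport φ) :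
    gradient g φ x = 0 := by
  have h : φ =ᶠ[𝓝 x] fun _ => 0 := by
    filter_upwards [(isClosed_tsupport φ).isOpen_compl.mem_nhds hx] with y hy
    exact image_eq_zero_of_notMem_tsupport hy
  have h2 : mvfderiv (𝓡 n) φ x = 0 := by
    ext X
    exact congrArg (fun L : TangentSpace (𝓡 n) x →L[ℝ] ℝ => L X)
      (h.mfderiv_eq.trans (mfderiv_const (I' := 𝓘(ℝ))))
  unfold gradient
  rw [h2]
  simp

theorem isTestField_smul_gradient (g : Metric n M) {a φ : M → ℝ}
    (ha : ContMDiff (𝓡 n) 𝓘(ℝ) ∞ a) (hφ : IsTestFunction n φ) :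
    IsTestField fun x => a x • gradient g φ x := by
  refine ⟨fun x => ?_, tsupport φ, hφ.2, fun x hx => ?_⟩
  · exact ContMDiffAt.smul_section (ha x) (contMDiffAt_gradient g hφ.1 x)
  · simp only [gradient_of_notMem_tsupport g hx, smul_zero]

theorem eq_of_inner_frame_eq (g : Metric n M) (hx : x ∈ (chartAt 𝔼 c).source)
    {X Y : TangentSpace (𝓡 n) x}
    (h : ∀ i, g.inner x X (coordVector c x i) = g.inner x Y (coordVector c x i)) : X = Y := by
  have h1 : ∀ Z, g.inner x (X - Y) Z = 0 := by
    intro Z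
    rw [← frame_coframe hx Z, ← sum_smul_single (coframe c x Z), map_sum, map_sum]
    refine Finset.sum_eq_zero fun i _ => ?_
    have := h i
    rw [coordVector_eq_frame] at this
    rw [map_smul, map_smul, map_sub, sub_apply, this, sub_self, smul_zero]
  by_contra hne
  exact (g.pos x (X - Y) (sub_ne_zero.2 hne)).ne' (h1 _)

theorem inner_self_nonneg (g : Metric n M) (X : TangentSpace (𝓡 n) x) : 0 ≤ g.inner x X X := by
  by_cases h : X = 0
  · simp [h]
  · exact (g.pos x X h).le

theorem two_mul_abs_inner_le (g : Metric n M) (X Y : TangentSpace (𝓡 n) x) :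
    2 * |g.inner x X Y| ≤ g.inner x X X + g.inner x Y Y := by
  have h1 := inner_self_nonneg g (X - Y)
  have h2 := inner_self_nonneg g (X + Y)
  simp only [map_sub, map_add, sub_apply, add_apply, g.symm x Y X] at h1 h2
  rcases abs_cases (g.inner x X Y) with ⟨h, _⟩ | ⟨h, _⟩ <;> rw [h] <;> linarith

theorem inner_add_self_le (g : Metric n M) (X Y : TangentSpace (𝓡 n) x) :
    g.inner x (X + Y) (X + Y) ≤ 2 * g.inner x X X + 2 * g.inner x Y Y := by
  have h1 := inner_self_nonneg g (X - Y)
  simp only [map_sub, map_add, sub_apply, add_apply, g.symm x Y X] at h1 ⊢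
  linarith

/-- Young's inequality for the rescaled vectors `√ε X` and `(a / √ε) Y`; a factor `1/2` is given
away. -/
theorem abs_inner_le_mul_add (g : Metric n M) (X Y : TangentSpace (𝓡 n) x) {ε : ℝ} (hε : 0 < ε)
    (a : ℝ) : |a * g.inner x X Y| ≤ ε * g.inner x X X + a ^ 2 / ε * g.inner x Y Y := by
  have h := two_mul_abs_inner_le g (√ε • X) ((a / √ε) • Y)
  have hs : 0 < √ε := Real.sqrt_pos.2 hε
  have hsq : √ε ^ 2 = ε := Real.sq_sqrt hε.le
  simp only [map_smul, smul_apply, smul_eq_mul] at h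
  have e1 : a / √ε * (√ε * g.inner x X Y) = a * g.inner x X Y := by field_simp
  have e2 : √ε * (√ε * g.inner x X X) = ε * g.inner x X X := by rw [← mul_assoc, ← sq, hsq]
  have e3 : a / √ε * (a / √ε * g.inner x Y Y) = a ^ 2 / ε * g.inner x Y Y := by
    rw [← mul_assoc, ← sq, div_pow, hsq]
  rw [e2, e3] at h
  rw [e1] at h
  linarith [abs_nonneg (a * g.inner x X Y)]

end Gradient

/-! ### The Riemannian volume in coordinates -/

theorem measurableSet_inter_preimage_of_continuousOn {α β : Type*} [TopologicalSpace α]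
    [MeasurableSpace α] [OpensMeasurableSpace α] [TopologicalSpace β] [MeasurableSpace β]
    [BorelSpace β] {f : α → β} {s : Set α} (hs : MeasurableSet s) (hf : ContinuousOn f s)
    {B : Set β} (hB : MeasurableSet B) : MeasurableSet (s ∩ f ⁻¹' B) := by
  have h := (continuousOn_iff_continuous_domRestrict.1 hf).measurable hB
  have := hs.subtype_image h
  convert this using 1
  ext x
  simp [and_comm]

section Measure

variable {n : ℕ} {M : Type*} [TopologicalSpace M]
  [ChartedSpace (EuclideanSpace ℝ (Fin n)) M] [IsManifold (𝓡 n) ∞ M] [MeasurableSpace M]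
  [BorelSpace M]

local notation "𝔼" => EuclideanSpace ℝ (Fin n)

variable {c : M}

theorem aemeasurable_chart_symm (c : M) :
    AEMeasurable (chartAt 𝔼 c).symm ((volume : Measure 𝔼).restrict (chartAt 𝔼 c).target) :=
  (chartAt 𝔼 c).continuousOn_symm.aemeasurable (chartAt 𝔼 c).open_target.measurableSet

theorem continuousOn_sqrtDet_symm (g : Metric n M) (c : M) :
    ContinuousOn (fun y => sqrtDet g c ((chartAt 𝔼 c).symm y)) (chartAt 𝔼 c).target := by
  intro y hy
  refine ContinuousAt.continuousWithinAt ?_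
  exact ContinuousAt.comp (f := (chartAt 𝔼 c).symm) (g := fun x => sqrtDet g c x)
    (contMDiffAt_sqrtDet g ((chartAt 𝔼 c).map_target hy)).continuousAt
    ((chartAt 𝔼 c).continuousAt_symm hy)

theorem aemeasurable_sqrtDet_symm (g : Metric n M) (c : M) :
    AEMeasurable (fun y => ENNReal.ofReal (sqrtDet g c ((chartAt 𝔼 c).symm y)))
      ((volume : Measure 𝔼).restrict (chartAt 𝔼 c).target) :=
  ((continuousOn_sqrtDet_symm g c).aemeasurable
    (chartAt 𝔼 c).open_target.measurableSet).ennreal_ofReal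

theorem chartVolume_apply (g : Metric n M) (c : M) {B : Set M} (hB : MeasurableSet B) :
    chartVolume g c B = ∫⁻ y in (chartAt 𝔼 c).target ∩ (chartAt 𝔼 c).symm ⁻¹' B,
      ENNReal.ofReal (sqrtDet g c ((chartAt 𝔼 c).symm y)) := by
  have hm := measurableSet_inter_preimage_of_continuousOn
    (chartAt 𝔼 c).open_target.measurableSet (chartAt 𝔼 c).continuousOn_symm hB
  unfold chartVolume
  rw [Measure.map_apply_of_aemeasurable
    ((aemeasurable_chart_symm c).mono_ac (withDensity_absolutelyContinuous _ _)) hB]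
  rw [← restrict_withDensity (chartAt 𝔼 c).open_target.measurableSet,
    Measure.restrict_apply' (chartAt 𝔼 c).open_target.measurableSet, inter_comm,
    withDensity_apply _ hm]

theorem target_inter_preimage_eq_image (c : M) {B : Set M} (hB : B ⊆ (chartAt 𝔼 c).source) :
    (chartAt 𝔼 c).target ∩ (chartAt 𝔼 c).symm ⁻¹' B = chartAt 𝔼 c '' B := by
  ext y
  constructor
  · rintro ⟨hy, hyB⟩
    exact ⟨_, hyB, (chartAt 𝔼 c).right_inv hy⟩
  · rintro ⟨x, hx, rfl⟩
    exact ⟨(chartAt 𝔼 c).map_source (hB hx), by rwa [mem_preimage, (chartAt 𝔼 c).left_inv (hB hx)]⟩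

theorem chartVolume_compl_source (g : Metric n M) (c : M) :
    chartVolume g c (chartAt 𝔼 c).sourceᶜ = 0 := by
  rw [chartVolume_apply g c (chartAt 𝔼 c).open_source.measurableSet.compl]
  have : (chartAt 𝔼 c).target ∩ (chartAt 𝔼 c).symm ⁻¹' (chartAt 𝔼 c).sourceᶜ = ∅ := by
    ext y
    simp only [mem_inter_iff, mem_preimage, mem_compl_iff, mem_empty_iff_false, iff_false, not_and,
      not_not]
    exact fun hy => (chartAt 𝔼 c).map_target hy
  rw [this]
  simp

/-- Change of variables under the transition map: its Jacobian is the factor by which the two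
densities differ. -/
theorem chartVolume_eq_of_subset (g : Metric n M) {c c' : M} {B : Set M} (hB : MeasurableSet B)
    (hBc : B ⊆ (chartAt 𝔼 c).source) (hBc' : B ⊆ (chartAt 𝔼 c').source) :
    chartVolume g c' B = chartVolume g c B := by
  have hm := measurableSet_inter_preimage_of_continuousOn
    (chartAt 𝔼 c').open_target.measurableSet (chartAt 𝔼 c').continuousOn_symm hB
  rw [chartVolume_apply g c hB, chartVolume_apply g c' hB]
  rw [target_inter_preimage_eq_image c hBc]
  rw [target_inter_preimage_eq_image c' hBc'] at hm ⊢
  set z := chartAt 𝔼 c ∘ (chartAt 𝔼 c').symm with hz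
  have hl : ∀ x ∈ B, (chartAt 𝔼 c').symm (chartAt 𝔼 c' x) = x := fun x hx =>
    (chartAt 𝔼 c').left_inv (hBc' hx)
  have himg : chartAt 𝔼 c '' B = z '' (chartAt 𝔼 c' '' B) := by
    rw [image_image]
    exact image_congr fun x hx => by simp [hz, hl x hx]
  have hinj : InjOn z (chartAt 𝔼 c' '' B) := by
    rintro _ ⟨x, hx, rfl⟩ _ ⟨x', hx', rfl⟩ h
    simp only [hz, Function.comp_apply, hl x hx, hl x' hx'] at h
    rw [(chartAt 𝔼 c).injOn (hBc hx) (hBc hx') h]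
  have hder : ∀ y ∈ chartAt 𝔼 c' '' B,
      HasFDerivWithinAt z (fderiv ℝ z y) (chartAt 𝔼 c' '' B) y := by
    rintro _ ⟨x, hx, rfl⟩
    exact ((contDiffAt_comp_symm (f := chartAt 𝔼 c) (contMDiffAt_chart (hBc hx))
      (hBc' hx)).differentiableAt (by simp)).hasFDerivAt.hasFDerivWithinAt
  rw [himg, lintegral_image_eq_lintegral_abs_det_fderiv_mul volume hm hder hinj]
  refine setLIntegral_congr_fun hm ?_
  rintro _ ⟨x, hx, rfl⟩
  simp only [hz, Function.comp_apply, hl x hx, (chartAt 𝔼 c).left_inv (hBc hx)]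
  rw [sqrtDet_change g (hBc hx) (hBc' hx), ENNReal.ofReal_mul (abs_nonneg _)]

/-- The supremum of measures is controlled by an upper bound. Every chart measure is at most
`chartVolume g c` plus the volume restricted to the complement of the domain at `c`, since chart
measures agree on overlaps. The bound passes to the supremum, and restriction to the domain removes
the second summand. -/
theorem restrict_riemannianVolume (g : Metric n M) (c : M) :
    (riemannianVolume g).restrict (chartAt 𝔼 c).source = chartVolume g c := by
  have hS := (chartAt 𝔼 c).open_source.measurableSet
  refine le_antisymm ?_ ?_
  · have hle : riemannianVolume g ≤
        chartVolume g c + (riemannianVolume g).restrict (chartAt 𝔼 c).sourceᶜ := by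
      refine iSup_le fun c' => Measure.le_iff.2 fun B hB => ?_
      rw [← measure_inter_add_sdiff B hS, Measure.add_apply, Measure.restrict_apply hB]
      refine add_le_add ?_ (Measure.le_iff.1 (le_iSup (chartVolume g) c') _ (hB.diff hS))
      have hm : MeasurableSet (B ∩ (chartAt 𝔼 c).source ∩ (chartAt 𝔼 c').source) :=
        (hB.inter hS).inter (chartAt 𝔼 c').open_source.measurableSet
      calc chartVolume g c' (B ∩ (chartAt 𝔼 c).source)
          ≤ chartVolume g c' (B ∩ (chartAt 𝔼 c).source ∩ (chartAt 𝔼 c').source)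
            + chartVolume g c' (chartAt 𝔼 c').sourceᶜ := by
            refine (measure_mono fun x hx => ?_).trans (measure_union_le _ _)
            by_cases h : x ∈ (chartAt 𝔼 c').source
            · exact Or.inl ⟨hx, h⟩
            · exact Or.inr h
        _ = chartVolume g c (B ∩ (chartAt 𝔼 c).source ∩ (chartAt 𝔼 c').source) := by
            rw [chartVolume_compl_source, add_zero]
            exact chartVolume_eq_of_subset g hm (fun x hx => hx.1.2) fun x hx => hx.2
        _ ≤ chartVolume g c B := measure_mono fun x hx => hx.1.1
    calc (riemannianVolume g).restrict (chartAt 𝔼 c).source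
        ≤ (chartVolume g c + (riemannianVolume g).restrict (chartAt 𝔼 c).sourceᶜ).restrict
          (chartAt 𝔼 c).source := Measure.restrict_mono_measure hle _
      _ = (chartVolume g c).restrict (chartAt 𝔼 c).source := by
          rw [Measure.restrict_add, Measure.restrict_restrict hS, inter_compl_self,
            Measure.restrict_empty, add_zero]
      _ ≤ chartVolume g c := Measure.restrict_le_self
  · have : (chartVolume g c).restrict (chartAt 𝔼 c).source = chartVolume g c :=
      Measure.restrict_eq_self_of_ae_mem (by
        rw [ae_iff]; exact chartVolume_compl_source g c)
    rw [← this]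
    exact Measure.restrict_mono_measure (le_iSup (chartVolume g) c) _

theorem restrict_target_absolutelyContinuous (g : Metric n M) (c : M) :
    (volume : Measure 𝔼).restrict (chartAt 𝔼 c).target ≪
      ((volume : Measure 𝔼).restrict (chartAt 𝔼 c).target).withDensity
        (fun y => ENNReal.ofReal (sqrtDet g c ((chartAt 𝔼 c).symm y))) := by
  refine withDensity_absolutelyContinuous' (aemeasurable_sqrtDet_symm g c) ?_
  filter_upwards [ae_restrict_mem (chartAt 𝔼 c).open_target.measurableSet] with y hy
  simpa using sqrtDet_pos g ((chartAt 𝔼 c).map_target hy)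

/-- The density is positive on the chart, so Lebesgue null sets and volume null sets correspond.
This and its converse below carry almost everywhere statements and measurability across the chart.
-/
theorem map_symm_absolutelyContinuous (g : Metric n M) (c : M) :
    ((volume : Measure 𝔼).restrict (chartAt 𝔼 c).target).map (chartAt 𝔼 c).symm ≪
      (riemannianVolume g).restrict (chartAt 𝔼 c).source := by
  rw [restrict_riemannianVolume]
  refine Measure.AbsolutelyContinuous.mk fun B hB h => ?_
  unfold chartVolume at h
  rw [Measure.map_apply_of_aemeasurable
    ((aemeasurable_chart_symm c).mono_ac (withDensity_absolutelyContinuous _ _)) hB] at h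
  rw [Measure.map_apply_of_aemeasurable (aemeasurable_chart_symm c) hB]
  exact restrict_target_absolutelyContinuous g c h

theorem aemeasurable_chart (g : Metric n M) (c : M) :
    AEMeasurable (chartAt 𝔼 c) ((riemannianVolume g).restrict (chartAt 𝔼 c).source) :=
  (chartAt 𝔼 c).continuousOn.aemeasurable (chartAt 𝔼 c).open_source.measurableSet

theorem map_chart_absolutelyContinuous (g : Metric n M) (c : M) :
    ((riemannianVolume g).restrict (chartAt 𝔼 c).source).map (chartAt 𝔼 c) ≪
      (volume : Measure 𝔼).restrict (chartAt 𝔼 c).target := by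
  have hS := (chartAt 𝔼 c).open_source.measurableSet
  refine Measure.AbsolutelyContinuous.mk fun B hB h => ?_
  rw [Measure.map_apply_of_aemeasurable (aemeasurable_chart g c) hB, Measure.restrict_apply' hS,
    inter_comm, ← Measure.restrict_eq_self _ (inter_subset_left (t := chartAt 𝔼 c ⁻¹' B)),
    restrict_riemannianVolume, chartVolume_apply g c
      (measurableSet_inter_preimage_of_continuousOn hS (chartAt 𝔼 c).continuousOn hB)]
  refine setLIntegral_measure_zero _ _ ?_
  rw [Measure.restrict_apply hB] at h
  have hsub : (chartAt 𝔼 c).target ∩ (chartAt 𝔼 c).symm ⁻¹' ((chartAt 𝔼 c).source ∩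
      chartAt 𝔼 c ⁻¹' B) ⊆ B ∩ (chartAt 𝔼 c).target := by
    rintro y ⟨hy, hy'⟩
    have := hy'.2
    rw [mem_preimage, (chartAt 𝔼 c).right_inv hy] at this
    exact ⟨this, hy⟩
  exact measure_mono_null hsub h

theorem aemeasurable_comp_symm (g : Metric n M) {β : Type*} [MeasurableSpace β] {f : M → β}
    (hf : AEMeasurable f ((riemannianVolume g).restrict (chartAt 𝔼 c).source)) :
    AEMeasurable (fun y => f ((chartAt 𝔼 c).symm y))
      ((volume : Measure 𝔼).restrict (chartAt 𝔼 c).target) :=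
  (hf.mono_ac (map_symm_absolutelyContinuous g c)).comp_aemeasurable (aemeasurable_chart_symm c)

theorem aemeasurable_comp_chart (g : Metric n M) {β : Type*} [MeasurableSpace β] {h : 𝔼 → β}
    (hh : AEMeasurable h ((volume : Measure 𝔼).restrict (chartAt 𝔼 c).target)) :
    AEMeasurable (fun x => h (chartAt 𝔼 c x))
      ((riemannianVolume g).restrict (chartAt 𝔼 c).source) :=
  (hh.mono_ac (map_chart_absolutelyContinuous g c)).comp_aemeasurable (aemeasurable_chart g c)

theorem ae_source_iff (g : Metric n M) {p : M → Prop} :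
    (∀ᵐ x ∂(riemannianVolume g).restrict (chartAt 𝔼 c).source, p x) ↔
      ∀ᵐ y ∂(volume : Measure 𝔼).restrict (chartAt 𝔼 c).target, p ((chartAt 𝔼 c).symm y) := by
  constructor
  · intro h
    exact ae_of_ae_map (aemeasurable_chart_symm c) ((map_symm_absolutelyContinuous g c).ae_le h)
  · intro h
    have := ae_of_ae_map (aemeasurable_chart g c)
      ((map_chart_absolutelyContinuous g c).ae_le h)
    filter_upwards [this, ae_restrict_mem (chartAt 𝔼 c).open_source.measurableSet] with x hx hxs
    rwa [(chartAt 𝔼 c).left_inv hxs] at hx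

theorem setLIntegral_source (g : Metric n M) {f : M → ℝ≥0∞}
    (hf : AEMeasurable f ((riemannianVolume g).restrict (chartAt 𝔼 c).source)) :
    ∫⁻ x in (chartAt 𝔼 c).source, f x ∂(riemannianVolume g) =
      ∫⁻ y in (chartAt 𝔼 c).target, ENNReal.ofReal (sqrtDet g c ((chartAt 𝔼 c).symm y)) *
        f ((chartAt 𝔼 c).symm y) := by
  have hf' := hf
  rw [restrict_riemannianVolume] at hf' ⊢
  unfold chartVolume at hf' ⊢
  rw [lintegral_map' hf'
    ((aemeasurable_chart_symm c).mono_ac (withDensity_absolutelyContinuous _ _)),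
    lintegral_withDensity_eq_lintegral_mul₀ (aemeasurable_sqrtDet_symm g c)
      (aemeasurable_comp_symm g hf)]
  rfl

theorem setIntegral_source (g : Metric n M) {f : M → ℝ}
    (hf : AEMeasurable f ((riemannianVolume g).restrict (chartAt 𝔼 c).source)) :
    ∫ x in (chartAt 𝔼 c).source, f x ∂(riemannianVolume g) =
      ∫ y in (chartAt 𝔼 c).target, sqrtDet g c ((chartAt 𝔼 c).symm y) *
        f ((chartAt 𝔼 c).symm y) := by
  have hf' := hf
  rw [restrict_riemannianVolume] at hf' ⊢
  unfold chartVolume at hf' ⊢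
  rw [integral_map
    ((aemeasurable_chart_symm c).mono_ac (withDensity_absolutelyContinuous _ _))
    hf'.aestronglyMeasurable,
    integral_withDensity_eq_integral_toReal_smul₀ (aemeasurable_sqrtDet_symm g c)
      (Eventually.of_forall fun _ => ENNReal.ofReal_lt_top)]
  refine integral_congr_ae (Eventually.of_forall fun y => ?_)
  simp only [smul_eq_mul]
  rw [ENNReal.toReal_ofReal (show 0 ≤ sqrtDet g c _ from Real.sqrt_nonneg _)]

instance instIsLocallyFiniteMeasure (g : Metric n M) :
    IsLocallyFiniteMeasure (riemannianVolume g) := by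
  refine ⟨fun x => ?_⟩
  have hx : x ∈ (chartAt 𝔼 x).source := mem_chart_source 𝔼 x
  obtain ⟨K, hK, hKt, hKx⟩ := exists_compact_subset (chartAt 𝔼 x).open_target (chart_mem_target hx)
  have hKm : MeasurableSet ((chartAt 𝔼 x).source ∩ chartAt 𝔼 x ⁻¹' K) :=
    measurableSet_inter_preimage_of_continuousOn (chartAt 𝔼 x).open_source.measurableSet
      (chartAt 𝔼 x).continuousOn hK.measurableSet
  refine ⟨(chartAt 𝔼 x).source ∩ chartAt 𝔼 x ⁻¹' K, ?_, ?_⟩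
  · exact Filter.inter_mem ((chartAt 𝔼 x).open_source.mem_nhds hx)
      (((chartAt 𝔼 x).continuousAt hx).preimage_mem_nhds (mem_interior_iff_mem_nhds.1 hKt))
  · rw [← Measure.restrict_eq_self _ inter_subset_left, restrict_riemannianVolume,
      chartVolume_apply g x hKm]
    refine (lintegral_mono_set (t := K) fun y hy => ?_).trans_lt ?_
    · have := hy.2.2
      rwa [mem_preimage, (chartAt 𝔼 x).right_inv hy.1] at this
    · have := ((continuousOn_sqrtDet_symm g x).mono hKx).integrableOn_compact (μ := volume) hK
      exact this.lintegral_lt_top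

theorem exists_countable_cover_source [SecondCountableTopology M] :
    ∃ s : Set M, s.Countable ∧ ⋃ c ∈ s, (chartAt 𝔼 c).source = univ :=
  TopologicalSpace.countable_cover_nhds fun x =>
    (chartAt 𝔼 x).open_source.mem_nhds (mem_chart_source 𝔼 x)

theorem ae_of_ae_source [SecondCountableTopology M] {μ : Measure M} {p : M → Prop}
    (h : ∀ c : M, ∀ᵐ x ∂μ.restrict (chartAt 𝔼 c).source, p x) : ∀ᵐ x ∂μ, p x := by
  obtain ⟨s, hs, hsu⟩ := exists_countable_cover_source (n := n) (M := M)
  rw [← Measure.restrict_univ (μ := μ), ← hsu, ae_restrict_biUnion_iff _ hs]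
  exact fun c _ => h c

theorem aemeasurable_of_source [SecondCountableTopology M] {μ : Measure M} {β : Type*}
    [MeasurableSpace β] {f : M → β}
    (h : ∀ c : M, AEMeasurable f (μ.restrict (chartAt 𝔼 c).source)) : AEMeasurable f μ := by
  obtain ⟨s, hs, hsu⟩ := exists_countable_cover_source (n := n) (M := M)
  have := hs.to_subtype
  rw [← Measure.restrict_univ (μ := μ), ← hsu, biUnion_eq_iUnion, aemeasurable_iUnion_iff]
  exact fun c => h c

end Measure

/-! ### Norm bounds by covariant components on compact sets -/

section LocalEstimates

variable {n : ℕ} {M : Type*} [TopologicalSpace M]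
  [ChartedSpace (EuclideanSpace ℝ (Fin n)) M] [IsManifold (𝓡 n) ∞ M]

local notation "𝔼" => EuclideanSpace ℝ (Fin n)

variable {c x : M}

theorem inner_sq_le (g : Metric n M) (X Y : TangentSpace (𝓡 n) x) :
    g.inner x X Y ^ 2 ≤ g.inner x X X * g.inner x Y Y := by
  by_cases hY : Y = 0
  · simp [hY]
  · have hp := g.pos x Y hY
    have h := inner_self_nonneg g (g.inner x Y Y • X - g.inner x X Y • Y)
    simp only [map_sub, map_smul, sub_apply, smul_apply, smul_eq_mul, g.symm x Y X] at h
    have : 0 ≤ g.inner x Y Y * (g.inner x X X * g.inner x Y Y - g.inner x X Y ^ 2) := by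
      nlinarith [h]
    have := nonneg_of_mul_nonneg_right this hp
    linarith

theorem inner_self_eq_sum (g : Metric n M) (hx : x ∈ (chartAt 𝔼 c).source)
    (Y : TangentSpace (𝓡 n) x) :
    g.inner x Y Y = ∑ i, ∑ j, (gram g c x)⁻¹ i j *
      (g.inner x Y (coordVector c x i) * g.inner x Y (coordVector c x j)) := by
  have hdet : IsUnit (gram g c x).det := (gram_posDef g hx).det_pos.ne'.isUnit
  set u := (coframe c x Y).ofLp with hu
  set b : Fin n → ℝ := fun i => g.inner x Y (coordVector c x i) with hb
  have h1 : b = (gram g c x).mulVec u := by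
    ext i
    rw [hb]
    simp only
    conv_lhs => rw [← frame_coframe hx Y, coordVector_eq_frame, g.symm, inner_frame]
    simp [hu, Matrix.mulVec, dotProduct, PiLp.single_apply, ite_mul]
  have h2 : u = (gram g c x)⁻¹.mulVec b := by
    rw [h1, Matrix.mulVec_mulVec, Matrix.nonsing_inv_mul _ hdet, Matrix.one_mulVec]
  have h3 : g.inner x Y Y = ∑ i, u i * b i := by
    conv_lhs => rw [← frame_coframe hx Y, inner_frame]
    rw [h1]
    simp [hu, Matrix.mulVec, dotProduct, Finset.mul_sum, mul_assoc]
  rw [h3]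
  refine Finset.sum_congr rfl fun i _ => ?_
  rw [h2]
  simp only [Matrix.mulVec, dotProduct, Finset.sum_mul]
  refine Finset.sum_congr rfl fun j _ => ?_
  ring

/-- The covariant components are the quantities seen by the weak identities in a chart. The norm is
a quadratic form in them with the inverse Gram matrix, whose entries are bounded on compact sets. -/
theorem exists_inner_self_le (g : Metric n M) {K : Set M} (hK : IsCompact K)
    (hKs : K ⊆ (chartAt 𝔼 c).source) : ∃ C : ℝ, 0 ≤ C ∧ ∀ x ∈ K, ∀ Y : TangentSpace (𝓡 n) x,
      g.inner x Y Y ≤ C * ∑ i, g.inner x Y (coordVector c x i) ^ 2 := by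
  have hcont : ContinuousOn (fun x => ∑ i, ∑ j, |(gram g c x)⁻¹ i j|) K := by
    refine continuousOn_finsetSum _ fun i _ => continuousOn_finsetSum _ fun j _ => ?_
    exact fun x hx => (contMDiffAt_inv_gram g (hKs hx) i j).continuousAt.abs.continuousWithinAt
  obtain ⟨C, hC⟩ := hK.exists_bound_of_continuousOn hcont
  refine ⟨|C|, abs_nonneg _, fun x hx Y => ?_⟩
  rw [inner_self_eq_sum g (hKs hx) Y]
  set S := ∑ i, g.inner x Y (coordVector c x i) ^ 2
  have hS : ∀ i j, |g.inner x Y (coordVector c x i) * g.inner x Y (coordVector c x j)| ≤ S := by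
    intro i j
    have h1 : ∀ i, g.inner x Y (coordVector c x i) ^ 2 ≤ S := fun i =>
      Finset.single_le_sum (f := fun i => g.inner x Y (coordVector c x i) ^ 2)
        (fun _ _ => sq_nonneg _) (Finset.mem_univ i)
    rw [abs_le]
    constructor
    · nlinarith [h1 i, h1 j, sq_nonneg (g.inner x Y (coordVector c x i) +
        g.inner x Y (coordVector c x j))]
    · nlinarith [h1 i, h1 j, sq_nonneg (g.inner x Y (coordVector c x i) -
        g.inner x Y (coordVector c x j))]
  calc _ ≤ ∑ i, ∑ j, |(gram g c x)⁻¹ i j| * S := by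
        refine Finset.sum_le_sum fun i _ => Finset.sum_le_sum fun j _ => ?_
        refine (le_abs_self _).trans ?_
        rw [abs_mul]
        exact mul_le_mul_of_nonneg_left (hS i j) (abs_nonneg _)
    _ = (∑ i, ∑ j, |(gram g c x)⁻¹ i j|) * S := by simp [Finset.sum_mul]
    _ ≤ |C| * S := by
        refine mul_le_mul_of_nonneg_right ?_ (Finset.sum_nonneg fun _ _ => sq_nonneg _)
        exact (le_abs_self _).trans ((hC x hx).trans (le_abs_self C))

end LocalEstimates

/-! ### Measurable fields and weak gradients in a chart -/

section LocalMeasure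

variable {n : ℕ} {M : Type*} [TopologicalSpace M]
  [ChartedSpace (EuclideanSpace ℝ (Fin n)) M] [IsManifold (𝓡 n) ∞ M] [MeasurableSpace M]
  [BorelSpace M]

local notation "𝔼" => EuclideanSpace ℝ (Fin n)

variable {c : M}

theorem exists_lintegral_compare (g : Metric n M) {K : Set M} (hK : IsCompact K)
    (hKs : K ⊆ (chartAt 𝔼 c).source) : ∃ C : ℝ≥0∞, C ≠ ⊤ ∧ ∀ A : M → ℝ≥0∞,
      AEMeasurable A ((riemannianVolume g).restrict (chartAt 𝔼 c).source) → (∀ x ∉ K, A x = 0) →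
      ∫⁻ y in (chartAt 𝔼 c).target, A ((chartAt 𝔼 c).symm y) ≤ C * ∫⁻ x, A x ∂(riemannianVolume g) ∧
      ∫⁻ x, A x ∂(riemannianVolume g) ≤
        C * ∫⁻ y in (chartAt 𝔼 c).target, A ((chartAt 𝔼 c).symm y) := by
  have hpos : ∀ x ∈ K, 0 < sqrtDet g c x := fun x hx => sqrtDet_pos g (hKs hx)
  have hc1 : ContinuousOn (fun x => sqrtDet g c x) K := fun x hx =>
    (contMDiffAt_sqrtDet g (hKs hx)).continuousAt.continuousWithinAt
  have hc2 : ContinuousOn (fun x => (sqrtDet g c x)⁻¹) K :=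
    hc1.inv₀ fun x hx => (hpos x hx).ne'
  obtain ⟨C₁, hC₁⟩ := hK.exists_bound_of_continuousOn hc1
  obtain ⟨C₂, hC₂⟩ := hK.exists_bound_of_continuousOn hc2
  refine ⟨ENNReal.ofReal (max C₁ C₂), ENNReal.ofReal_ne_top, fun A hA hAK => ?_⟩
  have htm := (chartAt 𝔼 c).open_target.measurableSet
  have hvol : ∫⁻ x, A x ∂(riemannianVolume g) = ∫⁻ y in (chartAt 𝔼 c).target,
      ENNReal.ofReal (sqrtDet g c ((chartAt 𝔼 c).symm y)) * A ((chartAt 𝔼 c).symm y) := by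
    rw [← setLIntegral_source g hA, setLIntegral_eq_of_support_subset]
    intro x hx
    by_contra h
    exact hx (hAK x fun h' => h (hKs h'))
  rw [hvol]
  have hAm := aemeasurable_comp_symm g hA
  constructor
  · rw [← lintegral_const_mul' _ _ ENNReal.ofReal_ne_top]
    refine setLIntegral_mono' htm fun y hy => ?_
    by_cases h : (chartAt 𝔼 c).symm y ∈ K
    · rw [← mul_assoc, ← ENNReal.ofReal_mul' (hpos _ h).le]
      refine le_mul_of_one_le_left zero_le ?_
      rw [ENNReal.one_le_ofReal]
      have h2 := hC₂ _ h
      rw [Real.norm_of_nonneg (inv_nonneg.2 (hpos _ h).le)] at h2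
      calc 1 = (sqrtDet g c ((chartAt 𝔼 c).symm y))⁻¹ * sqrtDet g c ((chartAt 𝔼 c).symm y) :=
            (inv_mul_cancel₀ (hpos _ h).ne').symm
        _ ≤ _ := mul_le_mul_of_nonneg_right (h2.trans (le_max_right _ _)) (hpos _ h).le
    · rw [hAK _ h]; exact zero_le
  · rw [← lintegral_const_mul' _ _ ENNReal.ofReal_ne_top]
    refine setLIntegral_mono' htm fun y hy => ?_
    by_cases h : (chartAt 𝔼 c).symm y ∈ K
    · refine mul_le_mul_left ?_ _
      have h1 := hC₁ _ h
      rw [Real.norm_of_nonneg (hpos _ h).le] at h1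
      exact ENNReal.ofReal_le_ofReal (h1.trans (le_max_left _ _))
    · rw [hAK _ h]; simp

theorem aemeasurable_inner (g : Metric n M) {X Y : VectorField n M}
    (hX : AEMeasurable (fun x => components c x (X x))
      ((riemannianVolume g).restrict (chartAt 𝔼 c).source))
    (hY : AEMeasurable (fun x => components c x (Y x))
      ((riemannianVolume g).restrict (chartAt 𝔼 c).source)) :
    AEMeasurable (fun x => g.inner x (X x) (Y x))
      ((riemannianVolume g).restrict (chartAt 𝔼 c).source) := by
  have hm := (chartAt 𝔼 c).open_source.measurableSet
  have h : AEMeasurable (fun x => ∑ i, ∑ j, components c x (X x) i * gram g c x i j *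
      components c x (Y x) j) ((riemannianVolume g).restrict (chartAt 𝔼 c).source) := by
    refine Finset.aemeasurable_fun_sum _ fun i _ => Finset.aemeasurable_fun_sum _ fun j _ => ?_
    refine AEMeasurable.mul (AEMeasurable.mul ?_ ?_) ?_
    · exact (EuclideanSpace.proj (𝕜 := ℝ) i).measurable.comp_aemeasurable hX
    · exact ContinuousOn.aemeasurable (fun x hx =>
        (contMDiffAt_gram g hx i j).continuousAt.continuousWithinAt) hm
    · exact (EuclideanSpace.proj (𝕜 := ℝ) j).measurable.comp_aemeasurable hY
  refine h.congr ?_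
  filter_upwards [ae_restrict_mem hm] with x hx
  rw [components_eq_coframe, components_eq_coframe, ← inner_frame, frame_coframe hx,
    frame_coframe hx]

/-- `X` is measurable: it has measurable components in every chart, up to null sets. -/
def IsMeasurableField (g : Metric n M) (X : VectorField n M) : Prop :=
  ∀ c : M, AEMeasurable (fun x => components c x (X x))
    ((riemannianVolume g).restrict (chartAt 𝔼 c).source)

theorem isMeasurableField_of_contMDiff (g : Metric n M) {X : VectorField n M}
    (hX : ∀ x, ContMDiffAt (𝓡 n) (𝓡 n).tangent ∞
      (fun x => (⟨x, X x⟩ : TangentBundle (𝓡 n) M)) x) : IsMeasurableField g X := fun c =>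
  ContinuousOn.aemeasurable (fun x hx =>
    ((contMDiffAt_section_iff_coframe hx).1 (hX x)).continuousAt.continuousWithinAt)
    (chartAt 𝔼 c).open_source.measurableSet

theorem IsMeasurableField.add {g : Metric n M} {X Y : VectorField n M} (hX : IsMeasurableField g X)
    (hY : IsMeasurableField g Y) : IsMeasurableField g fun x => X x + Y x := fun c => by
  simp only [components_eq_coframe, map_add]
  exact (hX c).add (hY c)

theorem IsMeasurableField.sub {g : Metric n M} {X Y : VectorField n M} (hX : IsMeasurableField g X)
    (hY : IsMeasurableField g Y) : IsMeasurableField g fun x => X x - Y x := fun c => by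
  simp only [components_eq_coframe, map_sub]
  exact (hX c).sub (hY c)

theorem IsMeasurableField.smul {g : Metric n M} {a : M → ℝ} {X : VectorField n M}
    (ha : AEMeasurable a (riemannianVolume g)) (hX : IsMeasurableField g X) :
    IsMeasurableField g fun x => a x • X x := fun c => by
  simp only [components_eq_coframe, map_smul]
  exact ha.restrict.smul (hX c)

theorem IsMeasurableField.aemeasurable_inner [SecondCountableTopology M] {g : Metric n M}
    {X Y : VectorField n M} (hX : IsMeasurableField g X) (hY : IsMeasurableField g Y) :
    AEMeasurable (fun x => g.inner x (X x) (Y x)) (riemannianVolume g) :=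
  aemeasurable_of_source fun c => WeightedManifold.aemeasurable_inner g (hX c) (hY c)

theorem IsMeasurableField.aemeasurable_inner_frame {g : Metric n M} {X : VectorField n M}
    (hX : IsMeasurableField g X) (w : 𝔼) : AEMeasurable (fun x => g.inner x (X x) (frame c x w))
      ((riemannianVolume g).restrict (chartAt 𝔼 c).source) := by
  refine WeightedManifold.aemeasurable_inner g (hX c) ?_
  refine (aemeasurable_const (b := w)).congr ?_
  filter_upwards [ae_restrict_mem (chartAt 𝔼 c).open_source.measurableSet] with x hx
  exact (coframe_frame hx w).symm

/-- `f` and `X` are measurable and locally square integrable, and `X` is the distributional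
gradient of `f`. -/
structure IsLocalGradient (g : Metric n M) (f : M → ℝ) (X : VectorField n M) : Prop where
  aemeasurable : AEMeasurable f (riemannianVolume g)
  isMeasurableField : IsMeasurableField g X
  lintegral_sq_lt_top : ∀ K : Set M, IsCompact K →
    ∫⁻ x in K, ‖f x‖ₑ ^ 2 ∂(riemannianVolume g) < ⊤
  lintegral_inner_lt_top : ∀ K : Set M, IsCompact K →
    ∫⁻ x in K, ENNReal.ofReal (g.inner x (X x) (X x)) ∂(riemannianVolume g) < ⊤
  weak : ∀ ψ : VectorField n M, IsTestField ψ →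
    distGradient g (toDistribution g f) ψ = toVectorDistribution g X ψ

/-- The weak gradient identity is tested with `chartField g c η w`. The factor `1 / √(det g)` in the
field and in its divergence cancels the volume density, leaving an unweighted identity for Lebesgue
measure. -/
theorem integral_chart_weak [T2Space M] {g : Metric n M} {f : M → ℝ} {X : VectorField n M}
    (h : IsLocalGradient g f X) {η : 𝔼 → ℝ} (hη : ContDiff ℝ ∞ η) (hηc : HasCompactSupport η)
    (hηt : tsupport η ⊆ (chartAt 𝔼 c).target) (w : 𝔼) :
    ∫ y in (chartAt 𝔼 c).target, f ((chartAt 𝔼 c).symm y) * fderiv ℝ η y w =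
      -∫ y in (chartAt 𝔼 c).target, g.inner ((chartAt 𝔼 c).symm y) (X ((chartAt 𝔼 c).symm y))
        (frame c ((chartAt 𝔼 c).symm y) w) * η y := by
  have hm := (chartAt 𝔼 c).open_source.measurableSet
  have htm := (chartAt 𝔼 c).open_target.measurableSet
  have hw := h.weak _ (isTestField_chartField g hη hηc hηt w)
  unfold distGradient toDistribution toVectorDistribution at hw
  have hsq : AEMeasurable (fun x => sqrtDet g c x)
      ((riemannianVolume g).restrict (chartAt 𝔼 c).source) :=
    ContinuousOn.aemeasurable (fun x hx =>
      (contMDiffAt_sqrtDet g hx).continuousAt.continuousWithinAt) hm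
  have hηd : Continuous fun y => fderiv ℝ η y w :=
    (hη.continuous_fderiv (by simp)).clm_apply continuous_const
  have hL : ∫ x, f x * divergence g (chartField g c η w) x ∂(riemannianVolume g) =
      ∫ y in (chartAt 𝔼 c).target, f ((chartAt 𝔼 c).symm y) * fderiv ℝ η y w := by
    rw [← setIntegral_eq_integral_of_forall_compl_eq_zero (s := (chartAt 𝔼 c).source),
      setIntegral_source g]
    · refine setIntegral_congr_fun htm fun y hy => ?_
      have hys := (chartAt 𝔼 c).map_target hy
      have := (sqrtDet_pos g hys).ne'
      simp only [divergence_chartField g hη hηc hηt, pull_apply hys, (chartAt 𝔼 c).right_inv hy]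
      field_simp
    · refine h.aemeasurable.restrict.mul ?_
      refine ((aemeasurable_comp_chart g (c := c) hηd.measurable.aemeasurable).mul
        hsq.inv).congr ?_
      filter_upwards [ae_restrict_mem hm] with x hx
      simp [divergence_chartField g hη hηc hηt, pull_apply hx]
    · intro x hx
      rw [divergence_chartField g hη hηc hηt, pull, indicator_of_notMem hx, zero_mul, mul_zero]
  have hR : ∫ x, g.inner x (X x) (chartField g c η w x) ∂(riemannianVolume g) =
      ∫ y in (chartAt 𝔼 c).target, g.inner ((chartAt 𝔼 c).symm y) (X ((chartAt 𝔼 c).symm y))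
        (frame c ((chartAt 𝔼 c).symm y) w) * η y := by
    rw [← setIntegral_eq_integral_of_forall_compl_eq_zero (s := (chartAt 𝔼 c).source),
      setIntegral_source g]
    · refine setIntegral_congr_fun htm fun y hy => ?_
      have hys := (chartAt 𝔼 c).map_target hy
      have := (sqrtDet_pos g hys).ne'
      simp only [chartField_apply g hys, (chartAt 𝔼 c).right_inv hy, map_smul, smul_eq_mul]
      field_simp
    · refine (((aemeasurable_comp_chart g (c := c) hη.continuous.measurable.aemeasurable).div
        hsq).mul (h.isMeasurableField.aemeasurable_inner_frame w)).congr ?_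
      filter_upwards [ae_restrict_mem hm] with x hx
      simp [chartField_apply g hx]
    · intro x hx
      simp only [chartField, if_neg hx, map_zero]
  rw [hL, hR] at hw
  linarith

end LocalMeasure

/-! ### Approximation by test functions inside one chart -/

section LocalApproximation

variable {n : ℕ} {M : Type*} [TopologicalSpace M]
  [ChartedSpace (EuclideanSpace ℝ (Fin n)) M] [IsManifold (𝓡 n) ∞ M]

local notation "𝔼" => EuclideanSpace ℝ (Fin n)

variable {c x : M}

theorem mvfderiv_frame_pull [T2Space M] {η : 𝔼 → ℝ} (hη : ContDiff ℝ ∞ η)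
    (hηc : HasCompactSupport η) (hηt : tsupport η ⊆ (chartAt 𝔼 c).target)
    (hx : x ∈ (chartAt 𝔼 c).source) (w : 𝔼) :
    mvfderiv (𝓡 n) (pull c η) x (frame c x w) = fderiv ℝ η (chartAt 𝔼 c x) w := by
  rw [mvfderiv_frame ((isTestFunction_pull hη hηc hηt).mdifferentiableAt x) hx]
  congr 1
  refine Filter.EventuallyEq.fderiv_eq ?_
  filter_upwards [(chartAt 𝔼 c).open_target.mem_nhds (chart_mem_target hx)] with y hy
  simp [pull_apply ((chartAt 𝔼 c).map_target hy), (chartAt 𝔼 c).right_inv hy]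

theorem fderiv_push {χ : M → ℝ} (hχ : IsTestFunction n χ) {y : 𝔼}
    (hy : y ∈ (chartAt 𝔼 c).target) (w : 𝔼) :
    fderiv ℝ (push c χ) y w = mvfderiv (𝓡 n) χ ((chartAt 𝔼 c).symm y)
      (frame c ((chartAt 𝔼 c).symm y) w) := by
  rw [mvfderiv_frame (hχ.mdifferentiableAt _) ((chartAt 𝔼 c).map_target hy),
    (chartAt 𝔼 c).right_inv hy]
  congr 1
  refine Filter.EventuallyEq.fderiv_eq ?_
  filter_upwards [(chartAt 𝔼 c).open_target.mem_nhds hy] with z hz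
  exact push_apply hz χ

variable [MeasurableSpace M] [BorelSpace M]

theorem memLp_push (g : Metric n M) {K : Set M} (hK : IsCompact K)
    (hKs : K ⊆ (chartAt 𝔼 c).source) {A : M → ℝ}
    (hA : AEMeasurable A ((riemannianVolume g).restrict (chartAt 𝔼 c).source))
    (hAK : ∀ x ∉ K, A x = 0) (hAi : ∫⁻ x, ‖A x‖ₑ ^ 2 ∂(riemannianVolume g) < ⊤) :
    MemLp (push c A : 𝔼 → ℝ) 2 volume := by
  have htm := (chartAt 𝔼 c).open_target.measurableSet
  have hm : AEMeasurable (push c A : 𝔼 → ℝ) volume :=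
    (aemeasurable_indicator_iff htm).2 (aemeasurable_comp_symm g hA)
  refine memLp_two_of_lintegral_enorm_sq hm.aestronglyMeasurable ?_
  obtain ⟨C, hC, h⟩ := exists_lintegral_compare g hK hKs
  have h1 := (h (fun x => ‖A x‖ₑ ^ 2) (hA.enorm.pow_const 2)
    (fun x hx => by simp [hAK x hx])).1
  refine lt_of_le_of_lt (le_of_eq ?_) (h1.trans_lt (ENNReal.mul_lt_top hC.lt_top hAi))
  rw [← lintegral_indicator htm]
  refine lintegral_congr fun y => ?_
  by_cases hy : y ∈ (chartAt 𝔼 c).target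
  · rw [indicator_of_mem hy, push_apply hy]
  · rw [indicator_of_notMem hy]
    simp [push, indicator_of_notMem hy]

theorem memLp_mul_of_hasCompactSupport {F η : 𝔼 → ℝ} (hF : MemLp F 2 volume) (hη : Continuous η)
    (hηc : HasCompactSupport η) : MemLp (fun y => F y * η y) 2 volume :=
  (hη.memLp_top_of_hasCompactSupport hηc volume).mul (p := 2) (q := ⊤) (r := 2) hF

theorem integrable_mul_of_hasCompactSupport {F η : 𝔼 → ℝ} (hF : MemLp F 2 volume)
    (hη : Continuous η) (hηc : HasCompactSupport η) : Integrable (fun y => F y * η y) volume :=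
  hF.integrable_mul (q := 2) (hη.memLp_of_hasCompactSupport hηc)

variable [T2Space M]

theorem IsLocalGradient.memLp_push {g : Metric n M} {f : M → ℝ} {X : VectorField n M}
    (h : IsLocalGradient g f X) {K : Set M} (hK : IsCompact K)
    (hs : K ⊆ (chartAt 𝔼 c).source) : MemLp (push c (K.indicator f) : 𝔼 → ℝ) 2 volume := by
  have hKm : MeasurableSet K := hK.measurableSet
  refine WeightedManifold.memLp_push g hK hs (h.aemeasurable.indicator hKm).restrict
    (fun x hx => indicator_of_notMem hx _) ?_
  refine lt_of_le_of_lt (le_of_eq ?_) (h.lintegral_sq_lt_top K hK)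
  rw [← lintegral_indicator hKm]
  refine lintegral_congr fun x => ?_
  by_cases hx : x ∈ K <;> simp [hx]

theorem IsLocalGradient.memLp_push_inner {g : Metric n M} {f : M → ℝ} {X : VectorField n M}
    (h : IsLocalGradient g f X) {K : Set M} (hK : IsCompact K)
    (hs : K ⊆ (chartAt 𝔼 c).source) (w : 𝔼) :
    MemLp (push c (K.indicator fun x => g.inner x (X x) (frame c x w)) : 𝔼 → ℝ) 2 volume := by
  have hKm : MeasurableSet K := hK.measurableSet
  refine WeightedManifold.memLp_push g hK hs
    ((h.isMeasurableField.aemeasurable_inner_frame w).indicator hKm)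
    (fun x hx => indicator_of_notMem hx _) ?_
  have hcont : ContinuousOn (fun x => g.inner x (frame c x w) (frame c x w)) K := fun x hx =>
    (contMDiffAt_inner g (contMDiffAt_frame contMDiffAt_const (hs hx))
      (contMDiffAt_frame contMDiffAt_const (hs hx))).continuousAt.continuousWithinAt
  obtain ⟨C, hC⟩ := hK.exists_bound_of_continuousOn hcont
  have h2 := ENNReal.mul_lt_top (ENNReal.ofReal_lt_top (r := C)) (h.lintegral_inner_lt_top K hK)
  refine lt_of_le_of_lt ?_ h2
  rw [← lintegral_const_mul' _ _ ENNReal.ofReal_ne_top, ← lintegral_indicator hKm]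
  refine lintegral_mono fun x => ?_
  by_cases hx : x ∈ K
  · simp only [indicator_of_mem hx]
    have h0 := inner_self_nonneg g (X x)
    rw [← ofReal_norm, ← ENNReal.ofReal_pow (norm_nonneg _), ← ENNReal.ofReal_mul' h0]
    refine ENNReal.ofReal_le_ofReal ?_
    rw [Real.norm_eq_abs, sq_abs, mul_comm]
    refine (inner_sq_le g _ _).trans (mul_le_mul_of_nonneg_left ?_ h0)
    exact (le_abs_self _).trans (hC x hx)
  · simp [hx]

/-- Localisation by the Leibniz rule: testing with `χ' ψ`, which is supported in the chart, yields
weak derivatives of the push-forward of `χ f` on all of Euclidean space against arbitrary `ψ`. The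
cutoff makes local square integrability of `f` and `X` sufficient. -/
theorem push_weak {g : Metric n M} {f : M → ℝ} {X : VectorField n M}
    (h : IsLocalGradient g f X) {χ : M → ℝ} (hχ : IsTestFunction n χ)
    (hs : tsupport χ ⊆ (chartAt 𝔼 c).source) (w : 𝔼) :
    MemLp (push c fun x => χ x * f x) 2 (volume : Measure 𝔼) ∧
    MemLp (push c fun x => g.inner x (χ x • X x + f x • gradient g χ x) (frame c x w)) 2
      (volume : Measure 𝔼) ∧
    ∀ ψ : 𝔼 → ℝ, ContDiff ℝ ∞ ψ → HasCompactSupport ψ →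
      ∫ y, push c (fun x => χ x * f x) y * fderiv ℝ ψ y w =
        -∫ y, push c (fun x => g.inner x (χ x • X x + f x • gradient g χ x) (frame c x w)) y *
          ψ y := by
  have hm := (chartAt 𝔼 c).open_source.measurableSet
  have htm := (chartAt 𝔼 c).open_target.measurableSet
  set K := tsupport χ with hKdef
  have hK : IsCompact K := hχ.2
  have hKm : MeasurableSet K := (isClosed_tsupport χ).measurableSet
  have hχK : ∀ x ∉ K, χ x = 0 := fun x hx => image_eq_zero_of_notMem_tsupport hx
  have hG := h.memLp_push hK hs
  have hH := h.memLp_push_inner hK hs w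
  set χ' : 𝔼 → ℝ := push c χ with hχ'
  have hχ's : ContDiff ℝ ∞ χ' := contDiff_push hχ hs
  have hχ'c : HasCompactSupport χ' := hasCompactSupport_push hχ hs
  have hχ't : tsupport χ' ⊆ chartAt 𝔼 c '' K := tsupport_push_subset hχ hs
  have hdχ : Continuous fun y => fderiv ℝ χ' y w :=
    (hχ's.continuous_fderiv (by simp)).clm_apply continuous_const
  have hdχc : HasCompactSupport fun y => fderiv ℝ χ' y w := hχ'c.fderiv_apply ℝ w
  have hF : push c (fun x => χ x * f x) = fun y => push c (K.indicator f) y * χ' y := by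
    ext y
    by_cases hy : y ∈ (chartAt 𝔼 c).target
    · simp only [hχ', push_apply hy]
      by_cases hx : (chartAt 𝔼 c).symm y ∈ K
      · rw [indicator_of_mem hx, mul_comm]
      · simp [hχK _ hx]
    · simp [push, indicator_of_notMem hy]
  have hD : push c (fun x => g.inner x (χ x • X x + f x • gradient g χ x) (frame c x w)) =
      fun y => push c (K.indicator fun x => g.inner x (X x) (frame c x w)) y * χ' y +
        push c (K.indicator f) y * fderiv ℝ χ' y w := by
    ext y
    by_cases hy : y ∈ (chartAt 𝔼 c).target
    · rw [hχ', fderiv_push hχ hy, ← inner_gradient g]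
      simp only [push_apply hy]
      by_cases hx : (chartAt 𝔼 c).symm y ∈ K
      · simp [indicator_of_mem hx, mul_comm]
      · simp [hχK _ hx, indicator_of_notMem hx, gradient_of_notMem_tsupport g hx]
    · simp [push, indicator_of_notMem hy]
  refine ⟨?_, ?_, fun ψ hψ hψc => ?_⟩
  · rw [hF]
    exact memLp_mul_of_hasCompactSupport hG hχ's.continuous hχ'c
  · rw [hD]
    exact (memLp_mul_of_hasCompactSupport hH hχ's.continuous hχ'c).add
      (memLp_mul_of_hasCompactSupport hG hdχ hdχc)
  · have hη : ContDiff ℝ ∞ fun y => χ' y * ψ y := hχ's.mul hψ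
    have hηc : HasCompactSupport fun y => χ' y * ψ y := hχ'c.mul_right
    have hηt' : tsupport (fun y => χ' y * ψ y) ⊆ tsupport χ' := tsupport_mul_subset_left
    have hηt := (hηt'.trans hχ't).trans (chart_image_subset_target hs)
    have hdη : Continuous fun y => fderiv ℝ (fun y => χ' y * ψ y) y w :=
      (hη.continuous_fderiv (by simp)).clm_apply continuous_const
    have hdηc : HasCompactSupport fun y => fderiv ℝ (fun y => χ' y * ψ y) y w :=
      hηc.fderiv_apply ℝ w
    have hw := integral_chart_weak h hη hηc hηt w
    have hsupp : ∀ y ∈ (chartAt 𝔼 c).target, (chartAt 𝔼 c).symm y ∉ K →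
        y ∉ tsupport fun y => χ' y * ψ y := by
      intro y hy hx hmem
      obtain ⟨z, hz, rfl⟩ := hχ't (hηt' hmem)
      exact hx (by rwa [(chartAt 𝔼 c).left_inv (hs hz)])
    have e1 : ∫ y in (chartAt 𝔼 c).target, f ((chartAt 𝔼 c).symm y) *
        fderiv ℝ (fun y => χ' y * ψ y) y w =
        ∫ y, push c (K.indicator f) y * fderiv ℝ (fun y => χ' y * ψ y) y w := by
      rw [← integral_indicator htm]
      refine integral_congr_ae (Eventually.of_forall fun y => ?_)
      by_cases hy : y ∈ (chartAt 𝔼 c).target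
      · simp only [indicator_of_mem hy, push_apply hy]
        by_cases hx : (chartAt 𝔼 c).symm y ∈ K
        · rw [indicator_of_mem hx]
        · rw [fderiv_of_notMem_tsupport (𝕜 := ℝ) (hsupp y hy hx)]; simp
      · simp [push, indicator_of_notMem hy]
    have e2 : ∫ y in (chartAt 𝔼 c).target, g.inner ((chartAt 𝔼 c).symm y)
        (X ((chartAt 𝔼 c).symm y)) (frame c ((chartAt 𝔼 c).symm y) w) * (χ' y * ψ y) =
        ∫ y, push c (K.indicator fun x => g.inner x (X x) (frame c x w)) y * (χ' y * ψ y) := by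
      rw [← integral_indicator htm]
      refine integral_congr_ae (Eventually.of_forall fun y => ?_)
      by_cases hy : y ∈ (chartAt 𝔼 c).target
      · simp only [indicator_of_mem hy, push_apply hy]
        by_cases hx : (chartAt 𝔼 c).symm y ∈ K
        · rw [indicator_of_mem hx]
        · have : χ' y * ψ y = 0 :=
            image_eq_zero_of_notMem_tsupport (f := fun y => χ' y * ψ y) (hsupp y hy hx)
          simp [this]
      · simp [push, indicator_of_notMem hy]
    rw [e1, e2] at hw
    have hprod : ∀ y, fderiv ℝ (fun y => χ' y * ψ y) y w =
        χ' y * fderiv ℝ ψ y w + ψ y * fderiv ℝ χ' y w := by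
      intro y
      rw [fderiv_fun_mul (hχ's.differentiable (by simp) y) (hψ.differentiable (by simp) y)]
      simp
    have i1 := integrable_mul_of_hasCompactSupport hG hdη hdηc
    have hψχ : Continuous fun y => fderiv ℝ χ' y w * ψ y := hdχ.mul hψ.continuous
    have hψχc : HasCompactSupport fun y => fderiv ℝ χ' y w * ψ y := hdχc.mul_right
    have i2 := integrable_mul_of_hasCompactSupport hG hψχ hψχc
    have i3 := integrable_mul_of_hasCompactSupport hH hη.continuous hηc
    calc ∫ y, push c (fun x => χ x * f x) y * fderiv ℝ ψ y w
        = ∫ y, (push c (K.indicator f) y * fderiv ℝ (fun y => χ' y * ψ y) y w -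
            push c (K.indicator f) y * (fderiv ℝ χ' y w * ψ y)) := by
          refine integral_congr_ae (Eventually.of_forall fun y => ?_)
          simp only [hF, hprod]
          ring
      _ = -∫ y, (push c (K.indicator fun x => g.inner x (X x) (frame c x w)) y * (χ' y * ψ y) +
            push c (K.indicator f) y * (fderiv ℝ χ' y w * ψ y)) := by
          rw [integral_sub i1 i2, integral_add i3 i2, hw]
          ring
      _ = _ := by
          congr 1
          refine integral_congr_ae (Eventually.of_forall fun y => ?_)
          simp only [hD]
          ring

theorem exists_approx_chart {g : Metric n M} {f : M → ℝ} {X : VectorField n M}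
    (h : IsLocalGradient g f X) {χ : M → ℝ} (hχ : IsTestFunction n χ)
    (hs : tsupport χ ⊆ (chartAt 𝔼 c).source) {ε : ℝ≥0∞} (hε : 0 < ε) :
    ∃ u, IsTestFunction n u ∧ ∫⁻ x, ‖u x - χ x * f x‖ₑ ^ 2 ∂(riemannianVolume g) ≤ ε ∧
      ∫⁻ x, ENNReal.ofReal (g.inner x (gradient g u x - (χ x • X x + f x • gradient g χ x))
        (gradient g u x - (χ x • X x + f x • gradient g χ x))) ∂(riemannianVolume g) ≤ ε := by
  have htm := (chartAt 𝔼 c).open_target.measurableSet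
  have hKt := chart_image_subset_target hs
  -- Mollification enlarges the support; the compact set `L` leaves room for this, and all
  -- comparison constants are taken on it.
  obtain ⟨L, hL, hKL, hLt⟩ := exists_compact_between (isCompact_chart_image (n := n) hχ.2 hs)
    (chartAt 𝔼 c).open_target hKt
  have hLc := isCompact_pullSet hL hLt
  have hLs := pullSet_subset_source hLt
  have hKLs : tsupport χ ⊆ pullSet c L := fun x hx =>
    mem_pullSet (hs hx) (interior_subset (hKL ⟨x, hx, rfl⟩))
  obtain ⟨C, hC, hcmp⟩ := exists_lintegral_compare g hLc hLs
  obtain ⟨C₁, hC₁, hN⟩ := exists_inner_self_le g hLc hLs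
  set Y : VectorField n M := fun x => χ x • X x + f x • gradient g χ x with hY
  -- `B` dominates both losses: `C` for the function, and `C * C₁ * n` for the gradient, whose error
  -- is summed over `n` coordinate directions.
  set B : ℝ≥0∞ := C * (ENNReal.ofReal C₁ * n) + C + 1 with hB
  have hBtop : B ≠ ⊤ := by
    simp only [hB, ne_eq, ENNReal.add_eq_top, not_or]
    exact ⟨⟨ENNReal.mul_ne_top hC (ENNReal.mul_ne_top ENNReal.ofReal_ne_top (by simp)), hC⟩,
      by simp⟩
  have hBε : B * (ε / B) ≤ ε := ENNReal.mul_div_le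
  obtain ⟨u, hu, huc, hut, hu1, hu2⟩ := exists_smooth_approx (E := 𝔼) (μ := volume)
    (isCompact_chart_image (n := n) hχ.2 hs) isOpen_interior hKL
    (push_weak h hχ hs 0).1
    (fun y hy => push_of_notMem (n := n)
      (fun x hx => by simp [image_eq_zero_of_notMem_tsupport hx]) hy)
    (fun i : Fin n => EuclideanSpace.single i (1 : ℝ))
    (fun i => (push_weak h hχ hs (EuclideanSpace.single i 1)).2.1)
    (fun i => (push_weak h hχ hs (EuclideanSpace.single i 1)).2.2)
    (δ := ε / B) (ENNReal.div_pos hε.ne' hBtop)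
  have huL : tsupport u ⊆ L := hut.trans interior_subset
  have hutt : tsupport u ⊆ (chartAt 𝔼 c).target := huL.trans hLt
  have hpull := isTestFunction_pull hu huc hutt
  have hmY : IsMeasurableField g Y :=
    (IsMeasurableField.smul hχ.1.continuous.measurable.aemeasurable
    h.isMeasurableField).add (IsMeasurableField.smul h.aemeasurable
      (isMeasurableField_of_contMDiff g (contMDiffAt_gradient g hχ.1)))
  have hmD : IsMeasurableField g fun x => gradient g (pull c u) x - Y x :=
    (isMeasurableField_of_contMDiff g (contMDiffAt_gradient g hpull.1)).sub hmY
  have hoffu : ∀ x ∉ pullSet c L, x ∉ tsupport (pull c u) := fun x hx h' =>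
    hx (image_mono huL (tsupport_pull_subset huc hutt h'))
  refine ⟨pull c u, hpull, ?_, ?_⟩
  · refine ((hcmp (fun x => ‖pull c u x - χ x * f x‖ₑ ^ 2) ?_ ?_).2).trans ?_
    · exact ((hpull.1.continuous.measurable.aemeasurable.sub
        (hχ.1.continuous.measurable.aemeasurable.mul h.aemeasurable)).enorm.pow_const 2).restrict
    · intro x hx
      rw [image_eq_zero_of_notMem_tsupport (hoffu x hx),
        image_eq_zero_of_notMem_tsupport fun h' => hx (hKLs h')]
      simp
    · refine le_trans ?_ hBε
      refine mul_le_mul' (le_add_right le_add_self) (le_trans ?_ hu1)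
      rw [← lintegral_indicator htm]
      refine lintegral_mono fun y => ?_
      by_cases hy : y ∈ (chartAt 𝔼 c).target
      · rw [indicator_of_mem hy, push_apply hy, pull_apply ((chartAt 𝔼 c).map_target hy),
          (chartAt 𝔼 c).right_inv hy]
      · rw [indicator_of_notMem hy]; exact zero_le
  · refine ((hcmp (fun x => ENNReal.ofReal (g.inner x (gradient g (pull c u) x - Y x)
      (gradient g (pull c u) x - Y x))) ?_ ?_).2).trans ?_
    · exact (aemeasurable_inner g (hmD c) (hmD c)).ennreal_ofReal
    · intro x hx
      rw [gradient_of_notMem_tsupport g (hoffu x hx), hY]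
      simp only
      rw [image_eq_zero_of_notMem_tsupport fun h' => hx (hKLs h'),
        gradient_of_notMem_tsupport g fun h' => hx (hKLs h')]
      simp
    · refine le_trans ?_ hBε
      have key : ∀ y, (chartAt 𝔼 c).target.indicator (fun y =>
          ENNReal.ofReal (g.inner ((chartAt 𝔼 c).symm y)
          (gradient g (pull c u) ((chartAt 𝔼 c).symm y) - Y ((chartAt 𝔼 c).symm y))
          (gradient g (pull c u) ((chartAt 𝔼 c).symm y) - Y ((chartAt 𝔼 c).symm y)))) y ≤
          ENNReal.ofReal C₁ * ∑ i, ‖fderiv ℝ u y (EuclideanSpace.single i 1) -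
            push c (fun x => g.inner x (Y x) (frame c x (EuclideanSpace.single i 1))) y‖ₑ ^ 2 := by
        intro y
        by_cases hy : y ∈ (chartAt 𝔼 c).target
        · rw [indicator_of_mem hy]
          set x := (chartAt 𝔼 c).symm y with hx
          have hxs : x ∈ (chartAt 𝔼 c).source := (chartAt 𝔼 c).map_target hy
          by_cases hxL : x ∈ pullSet c L
          · refine (ENNReal.ofReal_le_ofReal (hN x hxL _)).trans ?_
            rw [ENNReal.ofReal_mul hC₁, ENNReal.ofReal_sum_of_nonneg fun _ _ => sq_nonneg _]
            gcongr with i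
            rw [← ofReal_norm, ← ENNReal.ofReal_pow (norm_nonneg _), Real.norm_eq_abs, sq_abs]
            refine ENNReal.ofReal_le_ofReal (le_of_eq ?_)
            rw [map_sub, sub_apply, inner_gradient, coordVector_eq_frame,
              mvfderiv_frame_pull hu huc hutt hxs, push_apply hy, hx,
              (chartAt 𝔼 c).right_inv hy]
          · rw [gradient_of_notMem_tsupport g (hoffu x hxL), hY]
            simp only
            rw [image_eq_zero_of_notMem_tsupport fun h' => hxL (hKLs h'),
              gradient_of_notMem_tsupport g fun h' => hxL (hKLs h')]
            simp
        · rw [indicator_of_notMem hy]; exact zero_le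
      rw [← lintegral_indicator htm]
      refine (mul_le_mul_right (lintegral_mono key) C).trans ?_
      have hmeas : ∀ i : Fin n, AEMeasurable (fun y => ‖fderiv ℝ u y (EuclideanSpace.single i 1) -
            push c (fun x => g.inner x (Y x) (frame c x (EuclideanSpace.single i 1))) y‖ₑ ^ 2)
            (volume : Measure 𝔼) := by
        intro i
        refine AEMeasurable.pow_const (AEMeasurable.enorm (AEMeasurable.sub ?_ ?_)) 2
        · exact ((hu.continuous_fderiv (by simp)).clm_apply
            continuous_const).measurable.aemeasurable
        · exact (push_weak h hχ hs
            (EuclideanSpace.single i 1)).2.1.aestronglyMeasurable.aemeasurable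
      rw [lintegral_const_mul' _ _ ENNReal.ofReal_ne_top, lintegral_finsetSum' _ fun i _ => hmeas i]
      calc _ ≤ C * (ENNReal.ofReal C₁ * ∑ _i : Fin n, ε / B) := by
            gcongr with i
            exact hu2 i
        _ = C * (ENNReal.ofReal C₁ * n) * (ε / B) := by simp [mul_assoc]
        _ ≤ _ := by
          gcongr
          rw [hB, add_assoc]
          exact le_self_add

end LocalApproximation

/-! ### Global assembly of the approximations -/

section Approximation

variable {n : ℕ} {M : Type*} [TopologicalSpace M]
  [ChartedSpace (EuclideanSpace ℝ (Fin n)) M] [IsManifold (𝓡 n) ∞ M]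

local notation "𝔼" => EuclideanSpace ℝ (Fin n)

variable {c x : M}

theorem ext_inner (g : Metric n M) {X Y : TangentSpace (𝓡 n) x}
    (h : ∀ Z, g.inner x X Z = g.inner x Y Z) : X = Y :=
  eq_of_inner_frame_eq g (mem_chart_source 𝔼 x) fun _ => h _

theorem gradient_add (g : Metric n M) {u w : M → ℝ} (hu : MDifferentiableAt (𝓡 n) 𝓘(ℝ) u x)
    (hw : MDifferentiableAt (𝓡 n) 𝓘(ℝ) w x) :
    gradient g (fun x => u x + w x) x = gradient g u x + gradient g w x :=
  ext_inner g fun Z => by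
    rw [inner_gradient, mvfderiv_fun_add hu hw, map_add, add_apply, add_apply, inner_gradient,
      inner_gradient]

theorem gradient_const (g : Metric n M) (a : ℝ) : gradient g (fun _ => a) x = 0 :=
  ext_inner g fun Z => by
    rw [inner_gradient, mvfderiv_const]
    simp

theorem gradient_congr (g : Metric n M) {u w : M → ℝ} (h : u =ᶠ[𝓝 x] w) :
    gradient g u x = gradient g w x :=
  ext_inner g fun Z => by
    rw [inner_gradient, inner_gradient]
    simp only [mvfderiv, h.mfderiv_eq]
    rfl

theorem mvfderiv_real_comp {θ : ℝ → ℝ} {θ' : ℝ} {u : M → ℝ} (hθ : HasDerivAt θ θ' (u x))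
    (hu : MDifferentiableAt (𝓡 n) 𝓘(ℝ) u x) (X : TangentSpace (𝓡 n) x) :
    mvfderiv (𝓡 n) (fun y => θ (u y)) x X = θ' * mvfderiv (𝓡 n) u x X := by
  have h := mvfderiv_comp_apply (g := θ) (f := u) x
    (mdifferentiableAt_iff_differentiableAt.2 hθ.differentiableAt) hu X
  refine h.trans ?_
  rw [mul_comm]
  simp only [mvfderiv, mfderiv_eq_fderiv]
  have := hθ.hasFDerivAt.fderiv
  rw [this]
  rfl

theorem IsTestFunction.add {u w : M → ℝ} (hu : IsTestFunction n u) (hw : IsTestFunction n w) :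
    IsTestFunction n fun x => u x + w x :=
  ⟨hu.1.add hw.1, hu.2.add hw.2⟩

theorem isTestFunction_zero : IsTestFunction n fun _ : M => (0 : ℝ) :=
  ⟨contMDiff_const, HasCompactSupport.zero⟩

theorem IsTestFunction.mul_left {a u : M → ℝ} (ha : ContMDiff (𝓡 n) 𝓘(ℝ) ∞ a)
    (hu : IsTestFunction n u) : IsTestFunction n fun x => a x * u x :=
  ⟨ha.mul hu.1, hu.2.mul_left⟩

variable [MeasurableSpace M] [BorelSpace M] [T2Space M]

theorem enorm_sq_eq_ofReal (r : ℝ) : ‖r‖ₑ ^ 2 = ENNReal.ofReal (r ^ 2) := by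
  rw [← ofReal_norm, ← ENNReal.ofReal_pow (norm_nonneg _), Real.norm_eq_abs, sq_abs]

theorem lintegral_ofReal_le_add {α : Type*} [MeasurableSpace α] {m : Measure α} {A B₁ B₂ : α → ℝ}
    (h : ∀ x, A x ≤ 2 * B₁ x + 2 * B₂ x) (hB₁ : AEMeasurable B₁ m) :
    ∫⁻ x, ENNReal.ofReal (A x) ∂m ≤
      2 * ∫⁻ x, ENNReal.ofReal (B₁ x) ∂m + 2 * ∫⁻ x, ENNReal.ofReal (B₂ x) ∂m := by
  rw [← lintegral_const_mul' _ _ (by simp), ← lintegral_const_mul' _ _ (by simp),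
    ← lintegral_add_left' (hB₁.ennreal_ofReal.const_mul 2)]
  refine lintegral_mono fun x => ?_
  refine (ENNReal.ofReal_le_ofReal (h x)).trans (ENNReal.ofReal_add_le.trans ?_)
  rw [ENNReal.ofReal_mul zero_le_two, ENNReal.ofReal_mul zero_le_two]
  simp

theorem four_mul_div_four (ε : ℝ≥0∞) : 2 * (ε / 4) + 2 * (ε / 4) = ε := by
  rw [← add_mul, show (2 + 2 : ℝ≥0∞) = 4 by norm_num]
  exact ENNReal.mul_div_cancel (by simp) (by simp)

/-- `χ` is a test function and `χ f`, `∇(χ f) = χ X + f ∇χ` are limits in `L²` of test functions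
and of their gradients. -/
def IsApproximable (g : Metric n M) (f : M → ℝ) (X : VectorField n M) (χ : M → ℝ) : Prop :=
  IsTestFunction n χ ∧ ∀ ε : ℝ≥0∞, 0 < ε → ∃ u, IsTestFunction n u ∧
    ∫⁻ x, ‖u x - χ x * f x‖ₑ ^ 2 ∂(riemannianVolume g) ≤ ε ∧
    ∫⁻ x, ENNReal.ofReal (g.inner x (gradient g u x - (χ x • X x + f x • gradient g χ x))
      (gradient g u x - (χ x • X x + f x • gradient g χ x))) ∂(riemannianVolume g) ≤ ε

theorem IsLocalGradient.isMeasurableField_sub {g : Metric n M} {f : M → ℝ} {X : VectorField n M}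
    (h : IsLocalGradient g f X) {χ u : M → ℝ} (hχ : IsTestFunction n χ) (hu : IsTestFunction n u) :
    IsMeasurableField g fun x => gradient g u x - (χ x • X x + f x • gradient g χ x) :=
  (isMeasurableField_of_contMDiff g (contMDiffAt_gradient g hu.1)).sub
    ((IsMeasurableField.smul hχ.1.continuous.measurable.aemeasurable
    h.isMeasurableField).add (IsMeasurableField.smul h.aemeasurable
      (isMeasurableField_of_contMDiff g (contMDiffAt_gradient g hχ.1))))

variable [SecondCountableTopology M]

theorem IsApproximable.add {g : Metric n M} {f : M → ℝ} {X : VectorField n M}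
    (h : IsLocalGradient g f X) {χ₁ χ₂ : M → ℝ} (h₁ : IsApproximable g f X χ₁)
    (h₂ : IsApproximable g f X χ₂) : IsApproximable g f X fun x => χ₁ x + χ₂ x := by
  refine ⟨h₁.1.add h₂.1, fun ε hε => ?_⟩
  -- The quarter pays for the factor `2` on each of the two squared errors.
  obtain ⟨u₁, hu₁, ha₁, hb₁⟩ := h₁.2 (ε / 4) (ENNReal.div_pos hε.ne' (by simp))
  obtain ⟨u₂, hu₂, ha₂, hb₂⟩ := h₂.2 (ε / 4) (ENNReal.div_pos hε.ne' (by simp))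
  refine ⟨_, hu₁.add hu₂, ?_, ?_⟩
  · simp only [enorm_sq_eq_ofReal] at ha₁ ha₂ ⊢
    refine (lintegral_ofReal_le_add (B₁ := fun x => (u₁ x - χ₁ x * f x) ^ 2)
      (B₂ := fun x => (u₂ x - χ₂ x * f x) ^ 2) (fun x => ?_) ?_).trans ?_
    · nlinarith [sq_nonneg ((u₁ x - χ₁ x * f x) - (u₂ x - χ₂ x * f x))]
    · exact (hu₁.1.continuous.measurable.aemeasurable.sub
        (h₁.1.1.continuous.measurable.aemeasurable.mul h.aemeasurable)).pow_const 2
    · exact (by gcongr : _ ≤ 2 * (ε / 4) + 2 * (ε / 4)).trans (four_mul_div_four ε).le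
  · refine (lintegral_ofReal_le_add (fun x => ?_)
      ((h.isMeasurableField_sub h₁.1 hu₁).aemeasurable_inner
        (h.isMeasurableField_sub h₁.1 hu₁))
      (B₂ := fun x => g.inner x (gradient g u₂ x - (χ₂ x • X x + f x • gradient g χ₂ x))
        (gradient g u₂ x - (χ₂ x • X x + f x • gradient g χ₂ x)))).trans ?_
    · refine le_trans (le_of_eq ?_) (inner_add_self_le g _ _)
      rw [gradient_add g (hu₁.mdifferentiableAt x) (hu₂.mdifferentiableAt x),
        gradient_add g (h₁.1.mdifferentiableAt x) (h₂.1.mdifferentiableAt x)]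
      have : ∀ A B C D E : TangentSpace (𝓡 n) x, ∀ a b r : ℝ,
          A + B - ((a + b) • C + r • (D + E)) =
            (A - (a • C + r • D)) + (B - (b • C + r • E)) := by
        intros; module
      rw [this]
    · exact (by gcongr : _ ≤ 2 * (ε / 4) + 2 * (ε / 4)).trans (four_mul_div_four ε).le

theorem IsApproximable.zero (g : Metric n M) (f : M → ℝ) (X : VectorField n M) :
    IsApproximable g f X fun _ => 0 := by
  refine ⟨isTestFunction_zero, fun ε hε => ⟨_, isTestFunction_zero, ?_, ?_⟩⟩ <;>
    simp [gradient_const]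

theorem IsApproximable.sum {g : Metric n M} {f : M → ℝ} {X : VectorField n M}
    (h : IsLocalGradient g f X) {ι : Type*} {χ : ι → M → ℝ} (s : Finset ι)
    (hχ : ∀ i ∈ s, IsApproximable g f X (χ i)) : IsApproximable g f X fun x => ∑ i ∈ s, χ i x := by
  classical
  induction s using Finset.induction_on with
  | empty => simpa using IsApproximable.zero g f X
  | insert i s hi ih =>
    simp only [Finset.sum_insert hi]
    exact (hχ i (by simp)).add h (ih fun j hj => hχ j (Finset.mem_insert_of_mem hj))

/-- A partition of unity subordinate to chart domains cuts `χ` into pieces treated in single charts;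
only finitely many of them meet its compact support. -/
theorem isApproximable {g : Metric n M} {f : M → ℝ} {X : VectorField n M}
    (h : IsLocalGradient g f X) {χ : M → ℝ} (hχ : IsTestFunction n χ) :
    IsApproximable g f X χ := by
  have : LocallyCompactSpace M := ChartedSpace.locallyCompactSpace 𝔼 M
  obtain ⟨ρ, hρ⟩ := SmoothPartitionOfUnity.exists_isSubordinate_chartAt_source (𝓡 n) M
  have hfin := ρ.locallyFinite.finite_nonempty_inter_compact hχ.2
  have hsum : χ = fun x => ∑ i ∈ hfin.toFinset, ρ i x * χ x := by
    ext x
    rw [← Finset.sum_mul]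
    by_cases hx : x ∈ tsupport χ
    · rw [← finsum_eq_sum_of_support_subset, ρ.sum_eq_one (mem_univ x), one_mul]
      intro i hi
      simp only [Finite.coe_toFinset, mem_ofPred_eq]
      exact ⟨x, hi, hx⟩
    · rw [image_eq_zero_of_notMem_tsupport hx, mul_zero]
  rw [hsum]
  refine IsApproximable.sum h _ fun i _ => ?_
  have hi : IsTestFunction n fun x => ρ i x * χ x := hχ.mul_left (ρ i).contMDiff
  exact ⟨hi, fun ε hε => exists_approx_chart h hi (tsupport_mul_subset_left.trans (hρ i)) hε⟩

/-- With a cutoff equal to `1` in a neighbourhood of `K`, the localised function is `f` on `K` and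
the extra term `f ∇χ` vanishes there. -/
theorem IsLocalGradient.exists_approx {g : Metric n M} {f : M → ℝ} {X : VectorField n M}
    (h : IsLocalGradient g f X) {K : Set M} (hK : IsCompact K) {ε : ℝ≥0∞} (hε : 0 < ε) :
    ∃ u, IsTestFunction n u ∧ ∫⁻ x in K, ‖u x - f x‖ₑ ^ 2 ∂(riemannianVolume g) ≤ ε ∧
      ∫⁻ x in K, ENNReal.ofReal (g.inner x (gradient g u x - X x) (gradient g u x - X x))
        ∂(riemannianVolume g) ≤ ε := by
  have : LocallyCompactSpace M := ChartedSpace.locallyCompactSpace 𝔼 M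
  obtain ⟨L, hL, hKL⟩ := exists_compact_superset hK
  obtain ⟨χ, hχ1, hχ0, -⟩ := exists_contMDiffMap_one_nhds_of_subset_interior (n := ⊤) (𝓡 n)
    hK.isClosed hKL
  have hχ : IsTestFunction n χ := ⟨χ.contMDiff, HasCompactSupport.intro hL hχ0⟩
  obtain ⟨u, hu, h1, h2⟩ := (isApproximable h hχ).2 ε hε
  have hev : ∀ x ∈ K, χ =ᶠ[𝓝 x] fun _ => (1 : ℝ) := fun x hx =>
    (Filter.eventually_iff_exists_mem.2 ⟨_, mem_nhdsSet_iff_forall.1 hχ1 x hx, fun _ h => h⟩)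
  refine ⟨u, hu, le_trans ?_ h1, le_trans ?_ h2⟩
  · refine le_trans (le_of_eq ?_) (setLIntegral_le_lintegral K _)
    refine setLIntegral_congr_fun hK.measurableSet fun x hx => ?_
    simp only [(hev x hx).self_of_nhds, one_mul]
  · refine le_trans (le_of_eq ?_) (setLIntegral_le_lintegral K _)
    refine setLIntegral_congr_fun hK.measurableSet fun x hx => ?_
    simp only [(hev x hx).self_of_nhds, one_smul, gradient_congr g (hev x hx), gradient_const,
      smul_zero, add_zero]

end Approximation

/-! ### Uniqueness of weak gradients -/

section Uniqueness

variable {n : ℕ} {M : Type*} [TopologicalSpace M]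
  [ChartedSpace (EuclideanSpace ℝ (Fin n)) M] [IsManifold (𝓡 n) ∞ M]

local notation "𝔼" => EuclideanSpace ℝ (Fin n)

variable {c x : M}

theorem push_mul_eq (A : M → ℝ) (η : 𝔼 → ℝ) (y : 𝔼) :
    push c A y * η y = push c ((pullSet c (tsupport η)).indicator A) y * η y := by
  by_cases hη : y ∈ tsupport η
  · by_cases hy : y ∈ (chartAt 𝔼 c).target
    · rw [push_apply hy, push_apply hy,
        indicator_of_mem (s := pullSet c (tsupport η)) (mem_image_of_mem _ hη)]
    · simp [push, indicator_of_notMem hy]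
  · simp [image_eq_zero_of_notMem_tsupport hη]

theorem setIntegral_target_mul [MeasurableSpace M] (A : M → ℝ) (η : 𝔼 → ℝ) :
    ∫ y in (chartAt 𝔼 c).target, A ((chartAt 𝔼 c).symm y) * η y = ∫ y, push c A y * η y := by
  rw [← integral_indicator (chartAt 𝔼 c).open_target.measurableSet]
  refine integral_congr_ae (Eventually.of_forall fun y => ?_)
  by_cases hy : y ∈ (chartAt 𝔼 c).target
  · simp [indicator_of_mem hy, push_apply hy]
  · simp [push, indicator_of_notMem hy]

theorem contDiffAt_push {φ : M → ℝ} (hφ : IsTestFunction n φ) {y : 𝔼}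
    (hy : y ∈ (chartAt 𝔼 c).target) : ContDiffAt ℝ ∞ (push c φ) y := by
  have h := contDiffAt_comp_symm (c := c) (hφ.1 ((chartAt 𝔼 c).symm y))
    ((chartAt 𝔼 c).map_target hy)
  rw [(chartAt 𝔼 c).right_inv hy] at h
  refine h.congr_of_eventuallyEq ?_
  filter_upwards [(chartAt 𝔼 c).open_target.mem_nhds hy] with z hz
  exact push_apply hz φ

theorem integrable_mul_of_continuousOn {F η : 𝔼 → ℝ} {U : Set 𝔼} (hU : IsOpen U)
    (hF : ContinuousOn F U) (hη : Continuous η) (hηc : HasCompactSupport η) (hηt : tsupport η ⊆ U) :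
    Integrable (fun y => F y * η y) := by
  refine Continuous.integrable_of_hasCompactSupport (continuous_of_tsupport fun y hy => ?_)
    hηc.mul_left
  exact ((hF.continuousAt (hU.mem_nhds (hηt (tsupport_mul_subset_right hy)))).mul hη.continuousAt)

variable [MeasurableSpace M] [BorelSpace M] [T2Space M]

theorem IsLocalGradient.integrable_push_mul {g : Metric n M} {f : M → ℝ} {X : VectorField n M}
    (h : IsLocalGradient g f X) {η : 𝔼 → ℝ} (hη : Continuous η) (hηc : HasCompactSupport η)
    (hηt : tsupport η ⊆ (chartAt 𝔼 c).target) : Integrable fun y => push c f y * η y := by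
  have := h.memLp_push (isCompact_pullSet hηc hηt) (pullSet_subset_source hηt)
  exact (integrable_mul_of_hasCompactSupport this hη hηc).congr
    (Eventually.of_forall fun y => (push_mul_eq _ _ y).symm)

theorem IsLocalGradient.integrable_push_inner_mul {g : Metric n M} {f : M → ℝ}
    {X : VectorField n M} (h : IsLocalGradient g f X) {η : 𝔼 → ℝ} (hη : Continuous η)
    (hηc : HasCompactSupport η) (hηt : tsupport η ⊆ (chartAt 𝔼 c).target) (w : 𝔼) :
    Integrable fun y => push c (fun x => g.inner x (X x) (frame c x w)) y * η y := by
  have := h.memLp_push_inner (isCompact_pullSet hηc hηt) (pullSet_subset_source hηt) w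
  exact (integrable_mul_of_hasCompactSupport this hη hηc).congr
    (Eventually.of_forall fun y => (push_mul_eq _ _ y).symm)

theorem IsLocalGradient.locallyIntegrableOn_push_inner {g : Metric n M} {f : M → ℝ}
    {X : VectorField n M} (h : IsLocalGradient g f X) (w : 𝔼) :
    LocallyIntegrableOn (push c fun x => g.inner x (X x) (frame c x w)) (chartAt 𝔼 c).target := by
  rw [locallyIntegrableOn_iff (chartAt 𝔼 c).open_target.isLocallyClosed]
  intro K hKt hK
  have := h.memLp_push_inner (isCompact_pullSet hK hKt) (pullSet_subset_source hKt) w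
  have hfin : IsFiniteMeasure ((volume : Measure 𝔼).restrict K) :=
    ⟨by simpa using hK.measure_lt_top⟩
  refine ((this.restrict K).integrable (by norm_num)).congr ?_
  filter_upwards [ae_restrict_mem hK.measurableSet] with y hy
  rw [push_apply (hKt hy), push_apply (hKt hy),
    indicator_of_mem (s := pullSet c K) (mem_image_of_mem _ hy)]

/-- The `W¹` norm of `f - φ` sees some weak gradient `Y` of the difference, while the estimates
concern the classical gradient of `φ`. The two are linked by the fundamental lemma of the calculus
of variations, applied in every chart and coordinate direction. -/
theorem gradient_ae_eq_of_sub [SecondCountableTopology M] {g : Metric n M}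
    {f φ : M → ℝ} {Y Z : VectorField n M} (hφ : IsTestFunction n φ) (hf : IsLocalGradient g f Z)
    (hfφ : IsLocalGradient g (fun x => f x - φ x) Y) :
    ∀ᵐ x ∂(riemannianVolume g), gradient g φ x = Z x - Y x := by
  refine ae_of_ae_source (n := n) fun c => ?_
  have hto := (chartAt 𝔼 c).open_target
  have key : ∀ w : 𝔼, ∀ᵐ y ∂(volume : Measure 𝔼), y ∈ (chartAt 𝔼 c).target →
      push c (fun x => g.inner x (Z x) (frame c x w)) y -
        push c (fun x => g.inner x (Y x) (frame c x w)) y - fderiv ℝ (push c φ) y w = 0 := by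
    intro w
    have hcd : ContinuousOn (fun y => fderiv ℝ (push c φ : 𝔼 → ℝ) y w) (chartAt 𝔼 c).target :=
      fun y hy => (((contDiffAt_push hφ hy).continuousAt_fderiv (by simp)).clm_apply
        continuousAt_const).continuousWithinAt
    have hcφ : ContinuousOn (push c φ : 𝔼 → ℝ) (chartAt 𝔼 c).target :=
      fun y hy => (contDiffAt_push hφ hy).continuousAt.continuousWithinAt
    refine hto.ae_eq_zero_of_integral_contDiff_smul_eq_zero
      (((hf.locallyIntegrableOn_push_inner w).sub (hfφ.locallyIntegrableOn_push_inner w)).sub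
        (hcd.locallyIntegrableOn hto.measurableSet)) fun η hη hηc hηt => ?_
    have hdη : Continuous fun y => fderiv ℝ η y w :=
      (hη.continuous_fderiv (by simp)).clm_apply continuous_const
    have hdηc : HasCompactSupport fun y => fderiv ℝ η y w := hηc.fderiv_apply ℝ w
    have hdηt : tsupport (fun y => fderiv ℝ η y w) ⊆ (chartAt 𝔼 c).target :=
      (tsupport_fderiv_apply_subset ℝ w).trans hηt
    have h1 := integral_chart_weak hf hη hηc hηt w
    have h2 := integral_chart_weak hfφ hη hηc hηt w
    rw [setIntegral_target_mul f fun y => fderiv ℝ η y w,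
      setIntegral_target_mul (fun x => g.inner x (Z x) (frame c x w))] at h1
    rw [setIntegral_target_mul (fun x => f x - φ x) fun y => fderiv ℝ η y w,
      setIntegral_target_mul (fun x => g.inner x (Y x) (frame c x w))] at h2
    have iZ := hf.integrable_push_inner_mul hη.continuous hηc hηt w
    have iY := hfφ.integrable_push_inner_mul hη.continuous hηc hηt w
    have if' := hf.integrable_push_mul hdη hdηc hdηt
    have iφ := integrable_mul_of_continuousOn hto hcφ hdη hdηc hdηt
    have idφ := integrable_mul_of_continuousOn hto hcd hη.continuous hηc hηt
    have h3 : ∫ y, push c φ y * fderiv ℝ η y w = -∫ y, fderiv ℝ (push c φ) y w * η y :=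
      integral_mul_fderiv_eq_neg_fderiv_mul_of_integrable idφ iφ
        (integrable_mul_of_continuousOn hto hcφ hη.continuous hηc hηt)
        (fun y hy => (contDiffAt_push hφ (hηt hy)).differentiableAt (by simp))
        (fun y _ => hη.differentiable (by simp) y)
    have h4 : ∫ y, push c (fun x => f x - φ x) y * fderiv ℝ η y w =
        (∫ y, push c f y * fderiv ℝ η y w) - ∫ y, push c φ y * fderiv ℝ η y w := by
      rw [← integral_sub if' iφ]
      refine integral_congr_ae (Eventually.of_forall fun y => ?_)
      by_cases hy : y ∈ (chartAt 𝔼 c).target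
      · simp only [push_apply hy]; ring
      · simp [push, indicator_of_notMem hy]
    calc _ = ∫ y, ((push c (fun x => g.inner x (Z x) (frame c x w)) y * η y -
          push c (fun x => g.inner x (Y x) (frame c x w)) y * η y) -
          fderiv ℝ (push c φ) y w * η y) := by
          refine integral_congr_ae (Eventually.of_forall fun y => ?_)
          simp only [smul_eq_mul]
          ring
      _ = 0 := by
          have e := integral_sub (iZ.sub iY) idφ
          simp only [Pi.sub_apply] at e
          rw [e, integral_sub iZ iY]
          linarith
  rw [ae_source_iff g, ae_restrict_iff' hto.measurableSet]
  have hall : ∀ᵐ y ∂(volume : Measure 𝔼), ∀ i : Fin n, y ∈ (chartAt 𝔼 c).target →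
      push c (fun x => g.inner x (Z x) (frame c x (EuclideanSpace.single i 1))) y -
        push c (fun x => g.inner x (Y x) (frame c x (EuclideanSpace.single i 1))) y -
        fderiv ℝ (push c φ) y (EuclideanSpace.single i 1) = 0 := ae_all_iff.2 fun i => key _
  filter_upwards [hall] with y hy hyt
  refine eq_of_inner_frame_eq g ((chartAt 𝔼 c).map_target hyt) fun i => ?_
  have := hy i hyt
  rw [push_apply hyt, push_apply hyt, fderiv_push hφ hyt] at this
  rw [map_sub, sub_apply, inner_gradient, coordVector_eq_frame]
  linarith

end Uniqueness

/-! ### Weighted measures and the Sobolev spaces -/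

section Weights

variable {n : ℕ} {M : Type*} [TopologicalSpace M]
  [ChartedSpace (EuclideanSpace ℝ (Fin n)) M] [IsManifold (𝓡 n) ∞ M]
  [MeasurableSpace M] [BorelSpace M]

theorem densityMeasure_eq (g : Metric n M) {Ψ κ : M → ℝ} (hΨ : Continuous Ψ)
    (hΨ_pos : ∀ x, 0 < Ψ x) (hκ : Continuous κ) :
    densityMeasure g Ψ κ = weightedVolume g fun x => Ψ x * κ x := by
  unfold densityMeasure weightedVolume
  rw [← withDensity_mul _ hΨ.measurable.ennreal_ofReal hκ.measurable.ennreal_ofReal]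
  congr 1
  ext x
  simp [ENNReal.ofReal_mul (hΨ_pos x).le]

theorem weightedVolume_absolutelyContinuous (g : Metric n M) (a : M → ℝ) :
    weightedVolume g a ≪ riemannianVolume g := withDensity_absolutelyContinuous _ _

theorem absolutelyContinuous_weightedVolume (g : Metric n M) {a : M → ℝ} (ha : Continuous a)
    (ha_pos : ∀ x, 0 < a x) : riemannianVolume g ≪ weightedVolume g a :=
  withDensity_absolutelyContinuous' ha.measurable.ennreal_ofReal.aemeasurable
    (Eventually.of_forall fun x => by simpa using ha_pos x)

theorem lintegral_weightedVolume (g : Metric n M) {a : M → ℝ} (ha : Continuous a) (A : M → ℝ≥0∞) :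
    ∫⁻ x, A x ∂(weightedVolume g a) = ∫⁻ x, ENNReal.ofReal (a x) * A x ∂(riemannianVolume g) :=
  lintegral_withDensity_eq_lintegral_mul_non_measurable _ ha.measurable.ennreal_ofReal
    (Eventually.of_forall fun _ => ENNReal.ofReal_lt_top) _

theorem integral_weightedVolume (g : Metric n M) {a : M → ℝ} (ha : Continuous a)
    (ha_pos : ∀ x, 0 < a x) (A : M → ℝ) :
    ∫ x, A x ∂(weightedVolume g a) = ∫ x, a x * A x ∂(riemannianVolume g) := by
  unfold weightedVolume
  rw [integral_withDensity_eq_integral_toReal_smul ha.measurable.ennreal_ofReal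
    (Eventually.of_forall fun _ => ENNReal.ofReal_lt_top)]
  simp [ENNReal.toReal_ofReal (ha_pos _).le]

theorem exists_setLIntegral_le_weightedVolume [T2Space M] (g : Metric n M) {a : M → ℝ}
    (ha : Continuous a) (ha_pos : ∀ x, 0 < a x) {K : Set M} (hK : IsCompact K) : ∃ C : ℝ≥0∞, C ≠ ⊤ ∧
      ∀ A : M → ℝ≥0∞,
        ∫⁻ x in K, A x ∂(riemannianVolume g) ≤ C * ∫⁻ x, A x ∂(weightedVolume g a) := by
  obtain ⟨C, hC⟩ := hK.exists_bound_of_continuousOn (f := fun x => (a x)⁻¹)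
    (ha.continuousOn.inv₀ fun x _ => (ha_pos x).ne')
  refine ⟨ENNReal.ofReal C, ENNReal.ofReal_ne_top, fun A => ?_⟩
  rw [lintegral_weightedVolume g ha, ← lintegral_const_mul' _ _ ENNReal.ofReal_ne_top]
  refine le_trans ?_ (setLIntegral_le_lintegral K _)
  refine setLIntegral_mono' hK.measurableSet fun x hx => ?_
  rw [← mul_assoc, ← ENNReal.ofReal_mul' (ha_pos x).le]
  refine le_mul_of_one_le_left zero_le ?_
  rw [ENNReal.one_le_ofReal]
  have h := hC x hx
  rw [Real.norm_of_nonneg (inv_nonneg.2 (ha_pos x).le)] at h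
  calc 1 = (a x)⁻¹ * a x := (inv_mul_cancel₀ (ha_pos x).ne').symm
    _ ≤ _ := mul_le_mul_of_nonneg_right h (ha_pos x).le

theorem exists_lintegral_weightedVolume_le [T2Space M] (g : Metric n M) {a : M → ℝ}
    (ha : Continuous a) {K : Set M} (hK : IsCompact K) : ∃ C : ℝ≥0∞, C ≠ ⊤ ∧
      ∀ A : M → ℝ≥0∞,
        ∫⁻ x in K, A x ∂(weightedVolume g a) ≤ C * ∫⁻ x in K, A x ∂(riemannianVolume g) := by
  obtain ⟨C, hC⟩ := hK.exists_bound_of_continuousOn ha.continuousOn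
  refine ⟨ENNReal.ofReal C, ENNReal.ofReal_ne_top, fun A => ?_⟩
  rw [← lintegral_indicator hK.measurableSet, lintegral_weightedVolume g ha,
    ← lintegral_const_mul' _ _ ENNReal.ofReal_ne_top, ← lintegral_indicator hK.measurableSet]
  refine lintegral_mono fun x => ?_
  by_cases hx : x ∈ K
  · simp only [indicator_of_mem hx]
    gcongr
    exact (le_abs_self _).trans (hC x hx)
  · simp [hx]

theorem IsL2Gradient.isLocalGradient [T2Space M] {g : Metric n M} {Ψ κ f : M → ℝ}
    {X : VectorField n M} (hΨ : Continuous Ψ) (hΨ_pos : ∀ x, 0 < Ψ x) (hκ : Continuous κ)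
    (hκ_pos : ∀ x, 0 < κ x) (h : IsL2Gradient g Ψ f X) (hf : AEMeasurable f (riemannianVolume g))
    (hfi : ∫⁻ x, ‖f x‖ₑ ^ 2 ∂(densityMeasure g Ψ κ) < ⊤) : IsLocalGradient g f X where
  aemeasurable := hf
  isMeasurableField := h.1.1
  lintegral_sq_lt_top K hK := by
    rw [densityMeasure_eq g hΨ hΨ_pos hκ] at hfi
    obtain ⟨C, hC, hle⟩ := exists_setLIntegral_le_weightedVolume g (hΨ.mul hκ)
      (fun x => mul_pos (hΨ_pos x) (hκ_pos x)) hK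
    exact (hle _).trans_lt (ENNReal.mul_lt_top hC.lt_top hfi)
  lintegral_inner_lt_top K hK := by
    obtain ⟨C, hC, hle⟩ := exists_setLIntegral_le_weightedVolume g hΨ hΨ_pos hK
    exact (hle _).trans_lt (ENNReal.mul_lt_top hC.lt_top h.1.2)
  weak := h.2

theorem riemannianVolume_absolutelyContinuous_densityMeasure (g : Metric n M) {Ψ κ : M → ℝ}
    (hΨ : Continuous Ψ) (hΨ_pos : ∀ x, 0 < Ψ x) (hκ : Continuous κ) (hκ_pos : ∀ x, 0 < κ x) :
    riemannianVolume g ≪ densityMeasure g Ψ κ := by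
  rw [densityMeasure_eq g hΨ hΨ_pos hκ]
  exact absolutelyContinuous_weightedVolume g (hΨ.mul hκ) fun x => mul_pos (hΨ_pos x) (hκ_pos x)

theorem MemW1.exists_isLocalGradient [T2Space M] {g : Metric n M} {Ψ κ f : M → ℝ}
    (hΨ : Continuous Ψ) (hΨ_pos : ∀ x, 0 < Ψ x) (hκ : Continuous κ) (hκ_pos : ∀ x, 0 < κ x)
    (h : MemW1 g Ψ κ f) : ∃ X, IsLocalGradient g f X ∧
      ∫⁻ x, ENNReal.ofReal (g.inner x (X x) (X x)) ∂(weightedVolume g Ψ) < ⊤ := by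
  obtain ⟨hf, X, hX⟩ := h
  exact ⟨X, hX.isLocalGradient hΨ hΨ_pos hκ hκ_pos (hf.1.aemeasurable.mono_ac
    (riemannianVolume_absolutelyContinuous_densityMeasure g hΨ hΨ_pos hκ hκ_pos))
    (lintegral_enorm_sq_lt_top hf), hX.1.2⟩

/-- Of the convergence of gradients only a bound uniform in `ε` is retained; this suffices for the
second limit. -/
theorem MemW10.exists_approx [T2Space M] [SecondCountableTopology M] {g : Metric n M}
    {Ψ κ h : M → ℝ} (hΨ : Continuous Ψ) (hΨ_pos : ∀ x, 0 < Ψ x) (hκ : Continuous κ)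
    (hκ_pos : ∀ x, 0 < κ x) (hh : MemW10 g Ψ κ h) : ∃ C : ℝ≥0∞, C ≠ ⊤ ∧ ∀ ε : ℝ≥0∞, 0 < ε →
      ∃ φ, IsTestFunction n φ ∧ ∫⁻ x, ‖φ x - h x‖ₑ ^ 2 ∂(densityMeasure g Ψ κ) ≤ ε ∧
        ∫⁻ x, ENNReal.ofReal (g.inner x (gradient g φ x) (gradient g φ x))
          ∂(weightedVolume g Ψ) ≤ C := by
  obtain ⟨Z, hZ, hZi⟩ := hh.1.exists_isLocalGradient hΨ hΨ_pos hκ hκ_pos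
  refine ⟨2 * (∫⁻ x, ENNReal.ofReal (g.inner x (Z x) (Z x)) ∂(weightedVolume g Ψ)) + 2 * 1,
    by finiteness, fun ε hε => ?_⟩
  -- The bound `ε` is for the functions. The bound `1` is for the gradient of `h - φ` and makes the
  -- constant independent of `ε`. The exponent matches the square root in the norm.
  obtain ⟨φ, hφ, hφn⟩ := hh.2 (min ε 1 ^ (1 / 2 : ℝ))
    (ENNReal.rpow_pos (lt_min hε one_pos) (by simp))
  unfold normW1 at hφn
  rw [ENNReal.rpow_lt_rpow_iff (by norm_num), iInf_lt_iff] at hφn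
  obtain ⟨Y, hφn⟩ := hφn
  obtain ⟨hY, hφn⟩ := iInf_lt_iff.1 hφn
  have h1 : ∫⁻ x, ‖φ x - h x‖ₑ ^ 2 ∂(densityMeasure g Ψ κ) ≤ min ε 1 := by
    refine le_trans (le_of_eq ?_) (le_add_self.trans hφn.le)
    refine lintegral_congr fun x => ?_
    rw [enorm_sq_eq_ofReal, ← neg_sub, neg_sq]
  have h2 : ∫⁻ x, ENNReal.ofReal (g.inner x (Y x) (Y x)) ∂(weightedVolume g Ψ) ≤ 1 :=
    (le_self_add.trans hφn.le).trans (min_le_right _ _)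
  have hlt : ∫⁻ x, ‖h x - φ x‖ₑ ^ 2 ∂(densityMeasure g Ψ κ) < ⊤ := by
    refine lt_of_le_of_lt (le_of_eq ?_) ((h1.trans (min_le_right _ _)).trans_lt ENNReal.one_lt_top)
    refine lintegral_congr fun x => ?_
    rw [enorm_sq_eq_ofReal, enorm_sq_eq_ofReal, ← neg_sub, neg_sq]
  have hYl := hY.isLocalGradient hΨ hΨ_pos hκ hκ_pos
    (hZ.aemeasurable.sub hφ.1.continuous.measurable.aemeasurable) hlt
  refine ⟨φ, hφ, h1.trans (min_le_left _ _), ?_⟩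
  have hae := (weightedVolume_absolutelyContinuous g Ψ).ae_le (gradient_ae_eq_of_sub hφ hZ hYl)
  have hneg : ∀ x, ∀ A : TangentSpace (𝓡 n) x, g.inner x (-A) (-A) = g.inner x A A := by
    intro x A; simp
  calc _ = ∫⁻ x, ENNReal.ofReal (g.inner x (Z x - Y x) (Z x - Y x)) ∂(weightedVolume g Ψ) := by
        refine lintegral_congr_ae ?_
        filter_upwards [hae] with x hx
        rw [hx]
    _ ≤ _ := lintegral_ofReal_le_add (fun x => by
        have := inner_add_self_le g (Z x) (-Y x)
        rw [hneg, ← sub_eq_add_neg] at this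
        exact this) ((hZ.isMeasurableField.aemeasurable_inner
          hZ.isMeasurableField).mono_ac (weightedVolume_absolutelyContinuous g Ψ))
    _ ≤ _ := by gcongr

end Weights

/-! ### The two-variable truncation used as a test function -/

section TruncDiff

/-- A smooth substitute for the minimum of the negative part of `a` and the positive part of `b`. -/
def truncDiff (δ a b : ℝ) : ℝ := trunc δ (-a) - trunc δ (-a - ramp δ b)

variable {δ : ℝ}

theorem truncDiff_zero (δ a : ℝ) : truncDiff δ a 0 = 0 := by simp [truncDiff, ramp_zero]

theorem truncDiff_nonneg (hδ : 0 < δ) (a b : ℝ) : 0 ≤ truncDiff δ a b :=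
  sub_nonneg.2 (trunc_mono δ (by linarith [ramp_nonneg hδ b]))

theorem truncDiff_le (hδ : 0 < δ) (a b : ℝ) : truncDiff δ a b ≤ trunc δ (-a) := by
  unfold truncDiff
  linarith [trunc_nonneg hδ (-a - ramp δ b)]

/-- This bound and the next give the dominating functions: `|b|` when the first argument varies with
`φ` fixed, `|a|` when the second varies with `v` fixed. -/
theorem abs_truncDiff_le_left (hδ : 0 < δ) (a b : ℝ) : |truncDiff δ a b| ≤ |a| := by
  rw [abs_of_nonneg (truncDiff_nonneg hδ a b), ← abs_neg a]
  exact (truncDiff_le hδ a b).trans ((le_abs_self _).trans (abs_trunc_le hδ _))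

theorem abs_truncDiff_le_right (δ a b : ℝ) : |truncDiff δ a b| ≤ |b| := by
  refine (abs_trunc_sub_le (δ := δ) (-a - ramp δ b) (-a)).trans ?_
  simpa [ramp_zero] using abs_ramp_sub_le (δ := δ) 0 b

/-- This gives the potential term its sign. -/
theorem mul_truncDiff_nonpos (hδ : 0 < δ) (a b : ℝ) : a * truncDiff δ a b ≤ 0 := by
  rcases le_total a 0 with h | h
  · exact mul_nonpos_of_nonpos_of_nonneg h (truncDiff_nonneg hδ a b)
  · have h1 := truncDiff_le hδ a b
    rw [trunc_of_le hδ (by linarith)] at h1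
    rw [le_antisymm h1 (truncDiff_nonneg hδ a b), mul_zero]

theorem continuous_truncDiff (δ : ℝ) : Continuous fun p : ℝ × ℝ => truncDiff δ p.1 p.2 := by
  have h1 := continuous_trunc δ
  have h2 := continuous_ramp δ
  unfold truncDiff
  fun_prop

/-- The derivative of `trunc δ` at `-a - ramp δ b`. -/
def truncSlope (δ a b : ℝ) : ℝ := rampDeriv δ (-a - ramp δ b - δ)

theorem truncSlope_nonneg (δ a b : ℝ) : 0 ≤ truncSlope δ a b := rampDeriv_nonneg _ _

theorem truncSlope_le_one (δ a b : ℝ) : truncSlope δ a b ≤ 1 := rampDeriv_le_one _ _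

theorem continuous_truncSlope (δ : ℝ) : Continuous fun p : ℝ × ℝ => truncSlope δ p.1 p.2 := by
  have h1 := continuous_rampDeriv δ
  have h2 := continuous_ramp δ
  unfold truncSlope
  fun_prop

theorem abs_truncSlope_mul_le (δ a b : ℝ) : |truncSlope δ a b * rampDeriv δ b| ≤ 1 := by
  rw [abs_of_nonneg (mul_nonneg (truncSlope_nonneg _ _ _) (rampDeriv_nonneg _ _))]
  exact mul_le_one₀ (truncSlope_le_one _ _ _) (rampDeriv_nonneg _ _) (rampDeriv_le_one _ _)

/-- The shift by `δ` in `trunc δ` pays for the gap between `b` and `ramp δ b`: from `-a ≤ b` it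
follows that `-a - ramp δ b ≤ b - ramp δ b ≤ δ`. -/
theorem truncSlope_eq_zero (hδ : 0 < δ) {a b : ℝ} (h : 0 ≤ a + b) : truncSlope δ a b = 0 :=
  rampDeriv_of_nonpos hδ (by linarith [sub_le_ramp hδ b])

theorem truncDiff_eq_trunc (hδ : 0 < δ) {a b : ℝ} (h : 0 ≤ a + b) :
    truncDiff δ a b = trunc δ (-a) := by
  unfold truncDiff
  rw [trunc_of_le hδ (s := -a - ramp δ b) (by linarith [sub_le_ramp hδ b]), sub_zero]

theorem tendsto_truncDiff (δ : ℝ) {ι : Type*} {l : Filter ι} {a b : ι → ℝ} {a₀ b₀ : ℝ}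
    (ha : Tendsto a l (𝓝 a₀)) (hb : Tendsto b l (𝓝 b₀)) :
    Tendsto (fun j => truncDiff δ (a j) (b j)) l (𝓝 (truncDiff δ a₀ b₀)) :=
  Tendsto.comp (f := fun j => (a j, b j)) (continuous_truncDiff δ).continuousAt.tendsto
    (ha.prodMk_nhds hb)

theorem continuous_truncSlope_mul (δ : ℝ) :
    Continuous fun p : ℝ × ℝ => truncSlope δ p.1 p.2 * rampDeriv δ p.2 :=
  (continuous_truncSlope δ).mul ((continuous_rampDeriv δ).comp continuous_snd)

theorem tendsto_truncSlope_mul (δ : ℝ) {ι : Type*} {l : Filter ι} {a b : ι → ℝ} {a₀ b₀ : ℝ}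
    (ha : Tendsto a l (𝓝 a₀)) (hb : Tendsto b l (𝓝 b₀)) :
    Tendsto (fun j => truncSlope δ (a j) (b j) * rampDeriv δ (b j)) l
      (𝓝 (truncSlope δ a₀ b₀ * rampDeriv δ b₀)) :=
  Tendsto.comp (f := fun j => (a j, b j)) (continuous_truncSlope_mul δ).continuousAt.tendsto
    (ha.prodMk_nhds hb)

theorem aemeasurable_truncDiff (δ : ℝ) {α : Type*} [MeasurableSpace α] {m : Measure α}
    {a b : α → ℝ} (ha : AEMeasurable a m) (hb : AEMeasurable b m) :
    AEMeasurable (fun x => truncDiff δ (a x) (b x)) m :=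
  Measurable.comp_aemeasurable (f := fun x => (a x, b x)) (continuous_truncDiff δ).measurable
    (ha.prodMk hb)

theorem aemeasurable_truncSlope_mul (δ : ℝ) {α : Type*} [MeasurableSpace α] {m : Measure α}
    {a b : α → ℝ} (ha : AEMeasurable a m) (hb : AEMeasurable b m) :
    AEMeasurable (fun x => truncSlope δ (a x) (b x) * rampDeriv δ (b x)) m :=
  Measurable.comp_aemeasurable (f := fun x => (a x, b x)) (continuous_truncSlope_mul δ).measurable
    (ha.prodMk hb)

end TruncDiff

/-- The geometric rate makes the sum of the squared errors integrable, hence finite almost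
everywhere, so no subsequence is needed. -/
theorem tendsto_ae_of_lintegral_enorm_sq_le {α : Type*} [MeasurableSpace α] {m : Measure α}
    {u : ℕ → α → ℝ} {f : α → ℝ} (hu : ∀ j, AEMeasurable (u j) m) (hf : AEMeasurable f m)
    (h : ∀ j, ∫⁻ x, ‖u j x - f x‖ₑ ^ 2 ∂m ≤ (1 / 2) ^ j) :
    ∀ᵐ x ∂m, Tendsto (fun j => u j x) atTop (𝓝 (f x)) := by
  have hm : ∀ j, AEMeasurable (fun x => ‖u j x - f x‖ₑ ^ 2) m := fun j =>
    ((hu j).sub hf).enorm.pow_const 2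
  have h1 : ∫⁻ x, ∑' j, ‖u j x - f x‖ₑ ^ 2 ∂m ≠ ⊤ := by
    rw [lintegral_tsum hm]
    refine ne_top_of_le_ne_top ?_ (ENNReal.tsum_le_tsum h)
    rw [ENNReal.tsum_geometric]
    simp
  filter_upwards [ae_lt_top' (AEMeasurable.tsum hm) h1] with x hx
  have h2 := ENNReal.tendsto_atTop_zero_of_tsum_ne_top hx.ne
  have h3 := (ENNReal.continuous_rpow_const (y := (1 / 2 : ℝ))).tendsto 0 |>.comp h2
  rw [tendsto_iff_edist_tendsto_0]
  simp only [one_div,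
    ENNReal.zero_rpow_of_pos (show (0 : ℝ) < 2⁻¹ by norm_num)] at h3
  refine h3.congr fun j => ?_
  rw [edist_eq_enorm_sub, Function.comp_apply, ← ENNReal.rpow_natCast, ← ENNReal.rpow_mul]
  norm_num

/-! ### Square integrable vector fields -/

section SquareIntegrable

variable {n : ℕ} {M : Type*} [TopologicalSpace M]
  [ChartedSpace (EuclideanSpace ℝ (Fin n)) M] [IsManifold (𝓡 n) ∞ M]
  [MeasurableSpace M] [BorelSpace M]

theorem isLocallyFiniteMeasure_weightedVolume (g : Metric n M) {a : M → ℝ} (ha : Continuous a) :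
    IsLocallyFiniteMeasure (weightedVolume g a) :=
  IsLocallyFiniteMeasure.withDensity_ofReal ha

/-- `Y` is a measurable vector field with `∫ |Y|² dμ < ∞`. -/
def IsSquareIntegrable (g : Metric n M) (μ : Measure M) (Y : VectorField n M) : Prop :=
  IsMeasurableField g Y ∧ Integrable (fun x => g.inner x (Y x) (Y x)) μ

variable [SecondCountableTopology M] {g : Metric n M} {μ : Measure M} {Y Z : VectorField n M}

theorem IsSquareIntegrable.integrable_inner (hμ : μ ≪ riemannianVolume g)
    (hY : IsSquareIntegrable g μ Y) (hZ : IsSquareIntegrable g μ Z) :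
    Integrable (fun x => g.inner x (Y x) (Z x)) μ := by
  refine (hY.2.add hZ.2).mono'
    ((hY.1.aemeasurable_inner hZ.1).mono_ac hμ).aestronglyMeasurable
    (Eventually.of_forall fun x => ?_)
  have := two_mul_abs_inner_le g (Y x) (Z x)
  rw [Real.norm_eq_abs, Pi.add_apply]
  linarith [abs_nonneg (g.inner x (Y x) (Z x))]

theorem IsSquareIntegrable.sub (hμ : μ ≪ riemannianVolume g) (hY : IsSquareIntegrable g μ Y)
    (hZ : IsSquareIntegrable g μ Z) : IsSquareIntegrable g μ fun x => Y x - Z x := by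
  refine ⟨hY.1.sub hZ.1, ((hY.2.sub ((hY.integrable_inner hμ hZ).const_mul 2)).add hZ.2).congr
    (Eventually.of_forall fun x => ?_)⟩
  simp only [Pi.add_apply, Pi.sub_apply, map_sub, sub_apply, g.symm x (Z x) (Y x)]
  ring

theorem IsTestFunction.isSquareIntegrable_gradient [IsLocallyFiniteMeasure μ] {φ : M → ℝ}
    (hφ : IsTestFunction n φ) : IsSquareIntegrable g μ (gradient g φ) := by
  refine ⟨isMeasurableField_of_contMDiff g (contMDiffAt_gradient g hφ.1),
    Continuous.integrable_of_hasCompactSupport ?_ (hφ.2.mono' fun x hx => ?_)⟩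
  · exact continuous_iff_continuousAt.2 fun x => (contMDiffAt_inner g
      (contMDiffAt_gradient g hφ.1 x) (contMDiffAt_gradient g hφ.1 x)).continuousAt
  · by_contra h
    exact hx (by simp [gradient_of_notMem_tsupport g h])

theorem isSquareIntegrable_of_lintegral_lt_top (hμ : μ ≪ riemannianVolume g)
    (hY : IsMeasurableField g Y) (h : ∫⁻ x, ENNReal.ofReal (g.inner x (Y x) (Y x)) ∂μ < ⊤) :
    IsSquareIntegrable g μ Y := by
  refine ⟨hY, ((hY.aemeasurable_inner hY).mono_ac hμ).aestronglyMeasurable, ?_⟩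
  rwa [hasFiniteIntegral_iff_ofReal (Eventually.of_forall fun x => inner_self_nonneg g _)]

end SquareIntegrable

/-! ### The truncated test function and its gradient -/

section TestFunctions

variable {n : ℕ} {M : Type*} [TopologicalSpace M]
  [ChartedSpace (EuclideanSpace ℝ (Fin n)) M] [IsManifold (𝓡 n) ∞ M]

variable {x : M}

theorem IsTestFunction.truncDiff {u φ : M → ℝ} (δ : ℝ) (hu : IsTestFunction n u)
    (hφ : IsTestFunction n φ) : IsTestFunction n fun x => truncDiff δ (u x) (φ x) := by
  refine ⟨?_, hφ.2.mono fun x hx => ?_⟩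
  · unfold WeightedManifold.truncDiff
    exact ((contDiff_trunc δ).contMDiff.comp hu.1.neg).sub ((contDiff_trunc δ).contMDiff.comp
      (hu.1.neg.sub ((contDiff_ramp δ).contMDiff.comp hφ.1)))
  · intro h
    exact hx (by simp [h, truncDiff_zero])

theorem mvfderiv_truncDiff {u φ : M → ℝ} (δ : ℝ) (hu : IsTestFunction n u)
    (hφ : IsTestFunction n φ) (Y : TangentSpace (𝓡 n) x) :
    mvfderiv (𝓡 n) (fun x => truncDiff δ (u x) (φ x)) x Y =
      (truncSlope δ (u x) (φ x) - rampDeriv δ (-u x - δ)) * mvfderiv (𝓡 n) u x Y +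
        truncSlope δ (u x) (φ x) * rampDeriv δ (φ x) * mvfderiv (𝓡 n) φ x Y := by
  have hu' := hu.mdifferentiableAt x
  have hφ' := hφ.mdifferentiableAt x
  have hr : MDifferentiableAt (𝓡 n) 𝓘(ℝ) (fun y => ramp δ (φ y)) x :=
    (((contDiff_ramp δ).contMDiff.comp hφ.1) x).mdifferentiableAt (by simp)
  have hn : MDifferentiableAt (𝓡 n) 𝓘(ℝ) (fun y => -u y) x := (hu.1.neg x).mdifferentiableAt
    (by simp)
  have hq : MDifferentiableAt (𝓡 n) 𝓘(ℝ) (fun y => -u y - ramp δ (φ y)) x := hn.sub hr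
  have h1 := mvfderiv_real_comp (u := fun y => -u y) (hasDerivAt_trunc δ (-u x)) hn Y
  have h2 := mvfderiv_real_comp (u := fun y => -u y - ramp δ (φ y))
    (hasDerivAt_trunc δ (-u x - ramp δ (φ x))) hq Y
  have h3 := mvfderiv_real_comp (hasDerivAt_ramp δ (φ x)) hφ' Y
  have t1 : MDifferentiableAt (𝓡 n) 𝓘(ℝ) (fun y => trunc δ (-u y)) x :=
    (((contDiff_trunc δ).contMDiff.comp hu.1.neg) x).mdifferentiableAt (by simp)
  have t2 : MDifferentiableAt (𝓡 n) 𝓘(ℝ) (fun y => trunc δ (-u y - ramp δ (φ y))) x :=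
    (((contDiff_trunc δ).contMDiff.comp (hu.1.neg.sub
      ((contDiff_ramp δ).contMDiff.comp hφ.1))) x).mdifferentiableAt (by simp)
  unfold truncDiff
  rw [mvfderiv_fun_sub t1 t2, sub_apply, h1, h2, mvfderiv_fun_sub hn hr, sub_apply, h3,
    mvfderiv_fun_neg, neg_apply]
  unfold truncSlope
  ring

/-- The coefficient of `∇u` lies in `[-1, 0]` because `rampDeriv δ` is monotone with values in `[0,
1]`. Since `⟨∇u, X⟩ ≥ -|∇u - X|²`, the whole `∇u` term is at most `|∇u - X|²`, so no limit of its
coefficient has to be taken. -/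
theorem inner_gradient_truncDiff_le (g : Metric n M) {u φ : M → ℝ} {δ : ℝ} (hδ : 0 < δ)
    (hu : IsTestFunction n u) (hφ : IsTestFunction n φ) (X : TangentSpace (𝓡 n) x) :
    g.inner x X (gradient g (fun x => truncDiff δ (u x) (φ x)) x) ≤
      (tsupport φ).indicator (fun _ => g.inner x (gradient g u x - X) (gradient g u x - X)) x +
        truncSlope δ (u x) (φ x) * rampDeriv δ (φ x) * g.inner x (gradient g φ x) X := by
  by_cases hx : x ∈ tsupport φ
  · rw [indicator_of_mem hx, g.symm, inner_gradient, mvfderiv_truncDiff δ hu hφ,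
      ← inner_gradient g φ, ← inner_gradient g u]
    have hA : truncSlope δ (u x) (φ x) ≤ rampDeriv δ (-u x - δ) :=
      rampDeriv_mono hδ (by linarith [ramp_nonneg hδ (φ x)])
    have hA0 := truncSlope_nonneg δ (u x) (φ x)
    have hA1 := rampDeriv_le_one δ (-u x - δ)
    set D := gradient g u x - X with hD
    have hu' : g.inner x (gradient g u x) X = g.inner x D X + g.inner x X X := by
      rw [hD, map_sub, sub_apply]; ring
    have h1 := two_mul_abs_inner_le g D X
    have h2 := neg_abs_le (g.inner x D X)
    have h3 := inner_self_nonneg g D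
    have h4 := inner_self_nonneg g X
    rw [hu']
    -- Completing the square: `|⟨D, X⟩|` is at most half of `|D|² + |X|²`.
    have h5 : -g.inner x D D ≤ g.inner x D X + g.inner x X X := by linarith
    nlinarith [mul_le_mul_of_nonneg_left h5 (sub_nonneg.2 hA)]
  · have hz : x ∉ tsupport fun x => truncDiff δ (u x) (φ x) := fun h =>
      hx (closure_mono (fun y (hy : truncDiff δ (u y) (φ y) ≠ 0) (h' : φ y = 0) => hy (by
        simp [h', truncDiff_zero])) h)
    rw [indicator_of_notMem hx, gradient_of_notMem_tsupport g hz, gradient_of_notMem_tsupport g hx]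
    simp

end TestFunctions

/-! ### Testing the supersolution inequality -/

section Supersolutions

variable {n : ℕ} {M : Type*} [TopologicalSpace M]
  [ChartedSpace (EuclideanSpace ℝ (Fin n)) M] [IsManifold (𝓡 n) ∞ M]
  [T2Space M] [SecondCountableTopology M] [MeasurableSpace M] [BorelSpace M]

theorem IsLocalGradient.exists_seq_approx {g : Metric n M} {f Ψ : M → ℝ} {X : VectorField n M}
    (h : IsLocalGradient g f X) (hΨ : Continuous Ψ) {K : Set M} (hK : IsCompact K) :
    ∃ u : ℕ → M → ℝ, (∀ j, IsTestFunction n (u j)) ∧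
      (∀ᵐ x ∂(riemannianVolume g), x ∈ K → Tendsto (fun j => u j x) atTop (𝓝 (f x))) ∧
      Tendsto (fun j => ∫ x in K, g.inner x (gradient g (u j) x - X x) (gradient g (u j) x - X x)
        ∂(weightedVolume g Ψ)) atTop (𝓝 0) := by
  have hpos : ∀ j : ℕ, (0 : ℝ≥0∞) < (1 / 2) ^ j := fun j => ENNReal.pow_pos (by simp) j
  choose u hu h1 h2 using fun j => h.exists_approx hK (hpos j)
  refine ⟨u, hu, ?_, ?_⟩
  · rw [← ae_restrict_iff' hK.measurableSet]
    exact tendsto_ae_of_lintegral_enorm_sq_le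
      (fun j => (hu j).1.continuous.measurable.aemeasurable) h.aemeasurable.restrict h1
  · obtain ⟨C, hC, hle⟩ := exists_lintegral_weightedVolume_le g hΨ hK
    have hD : ∀ j, IsMeasurableField g fun x => gradient g (u j) x - X x := fun j =>
      (isMeasurableField_of_contMDiff g (contMDiffAt_gradient g (hu j).1)).sub h.isMeasurableField
    have h3 : Tendsto (fun j : ℕ => C * (1 / 2 : ℝ≥0∞) ^ j) atTop (𝓝 0) := by
      have := ENNReal.Tendsto.const_mul (a := C)
        (ENNReal.tendsto_pow_atTop_nhds_zero_of_lt_one (r := 1 / 2) (by simp)) (Or.inr hC)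
      simpa using this
    have h4 := tendsto_of_tendsto_of_tendsto_of_le_of_le tendsto_const_nhds h3
      (fun _ => zero_le) fun j => (hle _).trans (mul_le_mul_right (h2 j) C)
    have h5 := (ENNReal.tendsto_toReal ENNReal.zero_ne_top).comp h4
    refine h5.congr fun j => ?_
    rw [integral_eq_lintegral_of_nonneg_ae
      (Eventually.of_forall fun x => inner_self_nonneg g _)
      (((hD j).aemeasurable_inner (hD j)).mono_ac
        (weightedVolume_absolutelyContinuous g Ψ)).restrict.aestronglyMeasurable]
    rfl

variable {g : Metric n M} {Ψ U v w : M → ℝ} {X : VectorField n M} {m : Measure M} {δ : ℝ}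

/-- The first limit, with `φ` fixed: test functions `u j` tend to `v` on the compact support of `φ`,
which contains the support of `truncDiff δ (u j) φ`. The surviving potential term is nonpositive and
is dropped. -/
theorem truncDiff_inequality (hδ : 0 < δ) (hΨ : Continuous Ψ)
    (hm : m ≪ riemannianVolume g) [IsLocallyFiniteMeasure m] (hU : ContMDiff (𝓡 n) 𝓘(ℝ) ∞ U)
    (hU0 : ∀ x, 0 ≤ U x) (hv : MemLp v 2 m) (hw : MemLp w 2 m) (hX : IsLocalGradient g v X)
    (hXμ : IsSquareIntegrable g (weightedVolume g Ψ) X)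
    (hsuper : ∀ φ, IsTestFunction n φ → (∀ x, 0 ≤ φ x) →
      0 ≤ ∫ x, w x * φ x ∂m + ∫ x, v x * (U x * φ x) ∂m +
        ∫ x, g.inner x (X x) (gradient g φ x) ∂(weightedVolume g Ψ))
    {φ : M → ℝ} (hφ : IsTestFunction n φ) :
    0 ≤ ∫ x, w x * truncDiff δ (v x) (φ x) ∂m +
      ∫ x, truncSlope δ (v x) (φ x) * rampDeriv δ (φ x) * g.inner x (gradient g φ x) (X x)
        ∂(weightedVolume g Ψ) := by
  set μ := weightedVolume g Ψ with hμdef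
  have hμ : μ ≪ riemannianVolume g := weightedVolume_absolutelyContinuous g Ψ
  have hμlf : IsLocallyFiniteMeasure μ := isLocallyFiniteMeasure_weightedVolume g hΨ
  have hKm : MeasurableSet (tsupport φ) := (isClosed_tsupport φ).measurableSet
  obtain ⟨u, hu, huv, hE⟩ := hX.exists_seq_approx hΨ hφ.2
  have hφm : ∀ ν : Measure M, AEMeasurable φ ν := fun ν => hφ.1.continuous.measurable.aemeasurable
  have hum : ∀ j, ∀ ν : Measure M, AEMeasurable (u j) ν := fun j ν =>
    (hu j).1.continuous.measurable.aemeasurable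
  have hφL : MemLp φ 2 m := hφ.1.continuous.memLp_of_hasCompactSupport hφ.2
  have hUφ := hφ.mul_left hU
  have hUφL : MemLp (fun x => U x * φ x) 2 m :=
    hUφ.1.continuous.memLp_of_hasCompactSupport hUφ.2
  have hGm : ∀ j, ∀ ν : Measure M, AEMeasurable (fun x => truncDiff δ (u j x) (φ x)) ν := fun j ν =>
    aemeasurable_truncDiff δ (hum j ν) (hφm ν)
  have hBm : ∀ j, ∀ ν : Measure M,
      AEMeasurable (fun x => truncSlope δ (u j x) (φ x) * rampDeriv δ (φ x)) ν := fun j ν =>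
    aemeasurable_truncSlope_mul δ (hum j ν) (hφm ν)
  have hgφ : IsSquareIntegrable g μ (gradient g φ) := hφ.isSquareIntegrable_gradient
  have hgφX := hgφ.integrable_inner hμ hXμ
  have hGlim : ∀ᵐ x ∂(riemannianVolume g), Tendsto (fun j => truncDiff δ (u j x) (φ x)) atTop
      (𝓝 (truncDiff δ (v x) (φ x))) := by
    filter_upwards [huv] with x hx
    by_cases hxK : x ∈ tsupport φ
    · exact tendsto_truncDiff δ (hx hxK) tendsto_const_nhds
    · simp [image_eq_zero_of_notMem_tsupport hxK, truncDiff_zero]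
  have hBlim : ∀ᵐ x ∂(riemannianVolume g), Tendsto (fun j => truncSlope δ (u j x) (φ x) *
      rampDeriv δ (φ x) * g.inner x (gradient g φ x) (X x)) atTop
      (𝓝 (truncSlope δ (v x) (φ x) * rampDeriv δ (φ x) * g.inner x (gradient g φ x) (X x))) := by
    filter_upwards [huv] with x hx
    by_cases hxK : x ∈ tsupport φ
    · exact (tendsto_truncSlope_mul δ (hx hxK) tendsto_const_nhds).mul_const _
    · simp [gradient_of_notMem_tsupport g hxK]
  have l1 : Tendsto (fun j => ∫ x, w x * truncDiff δ (u j x) (φ x) ∂m) atTop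
      (𝓝 (∫ x, w x * truncDiff δ (v x) (φ x) ∂m)) := by
    refine tendsto_integral_of_dominated_convergence (fun x => |w x * φ x|)
      (fun j => (hw.1.aemeasurable.mul (hGm j m)).aestronglyMeasurable)
      (hw.integrable_mul hφL).abs (fun j => Eventually.of_forall fun x => ?_) ?_
    · rw [Real.norm_eq_abs, abs_mul, abs_mul]
      exact mul_le_mul_of_nonneg_left (abs_truncDiff_le_right δ _ _) (abs_nonneg _)
    · filter_upwards [hm.ae_le hGlim] with x hx using hx.const_mul _
  have l2 : Tendsto (fun j => ∫ x, v x * (U x * truncDiff δ (u j x) (φ x)) ∂m) atTop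
      (𝓝 (∫ x, v x * (U x * truncDiff δ (v x) (φ x)) ∂m)) := by
    refine tendsto_integral_of_dominated_convergence (fun x => |v x * (U x * φ x)|)
      (fun j => (hv.1.aemeasurable.mul (hU.continuous.measurable.aemeasurable.mul
        (hGm j m))).aestronglyMeasurable)
      (hv.integrable_mul hUφL).abs (fun j => Eventually.of_forall fun x => ?_) ?_
    · rw [Real.norm_eq_abs, abs_mul, abs_mul, abs_mul, abs_mul]
      exact mul_le_mul_of_nonneg_left (mul_le_mul_of_nonneg_left
        (abs_truncDiff_le_right δ _ _) (abs_nonneg _)) (abs_nonneg _)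
    · filter_upwards [hm.ae_le hGlim] with x hx using (hx.const_mul _).const_mul _
  have hBbound : ∀ j x, ‖truncSlope δ (u j x) (φ x) * rampDeriv δ (φ x) *
      g.inner x (gradient g φ x) (X x)‖ ≤ |g.inner x (gradient g φ x) (X x)| := by
    intro j x
    rw [Real.norm_eq_abs, abs_mul]
    exact mul_le_of_le_one_left (abs_nonneg _) (abs_truncSlope_mul_le δ _ _)
  have hBm' : ∀ j, AEStronglyMeasurable (fun x => truncSlope δ (u j x) (φ x) *
      rampDeriv δ (φ x) * g.inner x (gradient g φ x) (X x)) μ := fun j =>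
    ((hBm j μ).mul hgφX.1.aemeasurable).aestronglyMeasurable
  have l3 : Tendsto (fun j => ∫ x, truncSlope δ (u j x) (φ x) * rampDeriv δ (φ x) *
        g.inner x (gradient g φ x) (X x) ∂μ) atTop
      (𝓝 (∫ x, truncSlope δ (v x) (φ x) * rampDeriv δ (φ x) *
        g.inner x (gradient g φ x) (X x) ∂μ)) :=
    tendsto_integral_of_dominated_convergence (fun x => |g.inner x (gradient g φ x) (X x)|)
      hBm' hgφX.abs (fun j => Eventually.of_forall (hBbound j)) (hμ.ae_le hBlim)
  have key : ∀ j, 0 ≤ ∫ x, w x * truncDiff δ (u j x) (φ x) ∂m +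
      ∫ x, v x * (U x * truncDiff δ (u j x) (φ x)) ∂m +
      (∫ x in tsupport φ, g.inner x (gradient g (u j) x - X x) (gradient g (u j) x - X x) ∂μ +
        ∫ x, truncSlope δ (u j x) (φ x) * rampDeriv δ (φ x) *
          g.inner x (gradient g φ x) (X x) ∂μ) := by
    intro j
    refine (hsuper _ ((hu j).truncDiff δ hφ) fun x => truncDiff_nonneg hδ _ _).trans ?_
    refine add_le_add_right ?_ _
    have hgu : IsSquareIntegrable g μ (gradient g (u j)) := (hu j).isSquareIntegrable_gradient
    have hgz : IsSquareIntegrable g μ (gradient g fun x => truncDiff δ (u j x) (φ x)) :=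
      ((hu j).truncDiff δ hφ).isSquareIntegrable_gradient
    have iD := (hgu.sub hμ hXμ).2.indicator hKm
    have iB := hgφX.abs.mono' (hBm' j) (Eventually.of_forall (hBbound j))
    rw [← integral_indicator hKm, ← integral_add iD iB]
    refine integral_mono (hXμ.integrable_inner hμ hgz) (iD.add iB) fun x => ?_
    exact inner_gradient_truncDiff_le g hδ (hu j) hφ (X x)
  have hlim := ge_of_tendsto' ((l1.add l2).add (hE.add l3)) key
  have hneg : ∫ x, v x * (U x * truncDiff δ (v x) (φ x)) ∂m ≤ 0 :=
    integral_nonpos fun x => by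
      have := mul_nonpos_of_nonneg_of_nonpos (hU0 x) (mul_truncDiff_nonpos hδ (v x) (φ x))
      simp only [Pi.zero_apply]
      linarith
  linarith

/-- The second limit, `φ k → h`: where `v + h ≥ 0`, the substitute becomes `trunc δ (-v)` and the
coefficient of `∇φ k` tends to zero. -/
theorem integral_trunc_mul_nonneg (hδ : 0 < δ) (hΨ : Continuous Ψ) (hΨ_pos : ∀ x, 0 < Ψ x)
    (hm : m ≪ riemannianVolume g) [IsLocallyFiniteMeasure m] (hU : ContMDiff (𝓡 n) 𝓘(ℝ) ∞ U)
    (hU0 : ∀ x, 0 ≤ U x) (hv : MemLp v 2 m) (hw : MemLp w 2 m) (hX : IsLocalGradient g v X)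
    (hXμ : IsSquareIntegrable g (weightedVolume g Ψ) X)
    (hsuper : ∀ φ, IsTestFunction n φ → (∀ x, 0 ≤ φ x) →
      0 ≤ ∫ x, w x * φ x ∂m + ∫ x, v x * (U x * φ x) ∂m +
        ∫ x, g.inner x (X x) (gradient g φ x) ∂(weightedVolume g Ψ))
    {κ : M → ℝ} (hκ : Continuous κ) (hκ_pos : ∀ x, 0 < κ x) (hbdry : NonnegModW10 g Ψ κ v) :
    0 ≤ ∫ x, trunc δ (-(v x)) * w x ∂m := by
  set μ := weightedVolume g Ψ with hμdef
  have hμ : μ ≪ riemannianVolume g := weightedVolume_absolutelyContinuous g Ψ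
  have hμ' : riemannianVolume g ≪ μ := absolutelyContinuous_weightedVolume g hΨ hΨ_pos
  have hμlf : IsLocallyFiniteMeasure μ := isLocallyFiniteMeasure_weightedVolume g hΨ
  obtain ⟨h, hh, hvh⟩ := hbdry
  obtain ⟨C, hC, happ⟩ := hh.exists_approx hΨ hΨ_pos hκ hκ_pos
  have hvol := riemannianVolume_absolutelyContinuous_densityMeasure g hΨ hΨ_pos hκ hκ_pos
  have hpos : ∀ j : ℕ, (0 : ℝ≥0∞) < (1 / 2) ^ j := fun j => ENNReal.pow_pos (by simp) j
  choose φ hφ h1 h2 using fun j : ℕ => happ _ (hpos j)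
  have hlim : ∀ᵐ x ∂(riemannianVolume g), Tendsto (fun k => φ k x) atTop (𝓝 (h x)) :=
    hvol.ae_le (tendsto_ae_of_lintegral_enorm_sq_le
      (fun j => (hφ j).1.continuous.measurable.aemeasurable) hh.1.1.1.aemeasurable h1)
  have hvh' := hμ'.ae_le hvh
  have hφm : ∀ k, ∀ ν : Measure M, AEMeasurable (φ k) ν := fun k ν =>
    (hφ k).1.continuous.measurable.aemeasurable
  have hvm : AEMeasurable v μ := hX.aemeasurable.mono_ac hμ
  have l1 : Tendsto (fun k => ∫ x, w x * truncDiff δ (v x) (φ k x) ∂m) atTop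
      (𝓝 (∫ x, trunc δ (-(v x)) * w x ∂m)) := by
    refine tendsto_integral_of_dominated_convergence (fun x => |w x * v x|)
      (fun k => (hw.1.aemeasurable.mul
        (aemeasurable_truncDiff δ hv.1.aemeasurable (hφm k m))).aestronglyMeasurable)
      (hw.integrable_mul hv).abs (fun k => Eventually.of_forall fun x => ?_) ?_
    · rw [Real.norm_eq_abs, abs_mul, abs_mul]
      exact mul_le_mul_of_nonneg_left (abs_truncDiff_le_left hδ _ _) (abs_nonneg _)
    · filter_upwards [hm.ae_le hlim, hm.ae_le hvh'] with x hx hx'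
      rw [mul_comm, ← truncDiff_eq_trunc hδ hx']
      exact (tendsto_truncDiff δ tendsto_const_nhds hx).const_mul _
  have hcm : ∀ k, AEMeasurable (fun x => truncSlope δ (v x) (φ k x) * rampDeriv δ (φ k x)) μ :=
    fun k => aemeasurable_truncSlope_mul δ hvm (hφm k μ)
  have hcm' : ∀ k, AEStronglyMeasurable (fun x =>
      (truncSlope δ (v x) (φ k x) * rampDeriv δ (φ k x)) ^ 2 * g.inner x (X x) (X x)) μ := fun k =>
    (((hcm k).pow_const 2).mul hXμ.2.1.aemeasurable).aestronglyMeasurable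
  have hcb : ∀ k x, ‖(truncSlope δ (v x) (φ k x) * rampDeriv δ (φ k x)) ^ 2 *
      g.inner x (X x) (X x)‖ ≤ g.inner x (X x) (X x) := by
    intro k x
    have h0 := inner_self_nonneg g (X x)
    rw [Real.norm_of_nonneg (mul_nonneg (sq_nonneg _) h0)]
    exact mul_le_of_le_one_left h0 ((sq_le_one_iff_abs_le_one _).2 (abs_truncSlope_mul_le δ _ _))
  have l2 : Tendsto (fun k => ∫ x, (truncSlope δ (v x) (φ k x) * rampDeriv δ (φ k x)) ^ 2 *
      g.inner x (X x) (X x) ∂μ) atTop (𝓝 0) := by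
    have := tendsto_integral_of_dominated_convergence (f := fun _ => (0 : ℝ))
      (fun x => g.inner x (X x) (X x)) hcm' hXμ.2
      (fun k => Eventually.of_forall (hcb k)) (by
        filter_upwards [hμ.ae_le hlim, hvh] with x hx hx'
        have h4 := tendsto_truncSlope_mul δ (tendsto_const_nhds (x := v x)) hx
        have h5 := (h4.pow 2).mul_const (g.inner x (X x) (X x))
        simp only [truncSlope_eq_zero hδ hx', zero_mul, ne_eq, OfNat.ofNat_ne_zero,
          not_false_eq_true, zero_pow] at h5
        exact h5)
    simpa using this
  have hgφ : ∀ k, IsSquareIntegrable g μ (gradient g (φ k)) := fun k =>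
    (hφ k).isSquareIntegrable_gradient
  have hgb : ∀ k, ∫ x, g.inner x (gradient g (φ k) x) (gradient g (φ k) x) ∂μ ≤ C.toReal := by
    intro k
    rw [integral_eq_lintegral_of_nonneg_ae
      (Eventually.of_forall fun x => inner_self_nonneg g _) (hgφ k).2.1]
    exact ENNReal.toReal_mono hC (h2 k)
  -- Young's inequality puts `ε` on the bounded gradients of `φ k` and `1 / ε` on the integral that
  -- tends to zero by `l2`. The limit in `k` is taken for fixed `ε`.
  have key : ∀ ε : ℝ, 0 < ε → 0 ≤ ∫ x, trunc δ (-(v x)) * w x ∂m + ε * C.toReal := by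
    intro ε hε
    have l3 := (l1.add_const (ε * C.toReal)).add (l2.const_mul (1 / ε))
    rw [mul_zero, add_zero] at l3
    refine ge_of_tendsto' l3 fun k => ?_
    have hA := truncDiff_inequality hδ hΨ hm hU hU0 hv hw hX hXμ hsuper (hφ k)
    have iX : Integrable (fun x => (truncSlope δ (v x) (φ k x) * rampDeriv δ (φ k x)) ^ 2 *
        g.inner x (X x) (X x)) μ := hXμ.2.mono' (hcm' k) (Eventually.of_forall (hcb k))
    have hle : ∫ x, truncSlope δ (v x) (φ k x) * rampDeriv δ (φ k x) *
        g.inner x (gradient g (φ k) x) (X x) ∂μ ≤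
        ε * (∫ x, g.inner x (gradient g (φ k) x) (gradient g (φ k) x) ∂μ) +
        1 / ε * ∫ x, (truncSlope δ (v x) (φ k x) * rampDeriv δ (φ k x)) ^ 2 *
          g.inner x (X x) (X x) ∂μ := by
      rw [← integral_const_mul, ← integral_const_mul,
        ← integral_add ((hgφ k).2.const_mul ε) (iX.const_mul (1 / ε))]
      refine integral_mono ?_ (((hgφ k).2.const_mul ε).add (iX.const_mul (1 / ε))) fun x => ?_
      · refine ((hgφ k).integrable_inner hμ hXμ).abs.mono'
          ((hcm k).mul ((hgφ k).integrable_inner hμ hXμ).1.aemeasurable).aestronglyMeasurable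
          (Eventually.of_forall fun x => ?_)
        rw [Real.norm_eq_abs, abs_mul]
        exact mul_le_of_le_one_left (abs_nonneg _) (abs_truncSlope_mul_le δ _ _)
      · refine (le_abs_self _).trans ((abs_inner_le_mul_add g _ _ hε _).trans (le_of_eq ?_))
        ring
    have := mul_le_mul_of_nonneg_left (hgb k) hε.le
    linarith
  refine le_of_forall_pos_le_add fun η hη => ?_
  have hC0 : 0 ≤ C.toReal := ENNReal.toReal_nonneg
  -- Adding `1` covers the case of a zero bound.
  have := key (η / (C.toReal + 1)) (by positivity)
  refine this.trans (add_le_add_right ?_ _)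
  rw [div_mul_eq_mul_div, div_le_iff₀ (by positivity)]
  nlinarith

/-- The test function is `ρ Ψ φ`: distributions pair with respect to `vol_g`, so the factor restores
the measure `ρ μ`, and it cancels the inverse weights in the operator. Transposition then leads to
the test field `Ψ ∇φ`. -/
theorem weak_inequality_of_distributionLE {ρ V : M → ℝ} (hΨ : ContMDiff (𝓡 n) 𝓘(ℝ) ∞ Ψ)
    (hΨ_pos : ∀ x, 0 < Ψ x) (hρ : ContMDiff (𝓡 n) 𝓘(ℝ) ∞ ρ) (hρ_pos : ∀ x, 0 < ρ x)
    (hX : IsLocalGradient g v X)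
    (hvw : DistributionLE n (distSchrodinger g Ψ ρ V (toDistribution g v)) (toDistribution g w))
    {φ : M → ℝ} (hφ : IsTestFunction n φ) (hφ0 : ∀ x, 0 ≤ φ x) :
    0 ≤ ∫ x, w x * φ x ∂(densityMeasure g Ψ ρ) +
      ∫ x, v x * (V x / ρ x * φ x) ∂(densityMeasure g Ψ ρ) +
      ∫ x, g.inner x (X x) (gradient g φ x) ∂(weightedVolume g Ψ) := by
  have h := hvw (fun x => ρ x * Ψ x * φ x) (hφ.mul_left (hρ.mul hΨ)) fun x =>
    mul_nonneg (mul_nonneg (hρ_pos x).le (hΨ_pos x).le) (hφ0 x)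
  have hw := hX.weak _ (isTestField_smul_gradient g hΨ hφ)
  have e1 : (fun x => (Ψ x)⁻¹ * ((ρ x)⁻¹ * (ρ x * Ψ x * φ x))) = φ := by
    ext x
    have := (hΨ_pos x).ne'
    have := (hρ_pos x).ne'
    field_simp
  simp only [distSchrodinger, distLaplacian, mulDistribution, distDivergence, mulVectorDistribution,
    Pi.sub_apply] at h
  rw [e1] at h
  simp only [distGradient, toDistribution, toVectorDistribution] at h hw
  rw [hw] at h
  rw [densityMeasure_eq g hΨ.continuous hΨ_pos hρ.continuous,
    integral_weightedVolume g (a := fun x => Ψ x * ρ x) (hΨ.mul hρ).continuous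
      fun x => mul_pos (hΨ_pos x) (hρ_pos x),
    integral_weightedVolume g (a := fun x => Ψ x * ρ x) (hΨ.mul hρ).continuous
      fun x => mul_pos (hΨ_pos x) (hρ_pos x),
    integral_weightedVolume g hΨ.continuous hΨ_pos]
  have e2 : ∀ x, Ψ x * ρ x * (w x * φ x) = w x * (ρ x * Ψ x * φ x) := fun x => by ring
  have e3 : ∀ x, Ψ x * ρ x * (v x * (V x / ρ x * φ x)) =
      v x * ((ρ x)⁻¹ * V x * (ρ x * Ψ x * φ x)) := fun x => by ring
  have e4 : ∀ x, Ψ x * g.inner x (X x) (gradient g φ x) =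
      g.inner x (X x) (Ψ x • gradient g φ x) := fun x => by simp
  simp only [e2, e3, e4]
  linarith

end Supersolutions

end WeightedManifold

end

/-! ### The parabolic maximum principle -/

theorem mainTheorem10 {n : ℕ} {M : Type*} [TopologicalSpace M]
    [ChartedSpace (EuclideanSpace ℝ (Fin n)) M] [IsManifold (𝓡 n) ∞ M]
    [T2Space M] [SecondCountableTopology M] [ConnectedSpace M]
    [MeasurableSpace M] [BorelSpace M]
    (g : WeightedManifold.Metric n M) (Ψ ρ V : M → ℝ)
    (hΨ : ContMDiff (𝓡 n) 𝓘(ℝ) ∞ Ψ) (hΨ_pos : ∀ x, 0 < Ψ x)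
    (hρ : ContMDiff (𝓡 n) 𝓘(ℝ) ∞ ρ) (hρ_pos : ∀ x, 0 < ρ x)
    (hV : ContMDiff (𝓡 n) 𝓘(ℝ) ∞ V) (hV_nonneg : ∀ x, 0 ≤ V x)
    (T : EReal) (hT : 0 < T)
    (v : ℝ → Lp ℝ 2 (WeightedManifold.densityMeasure g Ψ ρ))
    (hv_W1 : ∀ t : ℝ, 0 < t → (t : EReal) < T →
      WeightedManifold.MemW1 g Ψ (fun x => ρ x + V x) (v t))
    (hv_diff : ∀ t : ℝ, 0 < t → (t : EReal) < T → DifferentiableAt ℝ v t)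
    (hv_init : Tendsto (fun t => Lp.negPart (v t)) (𝓝[>] 0) (𝓝 0))
    (hv_bdry : ∀ t : ℝ, 0 < t → (t : EReal) < T →
      WeightedManifold.NonnegModW10 g Ψ (fun x => ρ x + V x) (v t))
    (hv_super : ∀ s : ℝ, 0 < s → (s : EReal) < T →
      WeightedManifold.DistributionLE n
        (WeightedManifold.distSchrodinger g Ψ ρ V (WeightedManifold.toDistribution g (v s)))
        (WeightedManifold.toDistribution g
          (deriv v s : Lp ℝ 2 (WeightedManifold.densityMeasure g Ψ ρ)))) :
    ∀ t : ℝ, 0 < t → (t : EReal) < T →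
      ∀ᵐ x ∂(WeightedManifold.weightedVolume g Ψ), 0 ≤ v t x := by
  intro t ht htT
  have hκ : Continuous fun x => ρ x + V x := hρ.continuous.add hV.continuous
  have hκ_pos : ∀ x, 0 < ρ x + V x := fun x => add_pos_of_pos_of_nonneg (hρ_pos x) (hV_nonneg x)
  have hm := WeightedManifold.densityMeasure_eq g hΨ.continuous hΨ_pos hρ.continuous
  have hmac : WeightedManifold.densityMeasure g Ψ ρ ≪ WeightedManifold.riemannianVolume g := by
    rw [hm]
    exact WeightedManifold.weightedVolume_absolutelyContinuous g _
  have hmlf : IsLocallyFiniteMeasure (WeightedManifold.densityMeasure g Ψ ρ) := by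
    rw [hm]
    exact WeightedManifold.isLocallyFiniteMeasure_weightedVolume g (hΨ.mul hρ).continuous
  have hvol := WeightedManifold.riemannianVolume_absolutelyContinuous_densityMeasure g
    hΨ.continuous hΨ_pos hρ.continuous hρ_pos
  have henergy : ∀ δ : ℝ, 0 < δ → ∀ s : ℝ, 0 < s → (s : EReal) < T →
      0 ≤ ∫ x, WeightedManifold.trunc δ (-(v s x)) * deriv v s x
        ∂(WeightedManifold.densityMeasure g Ψ ρ) := by
    intro δ hδ s hs hsT
    obtain ⟨X, hX, hXi⟩ := (hv_W1 s hs hsT).exists_isLocalGradient hΨ.continuous hΨ_pos hκ hκ_pos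
    -- Relative to the measure `ρ μ` the potential `V` becomes `V / ρ`.
    refine WeightedManifold.integral_trunc_mul_nonneg (U := fun x => V x / ρ x) hδ hΨ.continuous
      hΨ_pos hmac (hV.div₀ hρ fun x => (hρ_pos x).ne')
      (fun x => div_nonneg (hV_nonneg x) (hρ_pos x).le) (Lp.memLp _) (Lp.memLp _) hX
      (WeightedManifold.isSquareIntegrable_of_lintegral_lt_top
        (WeightedManifold.weightedVolume_absolutelyContinuous g Ψ) hX.isMeasurableField hXi)
      (fun φ hφ hφ0 => WeightedManifold.weak_inequality_of_distributionLE hΨ hΨ_pos hρ hρ_pos hX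
        (hv_super s hs hsT) hφ hφ0) hκ hκ_pos (hv_bdry s hs hsT)
  -- Only the countably many values `δ = 1 / (k + 1)` are used, so the exceptional null sets can be
  -- united.
  have hae : ∀ᵐ x ∂(WeightedManifold.densityMeasure g Ψ ρ), ∀ k : ℕ,
      -(2 * (1 / ((k : ℝ) + 1))) ≤ v t x := by
    refine ae_all_iff.2 fun k => ?_
    have hk : 0 < 1 / ((k : ℝ) + 1) := Nat.one_div_pos_of_nat
    exact WeightedManifold.ae_neg_le_of_energy hk hv_diff hv_init (henergy _ hk) ht htT
  refine (WeightedManifold.weightedVolume_absolutelyContinuous g Ψ).ae_le (hvol.ae_le ?_)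
  filter_upwards [hae] with x hx
  have hlim : Tendsto (fun k : ℕ => -(2 * (1 / ((k : ℝ) + 1)))) atTop (𝓝 0) := by
    simpa using ((tendsto_one_div_add_atTop_nhds_zero_nat (𝕜 := ℝ)).const_mul 2).neg
  exact le_of_tendsto' hlim hx
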